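/- **Setting.** Let $\mathcal D=\{z\in\mathbb R^d:\|z\|\le R\}$, $d\ge 1$, $R>0$, let $G:\mathcal D\to\mathbb R^n$ be differentiable with Jacobian $\nabla G$, let $A\in\mathbb R^{m\times n}$, $z^*\in\mathcal D$, $y=AG(z^*)$, and put $F(z)=\|y-AG(z)\|^2$. Norms are Euclidean norms and operator norms. Assume * (A.1) $\|G(z)\|\le B$ for $z\in\mathcal D$; * (A.2) $\iota_G\|z-z'\|\le\|G(z)-G(z')\|\le\kappa_G\|z-z'\|$ for $z,z'\in\mathcal D$, where $0<\iota_G\le\kappa_G$; * (A.3) $\|\nabla G(z)-\nabla G(z')\|\le M\|z-z'\|$ for $z,z'\in\mathcal D$; * (strong smoothness) for some $\alpha>0$, $\gamma\ge0$: $\langle G(z)-G(z'),\nabla G(z)(z-z')\rangle\ge\alpha\|z-z'\|^2-\gamma$ for $z,z'\in\mathcal D$. For $\beta>0$ let $\pi(\mathrm dz)\propto e^{-\beta F(z)}\mathbf 1(z\in\mathcal D)\,\mathrm dz$, and suppose that $\pi$ satisfies the isoperimetric inequality with Cheeger constant $\rho>0$: for all measurable $\mathcal A\subseteq\mathcal D$,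 $$\liminf_{h\to0^+}\frac{\pi(\mathcal A_h)-\pi(\mathcal A)}{h}\ \ge\ \rho\min\{\pi(\mathcal A),1-\pi(\mathcal A)\},\qquad \mathcal A_h=\{u\in\mathcal D:\exists v\in\mathcal A,\ \|u-v\|\le h\}.$$ A probability measure $\mu_0$ on $\mathcal D$ is a $\lambda$-warm start with respect to $\pi$ if $\mu_0(\mathcal A)\le\lambda\,\pi(\mathcal A)$ for all measurable $\mathcal A\subseteq\mathcal D$. CS-SGLD with step size $\eta>0$ and radius $r=\sqrt{10\eta d/\beta}$ draws $z_0\sim\mu_0$ and, for $k\ge0$, forms $v=z_k-\eta\nabla F(z_k)+\sqrt{2\eta/\beta}\,\xi_k$ with independent $\xi_k\sim\mathcal N(0,I_d)$, and sets $z_{k+1}=v$ if $\|v-z_k\|\le r$ and $v\in\mathcal D$, and $z_{k+1}=z_k$ otherwise. Let $\mu_k$ be the law of $z_k$, and $\|\mu-\nu\|_{TV}=\sup_{\mathcal A}|\mu(\mathcal A)-\nu(\mathcal A)|$. **Theorem.** There are an absolute constant $c_0>0$ and, for all $R,B,\kappa_G>0$ and $M,S\ge0$, constants $c,c_1,c_2,c_3>0$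 depending only on $R,B,\kappa_G,M,S$, such that the following holds whenever $\|A\|\le S$ and the assumptions above are satisfied (for all $d,n,m,G,A,z^*,\iota_G,\alpha,\gamma,\beta,\rho$). Let $$0<\eta\le c\,\Bigl(\frac1d\wedge\frac{\rho^2}{\beta d^2}\wedge\frac1\beta\wedge\frac{\beta}{d^2}\Bigr),\qquad r=\sqrt{10\eta d/\beta},$$ and let $\mu_0$ be any $\lambda$-warm start with respect to $\pi$. Then: 1. For all $k\ge0$, $$\|\mu_k-\pi\|_{TV}\le\lambda(1-C_0\eta)^k+C_1\eta^{1/2},\qquad C_0=c_0\rho^2\beta^{-1},\quad C_1=c_1d\beta^{1/2}\rho^{-1}.$$ 2. In particular, let $\epsilon>0$ and $\tau>0$. If moreover $$\tau\,\frac{c_2\rho^2\epsilon^2}{d^2\beta}\le\eta\le\frac{c_2\rho^2\epsilon^2}{d^2\beta}\qquad\text{and}\qquad k\ge\frac{c_3}{\tau}\,\frac{d^2\beta^2}{\rho^4\epsilon^2}\,\log\frac{2\lambda}{\epsilon},$$ then $\|\mu_k-\pi\|_{TV}\le\epsilon$. -/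

import Mathlib

open MeasureTheory ProbabilityTheory Filter Topology Set
open scoped ENNReal

namespace CSSGLD

noncomputable section

/-- The latent domain `𝒟 = B(0, R) ⊂ ℝᵈ`, a closed Euclidean ball. -/
def domain (d : ℕ) (R : ℝ) : Set (EuclideanSpace ℝ (Fin d)) :=
  Metric.closedBall 0 R

/-- The Jacobian `∇G(z)` of `G : 𝒟 → ℝⁿ` at `z ∈ 𝒟`, as a linear map. The derivative is taken
within `𝒟`, so that only the values of `G` on `𝒟` matter. -/
def jacobian {d n : ℕ} (R : ℝ) (G : EuclideanSpace ℝ (Fin d) → EuclideanSpace ℝ (Fin n))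
    (z : EuclideanSpace ℝ (Fin d)) : EuclideanSpace ℝ (Fin d) →L[ℝ] EuclideanSpace ℝ (Fin n) :=
  fderivWithin ℝ G (domain d R) z

/-- (A.1) Boundedness: `‖G(z)‖ ≤ B` on `𝒟`. -/
def IsBoundedGen {d n : ℕ} (R B : ℝ)
    (G : EuclideanSpace ℝ (Fin d) → EuclideanSpace ℝ (Fin n)) : Prop :=
  ∀ z ∈ domain d R, ‖G z‖ ≤ B

/-- (A.2) Near-isometry: `ι ‖z - z'‖ ≤ ‖G(z) - G(z')‖ ≤ κ ‖z - z'‖` on `𝒟`, with `0 < ι ≤ κ`. -/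
def IsNearIsometry {d n : ℕ} (R ι κ : ℝ)
    (G : EuclideanSpace ℝ (Fin d) → EuclideanSpace ℝ (Fin n)) : Prop :=
  0 < ι ∧ ι ≤ κ ∧ ∀ z ∈ domain d R, ∀ z' ∈ domain d R,
    ι * ‖z - z'‖ ≤ ‖G z - G z'‖ ∧ ‖G z - G z'‖ ≤ κ * ‖z - z'‖

/-- (A.3) `G` is differentiable on `𝒟` and its Jacobian is `M`-Lipschitz there
(in operator norm). -/
def HasLipschitzJacobian {d n : ℕ} (R M : ℝ)
    (G : EuclideanSpace ℝ (Fin d) → EuclideanSpace ℝ (Fin n)) : Prop :=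
  DifferentiableOn ℝ G (domain d R) ∧ ∀ z ∈ domain d R, ∀ z' ∈ domain d R,
    ‖jacobian R G z - jacobian R G z'‖ ≤ M * ‖z - z'‖

/-- `(α, γ)`-strong smoothness, `α > 0`, `γ ≥ 0`:
`⟨G(z) - G(z'), ∇G(z)(z - z')⟩ ≥ α ‖z - z'‖² - γ` on `𝒟`. -/
def IsStronglySmooth {d n : ℕ} (R α γ : ℝ)
    (G : EuclideanSpace ℝ (Fin d) → EuclideanSpace ℝ (Fin n)) : Prop :=
  0 < α ∧ 0 ≤ γ ∧ ∀ z ∈ domain d R, ∀ z' ∈ domain d R,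
    α * ‖z - z'‖ ^ 2 - γ ≤ inner ℝ (G z - G z') (jacobian R G z (z - z'))

/-- The spectral norm `‖A‖` of a real matrix. -/
def specNorm {m n : ℕ} (A : Matrix (Fin m) (Fin n) ℝ) : ℝ :=
  ‖LinearMap.toContinuousLinearMap (Matrix.toEuclideanLin A)‖

/-- The reconstruction loss `F(z) = ‖y - A G(z)‖²`. -/
def loss {d n m : ℕ} (A : Matrix (Fin m) (Fin n) ℝ) (y : EuclideanSpace ℝ (Fin m))
    (G : EuclideanSpace ℝ (Fin d) → EuclideanSpace ℝ (Fin n))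
    (z : EuclideanSpace ℝ (Fin d)) : ℝ :=
  ‖y - Matrix.toEuclideanLin A (G z)‖ ^ 2

/-- The Gibbs probability measure `π(dz) ∝ exp(-β F(z)) 1(z ∈ 𝒟) dz`. -/
def gibbs {d : ℕ} (R β : ℝ) (F : EuclideanSpace ℝ (Fin d) → ℝ) :
    Measure (EuclideanSpace ℝ (Fin d)) :=
  (volume.restrict (domain d R)).tilted (fun z => -β * F z)

open Classical in
/-- One iteration of CS-SGLD from the state `u` with noise `ξ`: propose
`v = u - η ∇F(u) + √(2η/β) ξ`, move to `v` if `v ∈ B(u, r) ∩ 𝒟`, otherwise stay at `u`. -/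
def step {d : ℕ} (R β η r : ℝ) (F : EuclideanSpace ℝ (Fin d) → ℝ)
    (u ξ : EuclideanSpace ℝ (Fin d)) : EuclideanSpace ℝ (Fin d) :=
  let v := u - η • gradientWithin F (domain d R) u + √(2 * η / β) • ξ
  if v ∈ Metric.closedBall u r ∩ domain d R then v else u

/-- The law `μ_k` of the `k`-th iterate of CS-SGLD started from `z₀ ∼ μ₀`: at each iteration a
fresh standard Gaussian vector, independent of the current state, is drawn. -/
def law {d : ℕ} (R β η r : ℝ) (F : EuclideanSpace ℝ (Fin d) → ℝ)
    (μ₀ : Measure (EuclideanSpace ℝ (Fin d))) : ℕ → Measure (EuclideanSpace ℝ (Fin d))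
  | 0 => μ₀
  | k + 1 => ((law R β η r F μ₀ k).prod (stdGaussian (EuclideanSpace ℝ (Fin d)))).map
      (fun p => step R β η r F p.1 p.2)

/-- Total variation distance `sup_A |μ(A) - ν(A)|`. -/
def tvDist {X : Type*} [MeasurableSpace X] (μ ν : Measure X) : ℝ :=
  ⨆ A : {A : Set X // MeasurableSet A}, |μ.real A.1 - ν.real A.1|

/-- `μ₀` is a distribution on `𝒟` that is a `lam`-warm start with respect to `ν`:
`μ₀(A) ≤ lam · ν(A)` for all measurable `A ⊆ 𝒟`. -/
def IsWarmStart {d : ℕ} (R lam : ℝ) (μ₀ ν : Measure (EuclideanSpace ℝ (Fin d))) : Prop :=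
  μ₀ (domain d R)ᶜ = 0 ∧
    ∀ A ⊆ domain d R, MeasurableSet A → μ₀ A ≤ ENNReal.ofReal lam * ν A

/-- The enlargement `A_h = {u ∈ 𝒟 : ∃ v ∈ A, ‖u - v‖ ≤ h}`. -/
def enlarge {d : ℕ} (R : ℝ) (A : Set (EuclideanSpace ℝ (Fin d))) (h : ℝ) :
    Set (EuclideanSpace ℝ (Fin d)) :=
  {u | u ∈ domain d R ∧ ∃ v ∈ A, ‖u - v‖ ≤ h}

/-- `μ` satisfies the isoperimetric inequality on `𝒟` with Cheeger constant `ρ`. The lower limit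
is taken in `[0, ∞]`, since it may be infinite. -/
def HasCheegerConstant {d : ℕ} (R ρ : ℝ) (μ : Measure (EuclideanSpace ℝ (Fin d))) : Prop :=
  ∀ A ⊆ domain d R, MeasurableSet A →
    ENNReal.ofReal ρ * min (μ A) (1 - μ A) ≤
      liminf (fun h : ℝ => (μ (enlarge R A h) - μ A) / ENNReal.ofReal h) (𝓝[>] 0)

end

end CSSGLD

/-! Every law is tracked through its density with respect to the Gibbs measure `π`. Relative to `π`,
the chain jumps from u to v with density `jumpDens`, which is the Gaussian proposal divided by the
density of `π` and cut off to v in the ball with ‖v - u‖ ≤ r. Otherwise the chain stays put.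
Expanding the square in the Gaussian exponent turns e^{βF(v)} into e^{β(F(u)+F(v))/2}, up to the
second-order Taylor remainder of F and a difference of ‖∇F‖². Since βr² = 10ηd, both are of order
ηd. Hence `jumpDens` lies between a symmetric density s = `symDens` and (1 + 4Δ)s, where Δ =
`curvErr` is a constant times ηd.

The quantity that contracts is the variance V = ∫(f - 1)² dπ of the density f. The reversible kernel
lowers it by a multiple of the Dirichlet form of f - 1. Laziness is not needed: up to positive
weights s is a positive semidefinite Gaussian kernel minus its tail beyond r, so its quadratic form
is at least -1/5 times the squared norm (`symDens_quadForm_ge`). The perturbation tested against g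
involves only differences g(v) - g(u), so Cauchy–Schwarz bounds it by Δ‖f‖ times the square root of
the Dirichlet form of g. Absorbing that form leaves an error of order Δ² instead of Δ
(`variance_transfer_le`), which is what makes the bias O(√η).

The spectral gap comes from conductance. From points closer than σ/100, with σ² = 2η/β, the jump
densities overlap substantially (`sq_reachDens_le`). The points of A and of its complement from
which crossing is unlikely therefore form two separated sets (`separation`), and the isoperimetric
inequality forces mass between them. The conductance is thus of order ρσ (`conductance`), and the
discrete Cheeger inequality `cheeger_poincare` turns it into a gap of order ρ²η/β.

Altogether V_{k+1} ≤ (1 - x)V_k + 432Δ² with x of order ρ²η/β. Since V_0 ≤ λ² and total variation is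
at most √V, the rate is λ(1 - x/2)^k and the bias is √(432Δ²/x), of order d√(βη)/ρ. The second claim
balances these two terms. -/

namespace CSSGLD

/-! ### Dirichlet forms and variance contraction for perturbed reversible chains. -/

noncomputable section

/-- Bounded measurable real functions. -/
def BddMeas {X : Type*} [MeasurableSpace X] (f : X → ℝ) : Prop :=
  Measurable f ∧ ∃ C, ∀ x, |f x| ≤ C

namespace BddMeas

variable {X Y : Type*} [MeasurableSpace X] [MeasurableSpace Y] {f g : X → ℝ}

lemma const (c : ℝ) : BddMeas (fun _ : X => c) := ⟨measurable_const, |c|, fun _ => le_rfl⟩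

lemma add (hf : BddMeas f) (hg : BddMeas g) : BddMeas (fun x => f x + g x) := by
  obtain ⟨hf, C, hC⟩ := hf
  obtain ⟨hg, C', hC'⟩ := hg
  exact ⟨hf.add hg, C + C', fun x => (abs_add_le _ _).trans (add_le_add (hC x) (hC' x))⟩

lemma neg (hf : BddMeas f) : BddMeas (fun x => - f x) := by
  obtain ⟨hf, C, hC⟩ := hf
  exact ⟨hf.neg, C, fun x => by simpa using hC x⟩

lemma sub (hf : BddMeas f) (hg : BddMeas g) : BddMeas (fun x => f x - g x) := by
  simpa only [sub_eq_add_neg] using hf.add hg.neg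

lemma mul (hf : BddMeas f) (hg : BddMeas g) : BddMeas (fun x => f x * g x) := by
  obtain ⟨hf, C, hC⟩ := hf
  obtain ⟨hg, C', hC'⟩ := hg
  refine ⟨hf.mul hg, C * C', fun x => ?_⟩
  rw [abs_mul]
  exact mul_le_mul (hC x) (hC' x) (abs_nonneg _) ((abs_nonneg _).trans (hC x))

lemma pow (hf : BddMeas f) (n : ℕ) : BddMeas (fun x => f x ^ n) := by
  induction n with
  | zero => simpa using const 1
  | succ n ih => simpa only [pow_succ] using ih.mul hf

lemma comp (hf : BddMeas f) {φ : Y → X} (hφ : Measurable φ) : BddMeas (fun y => f (φ y)) :=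
  ⟨hf.1.comp hφ, hf.2.imp fun _ h _ => h _⟩

lemma fst (hf : BddMeas f) : BddMeas (fun z : X × Y => f z.1) := hf.comp measurable_fst

lemma snd (hf : BddMeas f) : BddMeas (fun z : Y × X => f z.2) := hf.comp measurable_snd

lemma integrable (hf : BddMeas f) (μ : Measure X) [IsFiniteMeasure μ] : Integrable f μ := by
  obtain ⟨C, hC⟩ := hf.2
  exact Integrable.of_bound hf.1.aestronglyMeasurable C (ae_of_all _ hC)

lemma integral_add (hf : BddMeas f) (hg : BddMeas g) (μ : Measure X) [IsFiniteMeasure μ] :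
    ∫ x, f x + g x ∂μ = ∫ x, f x ∂μ + ∫ x, g x ∂μ :=
  MeasureTheory.integral_add (hf.integrable μ) (hg.integrable μ)

lemma integral_sub (hf : BddMeas f) (hg : BddMeas g) (μ : Measure X) [IsFiniteMeasure μ] :
    ∫ x, f x - g x ∂μ = ∫ x, f x ∂μ - ∫ x, g x ∂μ :=
  MeasureTheory.integral_sub (hf.integrable μ) (hg.integrable μ)

lemma const_mul (hf : BddMeas f) (c : ℝ) : BddMeas (fun x => c * f x) := (const c).mul hf

lemma integral_right {k : X × Y → ℝ} (hk : BddMeas k) (μ : Measure Y) [IsProbabilityMeasure μ] :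
    BddMeas (fun x => ∫ y, k (x, y) ∂μ) := by
  obtain ⟨C, hC⟩ := hk.2
  refine ⟨(hk.1.stronglyMeasurable.integral_prod_right' (ν := μ)).measurable, C, fun x => ?_⟩
  simpa using norm_integral_le_of_norm_le_const (μ := μ) (f := fun y => k (x, y))
    (ae_of_all _ fun y => hC (x, y))

lemma integral_left {k : X × Y → ℝ} (hk : BddMeas k) (μ : Measure X) [IsProbabilityMeasure μ] :
    BddMeas (fun y => ∫ x, k (x, y) ∂μ) :=
  (hk.comp (φ := Prod.swap) measurable_swap).integral_right μ

lemma indicator_one {A : Set X} (hA : MeasurableSet A) : BddMeas (A.indicator (1 : X → ℝ)) := by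
  refine ⟨measurable_one.indicator hA, 1, fun x => ?_⟩
  by_cases hx : x ∈ A <;> simp [hx]

end BddMeas

variable {X : Type*} [MeasurableSpace X]

lemma sq_integral_mul_le (μ : Measure X) [IsFiniteMeasure μ] {w a b : X → ℝ} (hw : BddMeas w)
    (ha : BddMeas a) (hb : BddMeas b) (hw0 : ∀ x, 0 ≤ w x) :
    (∫ x, w x * a x * b x ∂μ) ^ 2 ≤ (∫ x, w x * a x ^ 2 ∂μ) * ∫ x, w x * b x ^ 2 ∂μ := by
  have key : ∀ l : ℝ, 0 ≤ (∫ x, w x * b x ^ 2 ∂μ) * (l * l) + (2 * ∫ x, w x * a x * b x ∂μ) * l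
      + ∫ x, w x * a x ^ 2 ∂μ := by
    intro l
    have h : 0 ≤ ∫ x, w x * (a x + l * b x) ^ 2 ∂μ :=
      integral_nonneg fun x => mul_nonneg (hw0 x) (sq_nonneg _)
    have e : ∀ x, w x * (a x + l * b x) ^ 2
        = (l * l) * (w x * b x ^ 2) + (2 * l) * (w x * a x * b x) + w x * a x ^ 2 := by
      intro x; ring
    simp only [e] at h
    rw [integral_add, integral_add, integral_const_mul, integral_const_mul] at h
    · linarith
    · exact ((hw.mul (hb.pow 2)).integrable μ).const_mul _
    · exact (((hw.mul ha).mul hb).integrable μ).const_mul _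
    · exact (((hw.mul (hb.pow 2)).integrable μ).const_mul _).add
        ((((hw.mul ha).mul hb).integrable μ).const_mul _)
    · exact (hw.mul (ha.pow 2)).integrable μ
  have := discrim_le_zero key
  rw [discrim] at this
  nlinarith

/-- The bilinear Dirichlet form of the jump kernel with density `s`. -/
def dirichlet (π : Measure X) (s : X × X → ℝ) (f g : X → ℝ) : ℝ :=
  (1 / 2) * ∫ z, s z * (f z.1 - f z.2) * (g z.1 - g z.2) ∂(π.prod π)

/-- Evolution of densities (with respect to `π`) under the Markov chain which jumps from `u` to `v`
with density `t (u, v)` and otherwise stays at `u`. -/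
def transfer (π : Measure X) (t : X × X → ℝ) (f : X → ℝ) (v : X) : ℝ :=
  ∫ u, t (u, v) * f u ∂π + (1 - ∫ u, t (v, u) ∂π) * f v

variable (π : Measure X) [IsProbabilityMeasure π] {s t : X × X → ℝ} {f g h : X → ℝ}

lemma BddMeas.transfer (hf : BddMeas f) (ht : BddMeas t) : BddMeas (transfer π t f) :=
  ((ht.mul hf.fst).integral_left π).add (((BddMeas.const 1).sub (ht.integral_right π)).mul hf)

/-- Weak form of one step: the holding term cancels, so a test function changes only through its
increments along jumps. This is what later allows perturbations to be bounded by Dirichlet forms. -/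
lemma integral_mul_transfer (ht : BddMeas t) (hf : BddMeas f) (hg : BddMeas g) :
    ∫ v, g v * transfer π t f v ∂π
      = ∫ v, g v * f v ∂π + ∫ z, t z * f z.1 * (g z.2 - g z.1) ∂(π.prod π) := by
  have h1 : ∫ z, t z * f z.1 * g z.2 ∂(π.prod π) = ∫ v, g v * ∫ u, t (u, v) * f u ∂π ∂π := by
    rw [integral_prod_symm _ (((ht.mul hf.fst).mul hg.snd).integrable _)]
    refine integral_congr_ae (ae_of_all _ fun v => ?_)
    simp only
    rw [integral_mul_const, mul_comm]
  have h2 : ∫ z, t z * f z.1 * g z.1 ∂(π.prod π) = ∫ v, g v * ((∫ u, t (v, u) ∂π) * f v) ∂π := by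
    rw [integral_prod _ (((ht.mul hf.fst).mul hg.fst).integrable _)]
    refine integral_congr_ae (ae_of_all _ fun v => ?_)
    simp only
    rw [integral_mul_const, integral_mul_const, mul_comm]
  simp only [mul_sub]
  rw [integral_sub (((ht.mul hf.fst).mul hg.snd).integrable _)
    (((ht.mul hf.fst).mul hg.fst).integrable _), h1, h2, ← integral_sub, ← integral_add]
  · refine integral_congr_ae (ae_of_all _ fun v => ?_)
    simp only [CSSGLD.transfer]
    ring
  · exact (hg.mul hf).integrable π
  · exact ((hg.mul ((ht.mul hf.fst).integral_left π)).sub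
      (hg.mul ((ht.integral_right π).mul hf))).integrable π
  · exact (hg.mul ((ht.mul hf.fst).integral_left π)).integrable π
  · exact (hg.mul ((ht.integral_right π).mul hf)).integrable π

/-- Swapping the two variables and averaging turns the increment term of the weak form into half the
product of the increments of f and g. -/
lemma integral_mul_transfer_symm (hs : BddMeas s) (hsymm : ∀ u v, s (u, v) = s (v, u))
    (hf : BddMeas f) (hg : BddMeas g) :
    ∫ v, g v * transfer π s f v ∂π = ∫ v, g v * f v ∂π - dirichlet π s f g := by
  rw [integral_mul_transfer π hs hf hg, dirichlet]
  have h1 : ∫ z, s z * f z.1 * (g z.2 - g z.1) ∂(π.prod π)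
      = ∫ z, s z * f z.2 * (g z.1 - g z.2) ∂(π.prod π) := by
    rw [← integral_prod_swap]
    refine integral_congr_ae (ae_of_all _ fun z => ?_)
    simp only [Prod.swap]
    rw [hsymm z.2 z.1]
  have h2 : ∫ z, s z * (f z.1 - f z.2) * (g z.1 - g z.2) ∂(π.prod π)
      = - ∫ z, s z * f z.1 * (g z.2 - g z.1) ∂(π.prod π)
        - ∫ z, s z * f z.2 * (g z.1 - g z.2) ∂(π.prod π) := by
    rw [← integral_neg, ← integral_sub]
    · refine integral_congr_ae (ae_of_all _ fun z => ?_)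
      simp only
      ring
    · exact ((hs.mul hf.fst).mul (hg.snd.sub hg.fst)).neg.integrable _
    · exact ((hs.mul hf.snd).mul (hg.fst.sub hg.snd)).integrable _
  rw [h2, ← h1]
  ring

omit [IsProbabilityMeasure π] in
lemma dirichlet_self (s : X × X → ℝ) (f : X → ℝ) :
    dirichlet π s f f = (1 / 2) * ∫ z, s z * (f z.1 - f z.2) ^ 2 ∂(π.prod π) := by
  rw [dirichlet]
  congr 2
  ext z
  ring

omit [IsProbabilityMeasure π] in
lemma dirichlet_self_nonneg (hs0 : ∀ z, 0 ≤ s z) (f : X → ℝ) : 0 ≤ dirichlet π s f f := by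
  rw [dirichlet_self]
  have : 0 ≤ ∫ z, s z * (f z.1 - f z.2) ^ 2 ∂(π.prod π) :=
    integral_nonneg fun z => mul_nonneg (hs0 z) (sq_nonneg _)
  linarith

lemma sq_dirichlet_le (hs : BddMeas s) (hs0 : ∀ z, 0 ≤ s z) (hf : BddMeas f) (hg : BddMeas g) :
    dirichlet π s f g ^ 2 ≤ dirichlet π s f f * dirichlet π s g g := by
  have := sq_integral_mul_le (π.prod π) hs (hf.fst.sub hf.snd) (hg.fst.sub hg.snd) hs0
  rw [dirichlet_self, dirichlet_self, dirichlet]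
  linarith

lemma integral_fst_sq_le (hs : BddMeas s) (hrow : ∀ u, ∫ v, s (u, v) ∂π ≤ 1) (hf : BddMeas f) :
    ∫ z, s z * f z.1 ^ 2 ∂(π.prod π) ≤ ∫ u, f u ^ 2 ∂π := by
  rw [integral_prod _ ((hs.mul (hf.fst.pow 2)).integrable _)]
  refine integral_mono (((hs.mul (hf.fst.pow 2)).integral_right π).integrable π)
    ((hf.pow 2).integrable π) fun u => ?_
  simp only
  rw [integral_mul_const]
  nlinarith [hrow u, sq_nonneg (f u)]

/-- If the jump operator is bounded below by `-1/5`, the Dirichlet form is at most `6/5` times the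
squared norm. -/
lemma dirichlet_self_le (hs : BddMeas s) (hsymm : ∀ u v, s (u, v) = s (v, u))
    (hrow : ∀ u, ∫ v, s (u, v) ∂π ≤ 1)
    (hlow : ∀ f, BddMeas f →
      -(1 / 5) * ∫ u, f u ^ 2 ∂π ≤ ∫ z, s z * f z.1 * f z.2 ∂(π.prod π))
    (hf : BddMeas f) : dirichlet π s f f ≤ 6 / 5 * ∫ u, f u ^ 2 ∂π := by
  -- In s(f(u) - f(v))² the two square terms contribute at most one squared norm each, and the cross
  -- term at most 2/5 of one; halving gives 6/5.
  have h1 := integral_fst_sq_le π hs hrow hf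
  have h2 : ∫ z, s z * f z.2 ^ 2 ∂(π.prod π) = ∫ z, s z * f z.1 ^ 2 ∂(π.prod π) := by
    rw [← integral_prod_swap]
    refine integral_congr_ae (ae_of_all _ fun z => ?_)
    simp only [Prod.swap]
    rw [hsymm z.2 z.1]
  have h3 := hlow f hf
  have h4 : ∫ z, s z * (f z.1 - f z.2) ^ 2 ∂(π.prod π)
      = ∫ z, s z * f z.1 ^ 2 ∂(π.prod π) + ∫ z, s z * f z.2 ^ 2 ∂(π.prod π)
        - 2 * ∫ z, s z * f z.1 * f z.2 ∂(π.prod π) := by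
    have i1 := hs.mul (hf.fst.pow 2)
    have i2 := hs.mul (hf.snd.pow 2)
    have i3 := (hs.mul hf.fst).mul hf.snd
    rw [← integral_const_mul, ← i1.integral_add i2, ← (i1.add i2).integral_sub (i3.const_mul 2)]
    refine integral_congr_ae (ae_of_all _ fun z => ?_)
    simp only
    ring
  rw [dirichlet_self, h4, h2]
  linarith

omit [IsProbabilityMeasure π] in
lemma transfer_one (hsymm : ∀ u v, s (u, v) = s (v, u)) (v : X) :
    transfer π s (fun _ => 1) v = 1 := by
  simp [transfer, hsymm _ v]

lemma integral_transfer (ht : BddMeas t) (hf : BddMeas f) :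
    ∫ v, transfer π t f v ∂π = ∫ v, f v ∂π := by
  simpa using integral_mul_transfer π ht hf (BddMeas.const 1)

/-- One step of a perturbed reversible chain contracts the variance of a density, up to an error
which is quadratic in the relative perturbation of the jump density. -/
lemma variance_transfer_le (hs : BddMeas s) (ht : BddMeas t)
    (hsymm : ∀ u v, s (u, v) = s (v, u)) (hs0 : ∀ z, 0 ≤ s z) {δ : ℝ}
    (hst : ∀ z, s z ≤ t z) (hts : ∀ z, t z ≤ (1 + δ) * s z)
    (hrow : ∀ u, ∫ v, t (u, v) ∂π ≤ 1)
    (hlow : ∀ f, BddMeas f →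
      -(1 / 5) * ∫ u, f u ^ 2 ∂π ≤ ∫ z, s z * f z.1 * f z.2 ∂(π.prod π))
    (hf : BddMeas f) (hδ : 0 ≤ δ) :
    ∫ v, (transfer π t f v - 1) ^ 2 ∂π ≤ ∫ v, (f v - 1) ^ 2 ∂π
      - 2 / 5 * dirichlet π s (fun v => f v - 1) (fun v => f v - 1)
      + 27 * δ ^ 2 * ∫ v, f v ^ 2 ∂π := by
  have hrow' : ∀ u, ∫ v, s (u, v) ∂π ≤ 1 := fun u =>
    (integral_mono ((hs.comp measurable_prodMk_left).integrable π)
      ((ht.comp measurable_prodMk_left).integrable π) fun v => hst (u, v)).trans (hrow u)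
  -- Decomposition T_t f - 1 = h - D + e, where D is the increment of the reversible step on h = f -
  -- 1 and e is the effect of replacing s by t.
  set h : X → ℝ := fun v => f v - 1 with hh
  have bh : BddMeas h := hf.sub (BddMeas.const 1)
  set D : X → ℝ := fun v => h v - transfer π s h v with hD
  have bD : BddMeas D := bh.sub (bh.transfer π hs)
  set e : X → ℝ := fun v => transfer π t f v - transfer π s f v with he
  have be : BddMeas e := (hf.transfer π ht).sub (hf.transfer π hs)
  set N := ∫ v, f v ^ 2 ∂π with hN
  have hN0 : 0 ≤ N := integral_nonneg fun v => sq_nonneg _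
  have pairD : ∀ g, BddMeas g → ∫ v, g v * D v ∂π = dirichlet π s h g := by
    intro g bg
    have := integral_mul_transfer_symm π hs hsymm bh bg
    simp only [hD, mul_sub]
    rw [integral_sub ((bg.mul bh).integrable π) ((bg.mul (bh.transfer π hs)).integrable π), this]
    ring
  -- Cauchy–Schwarz with weight t - s, which lies between 0 and δ s: one factor gives δN, the other
  -- twice δ times the Dirichlet form of g.
  have paire : ∀ g, BddMeas g →
      (∫ v, g v * e v ∂π) ^ 2 ≤ 2 * δ ^ 2 * N * dirichlet π s g g := by
    intro g bg
    have e1 : ∫ v, g v * e v ∂π = ∫ z, (t z - s z) * f z.1 * (g z.2 - g z.1) ∂(π.prod π) := by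
      simp only [he, mul_sub]
      rw [integral_sub ((bg.mul (hf.transfer π ht)).integrable π)
        ((bg.mul (hf.transfer π hs)).integrable π), integral_mul_transfer π ht hf bg,
        integral_mul_transfer π hs hf bg, add_sub_add_left_eq_sub, ← integral_sub]
      · refine integral_congr_ae (ae_of_all _ fun z => ?_)
        simp only
        ring
      · exact ((ht.mul hf.fst).mul (bg.snd.sub bg.fst)).integrable _
      · exact ((hs.mul hf.fst).mul (bg.snd.sub bg.fst)).integrable _
    have c1 := sq_integral_mul_le (π.prod π) (ht.sub hs) hf.fst (bg.snd.sub bg.fst)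
      (fun z => sub_nonneg.2 (hst z))
    have c2 : ∫ z, (t z - s z) * f z.1 ^ 2 ∂(π.prod π) ≤ δ * N := by
      have : ∫ z, (t z - s z) * f z.1 ^ 2 ∂(π.prod π) ≤
          ∫ z, δ * (s z * f z.1 ^ 2) ∂(π.prod π) := by
        refine integral_mono (((ht.sub hs).mul (hf.fst.pow 2)).integrable _)
          (((hs.mul (hf.fst.pow 2)).integrable _).const_mul _) fun z => ?_
        simp only
        nlinarith [hts z, sq_nonneg (f z.1)]
      rw [integral_const_mul] at this
      exact this.trans (mul_le_mul_of_nonneg_left (integral_fst_sq_le π hs hrow' hf) hδ)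
    have c3 : ∫ z, (t z - s z) * (g z.2 - g z.1) ^ 2 ∂(π.prod π) ≤ δ * (2 * dirichlet π s g g) := by
      have : ∫ z, (t z - s z) * (g z.2 - g z.1) ^ 2 ∂(π.prod π) ≤
          ∫ z, δ * (s z * (g z.1 - g z.2) ^ 2) ∂(π.prod π) := by
        refine integral_mono (((ht.sub hs).mul ((bg.snd.sub bg.fst).pow 2)).integrable _)
          (((hs.mul ((bg.fst.sub bg.snd).pow 2)).integrable _).const_mul _) fun z => ?_
        simp only
        nlinarith [hts z, sq_nonneg (g z.2 - g z.1)]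
      rw [integral_const_mul] at this
      rw [dirichlet_self]
      linarith
    have n3 : 0 ≤ ∫ z, (t z - s z) * (g z.2 - g z.1) ^ 2 ∂(π.prod π) :=
      integral_nonneg fun z => mul_nonneg (sub_nonneg.2 (hst z)) (sq_nonneg _)
    rw [e1]
    calc _ ≤ _ := c1
      _ ≤ (δ * N) * (δ * (2 * dirichlet π s g g)) :=
        mul_le_mul c2 c3 n3 (mul_nonneg hδ hN0)
      _ = _ := by ring
  have top : ∀ g, BddMeas g → dirichlet π s g g ≤ 6 / 5 * ∫ u, g u ^ 2 ∂π :=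
    fun g bg => dirichlet_self_le π hs hsymm hrow' hlow bg
  set E := dirichlet π s h h with hE
  have hE0 : 0 ≤ E := dirichlet_self_nonneg π hs0 h
  set W := ∫ v, D v ^ 2 ∂π with hW
  have hW0 : 0 ≤ W := integral_nonneg fun v => sq_nonneg _
  set U := ∫ v, e v ^ 2 ∂π with hU
  have hU0 : 0 ≤ U := integral_nonneg fun v => sq_nonneg _
  -- Testing D against itself gives W² ≤ E · dirichlet(D, D) ≤ (6/5) E W, and one factor W cancels.
  -- The bound on U uses the same self-testing with e.
  have hWE : W ≤ 6 / 5 * E := by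
    have h1 : W = dirichlet π s h D := by rw [← pairD D bD, hW]; simp only [sq]
    have h2 := sq_dirichlet_le π hs hs0 bh bD
    rw [← h1, ← hE] at h2
    have h3 := top D bD
    rcases hW0.eq_or_lt with h0 | h0
    · rw [← h0]; positivity
    · have : W * W ≤ (6 / 5 * E) * W := by nlinarith
      exact le_of_mul_le_mul_right this h0
  have hUN : U ≤ 12 / 5 * (δ ^ 2 * N) := by
    have h1 := paire e be
    have h3 := top e be
    simp only [← sq] at h1
    rw [← hU] at h1 h3
    have hp : 0 ≤ δ ^ 2 * N := by positivity
    rcases hU0.eq_or_lt with h0 | h0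
    · rw [← h0]; positivity
    · have : U * U ≤ (12 / 5 * (δ ^ 2 * N)) * U := by nlinarith
      exact le_of_mul_le_mul_right this h0
  have hp : 0 ≤ δ ^ 2 * N := by positivity
  -- Weighted AM-GM: 4 · 2δ²N E = 4 · (E/5) · (10 δ²N). In `X2` the form of D is at most (36/25) E,
  -- and 10 becomes 72/5.
  have X1 : 2 * ∫ v, h v * e v ∂π ≤ 1 / 5 * E + 10 * (δ ^ 2 * N) := by
    have h1 := paire h bh
    rw [← hE] at h1
    refine (le_abs_self _).trans (abs_le_of_sq_le_sq ?_ (by positivity))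
    nlinarith [sq_nonneg (1 / 5 * E - 10 * (δ ^ 2 * N))]
  have X2 : -(2 * ∫ v, D v * e v ∂π) ≤ 1 / 5 * E + 72 / 5 * (δ ^ 2 * N) := by
    have h1 := paire D bD
    have h3 := top D bD
    rw [← hW] at h3
    have h4 : dirichlet π s D D ≤ 36 / 25 * E := by linarith
    have h5 := mul_le_mul_of_nonneg_left h4 hp
    refine (le_abs_self _).trans (abs_le_of_sq_le_sq ?_ (by positivity))
    nlinarith [sq_nonneg (1 / 5 * E - 72 / 5 * (δ ^ 2 * N))]
  -- The symmetric kernel fixes the constant density 1, so it acts on f - 1 as on f.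
  have lin : ∀ v, transfer π s f v = transfer π s h v + 1 := by
    intro v
    have hone := transfer_one π hsymm v
    have e1 : ∫ u, s (u, v) * f u ∂π = ∫ u, s (u, v) * h u ∂π + ∫ u, s (u, v) * 1 ∂π := by
      rw [← integral_add]
      · refine integral_congr_ae (ae_of_all _ fun z => ?_)
        simp only [hh]
        ring
      · exact ((hs.comp measurable_prodMk_right).mul bh).integrable π
      · exact ((hs.comp measurable_prodMk_right).mul (BddMeas.const 1)).integrable π
    simp only [transfer] at hone ⊢
    rw [e1]
    have : f v = h v + 1 := by simp [hh]
    rw [this]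
    linarith
  have expand : ∫ v, (transfer π t f v - 1) ^ 2 ∂π = ∫ v, h v ^ 2 ∂π + W + U
      - 2 * ∫ v, h v * D v ∂π + 2 * ∫ v, h v * e v ∂π - 2 * ∫ v, D v * e v ∂π := by
    have i1 := bh.pow 2
    have i2 := bD.pow 2
    have i3 := be.pow 2
    have i4 := (bh.mul bD).const_mul 2
    have i5 := (bh.mul be).const_mul 2
    have i6 := (bD.mul be).const_mul 2
    rw [hW, hU, ← integral_const_mul, ← integral_const_mul, ← integral_const_mul,
      ← i1.integral_add i2, ← (i1.add i2).integral_add i3, ← ((i1.add i2).add i3).integral_sub i4,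
      ← (((i1.add i2).add i3).sub i4).integral_add i5,
      ← ((((i1.add i2).add i3).sub i4).add i5).integral_sub i6]
    refine integral_congr_ae (ae_of_all _ fun v => ?_)
    have : transfer π t f v - 1 = h v - D v + e v := by
      simp only [he, hD, lin v]; ring
    simp only [this]
    ring
  rw [expand, pairD h bh, ← hE]
  -- The coefficient of E is 6/5 - 2 + 1/5 + 1/5 = -2/5; that of δ²N is 12/5 + 10 + 72/5, below 27.
  nlinarith

end

end CSSGLD

/-! ### Discrete Cheeger inequality for jump kernels. -/

namespace CSSGLD

variable {X : Type*} [MeasurableSpace X] (π : Measure X) [IsProbabilityMeasure π] {s : X × X → ℝ}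
  {f g h : X → ℝ}

/-- The quantile is the infimum of the levels at which the distribution function reaches q. Strictly
monotone sequences of levels approaching it from either side give the two inequalities by continuity
of the measure. -/
lemma exists_quantile (hf : BddMeas f) {q : ℝ} (hq0 : 0 < q) (hq1 : q < 1) :
    ∃ m, π.real {x | f x < m} ≤ q ∧ q ≤ π.real {x | f x ≤ m} := by
  obtain ⟨hfm, C, hC⟩ := hf
  set S : Set ℝ := {x | q ≤ π.real {y | f y ≤ x}} with hS
  have hne : S.Nonempty := by
    refine ⟨C, ?_⟩
    have : {y | f y ≤ C} = univ := eq_univ_of_forall fun y => (le_abs_self _).trans (hC y)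
    simp only [hS, mem_ofPred_eq, this, probReal_univ]
    exact hq1.le
  have hbdd : BddBelow S := by
    refine ⟨-C - 1, fun x hx => ?_⟩
    by_contra! hlt
    have : {y | f y ≤ x} = ∅ := by
      refine eq_empty_of_forall_notMem fun y hy => ?_
      have := neg_le_of_abs_le (hC y)
      simp only [mem_ofPred_eq] at hy
      linarith
    simp only [hS, mem_ofPred_eq, this, measureReal_empty] at hx
    linarith
  have hlt : ∀ x < sInf S, π.real {y | f y ≤ x} ≤ q := fun x hx =>
    by
    have h := notMem_of_lt_csInf hx hbdd
    simp only [hS, mem_ofPred_eq, not_le] at h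
    exact h.le
  have hgt : ∀ x > sInf S, q ≤ π.real {y | f y ≤ x} := by
    intro x hx
    obtain ⟨y, hy, hyx⟩ := exists_lt_of_csInf_lt hne hx
    exact le_trans hy (measureReal_mono fun z (hz : f z ≤ y) => hz.trans hyx.le)
  set m := sInf S
  obtain ⟨u, humono, hum, hutend⟩ := exists_seq_strictMono_tendsto m
  obtain ⟨w, hwanti, hwm, hwtend⟩ := exists_seq_strictAnti_tendsto m
  refine ⟨m, ?_, ?_⟩
  · have e : {x | f x < m} = ⋃ n, {x | f x ≤ u n} := by
      ext x
      simp only [mem_ofPred_eq, mem_iUnion]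
      refine ⟨fun hx => ?_, fun ⟨n, hn⟩ => hn.trans_lt (hum n)⟩
      exact ((hutend.eventually_const_lt hx).mono fun n hn => hn.le).exists
    have ht := tendsto_measure_iUnion_atTop (μ := π) (s := fun n => {x | f x ≤ u n})
      (fun i j hij x (hx : f x ≤ u i) => hx.trans (humono.monotone hij))
    rw [← e] at ht
    have ht' := (ENNReal.tendsto_toReal (measure_ne_top π _)).comp ht
    exact le_of_tendsto' ht' fun n => hlt _ (hum n)
  · have e : {x | f x ≤ m} = ⋂ n, {x | f x ≤ w n} := by
      ext x
      simp only [mem_ofPred_eq, mem_iInter]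
      exact ⟨fun hx n => hx.trans (hwm n).le, fun hx => ge_of_tendsto' hwtend hx⟩
    have ht := tendsto_measure_iInter_atTop (μ := π) (s := fun n => {x | f x ≤ w n})
      (fun n => (measurableSet_le hfm measurable_const).nullMeasurableSet)
      (fun i j hij x (hx : f x ≤ w j) => hx.trans (hwanti.antitone hij))
      ⟨0, measure_ne_top π _⟩
    rw [← e] at ht
    have ht' := (ENNReal.tendsto_toReal (measure_ne_top π _)).comp ht
    exact ge_of_tendsto' ht' fun n => hgt _ (hwm n)

/-- Ergodic flow from `A` to its complement. -/
noncomputable def flow (π : Measure X) (s : X × X → ℝ) (A : Set X) : ℝ :=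
  ∫ z, s z * (A.indicator 1 z.1 * Aᶜ.indicator 1 z.2) ∂(π.prod π)

lemma integral_superlevel {a b C : ℝ} (ha : 0 ≤ a) (hb : b ≤ C) :
    ∫ t in Ico 0 C, (Ico a b).indicator (1 : ℝ → ℝ) t = max (b - a) 0 := by
  rw [integral_indicator_one measurableSet_Ico, measureReal_restrict_apply measurableSet_Ico,
    inter_eq_left.2 (Ico_subset_Ico ha hb), Real.volume_real_Ico]

/-- Coarea formula: the positive part of f(u) - f(v) is the length of the set of levels t with f(v)
≤ t < f(u), and Fubini turns the integral into the flow across superlevel sets. -/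
lemma integral_mul_posPart_sub (hs : BddMeas s) (hf : Measurable f) (hf0 : ∀ x, 0 ≤ f x) {C : ℝ}
    (hC : ∀ x, f x ≤ C) :
    ∫ z, s z * max (f z.1 - f z.2) 0 ∂(π.prod π) = ∫ t in Ico 0 C, flow π s {x | t < f x} := by
  have b : BddMeas (fun p : (X × X) × ℝ =>
      s p.1 * (Ico (f p.1.2) (f p.1.1)).indicator (1 : ℝ → ℝ) p.2) := by
    refine hs.fst.mul ?_
    have m1 : Measurable fun p : (X × X) × ℝ => f p.1.2 := by fun_prop
    have m2 : Measurable fun p : (X × X) × ℝ => f p.1.1 := by fun_prop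
    exact BddMeas.indicator_one (A := {p : (X × X) × ℝ | p.2 ∈ Ico (f p.1.2) (f p.1.1)})
      ((measurableSet_le m1 measurable_snd).inter (measurableSet_lt measurable_snd m2))
  have sw := integral_integral_swap (μ := π.prod π) (ν := volume.restrict (Ico 0 C))
    (f := fun z t => s z * (Ico (f z.2) (f z.1)).indicator (1 : ℝ → ℝ) t) (b.integrable _)
  simp only [integral_const_mul, integral_superlevel (hf0 _) (hC _)] at sw
  rw [sw]
  refine integral_congr_ae (ae_of_all _ fun t => ?_)
  refine integral_congr_ae (ae_of_all _ fun z => ?_)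
  simp only [indicator, mem_Ico, mem_ofPred_eq, mem_compl_iff, Pi.one_apply, not_lt]
  by_cases h1 : t < f z.1 <;> by_cases h2 : f z.2 ≤ t <;> simp [h1, h2]

/-- Cheeger's argument: the coarea formula is applied to g², whose superlevel sets have mass at most
1/2, so the flow bound sees the mass of the set itself. Then |g(u)² - g(v)²| = |g(u) - g(v)|(g(u) +
g(v)) and Cauchy–Schwarz give (ΦN)² ≤ 2E · 4N. -/
lemma sq_norm_le_dirichlet (hs : BddMeas s) (hsymm : ∀ u v, s (u, v) = s (v, u))
    (hs0 : ∀ z, 0 ≤ s z) (hrow : ∀ u, ∫ v, s (u, v) ∂π ≤ 1) {Φ : ℝ} (hΦ : 0 ≤ Φ)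
    (hflow : ∀ A, MeasurableSet A → Φ * min (π.real A) (π.real Aᶜ) ≤ flow π s A)
    (hg : BddMeas g) (hg0 : ∀ x, 0 ≤ g x) (hmed : π.real {x | 0 < g x} ≤ 1 / 2) :
    Φ ^ 2 / 8 * ∫ x, g x ^ 2 ∂π ≤ dirichlet π s g g := by
  have bf := hg.pow 2
  obtain ⟨C, hC⟩ := bf.2
  have hC' : ∀ x, g x ^ 2 ≤ C := fun x => (le_abs_self _).trans (hC x)
  set N := ∫ x, g x ^ 2 ∂π with hN
  have hN0 : 0 ≤ N := integral_nonneg fun x => sq_nonneg _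
  set E := dirichlet π s g g with hE
  have co := integral_mul_posPart_sub π hs bf.1 (fun x => sq_nonneg (g x)) hC'
  -- Layer-cake formula for ∫ g² compared with the coarea formula level by level.
  have co1 : Φ * N ≤ ∫ t in Ico 0 C, flow π s {x | t < g x ^ 2} := by
    have bj : BddMeas (fun p : X × ℝ => {p : X × ℝ | p.2 < g p.1 ^ 2}.indicator (1 : X × ℝ → ℝ) p) :=
      BddMeas.indicator_one (measurableSet_lt measurable_snd (bf.1.comp measurable_fst))
    have sw := integral_integral_swap (μ := π) (ν := volume.restrict (Ico 0 C))
      (f := fun x t => {p : X × ℝ | p.2 < g p.1 ^ 2}.indicator (1 : X × ℝ → ℝ) (x, t))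
      (bj.integrable _)
    have e1 : ∀ x, ∫ t in Ico 0 C, {p : X × ℝ | p.2 < g p.1 ^ 2}.indicator (1 : X × ℝ → ℝ) (x, t)
        = g x ^ 2 := by
      intro x
      have := integral_superlevel (a := 0) (b := g x ^ 2) le_rfl (hC' x)
      rw [sub_zero, max_eq_left (sq_nonneg _)] at this
      rw [← this]
      refine setIntegral_congr_fun measurableSet_Ico fun t ht => ?_
      simp [indicator, ht.1]
    have e2 : ∀ t, ∫ x, {p : X × ℝ | p.2 < g p.1 ^ 2}.indicator (1 : X × ℝ → ℝ) (x, t) ∂π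
        = π.real {x | t < g x ^ 2} := fun t =>
      integral_indicator_one (measurableSet_lt measurable_const bf.1)
    simp only [e1, e2] at sw
    rw [hN, sw, ← integral_const_mul]
    have bl : BddMeas (fun t => π.real {x | t < g x ^ 2}) := by
      simp only [← e2]
      exact bj.integral_left π
    have bF : BddMeas (fun p : ℝ × (X × X) => s p.2 * ({x | p.1 < g x ^ 2}.indicator 1 p.2.1 *
        {x | p.1 < g x ^ 2}ᶜ.indicator 1 p.2.2)) := by
      refine hs.snd.mul ((BddMeas.indicator_one (A := {p : ℝ × (X × X) | p.1 < g p.2.1 ^ 2})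
        (measurableSet_lt measurable_fst ?_)).mul
        (BddMeas.indicator_one (A := {p : ℝ × (X × X) | p.1 < g p.2.2 ^ 2}ᶜ)
        (measurableSet_lt measurable_fst ?_).compl))
      · exact bf.1.comp (measurable_fst.comp measurable_snd)
      · exact bf.1.comp (measurable_snd.comp measurable_snd)
    refine setIntegral_mono_on ((bl.const_mul Φ).integrable _)
      ((bF.integral_right (π.prod π)).integrable _) measurableSet_Ico fun t ht => ?_
    have hm : MeasurableSet {x | t < g x ^ 2} := measurableSet_lt measurable_const bf.1
    refine le_trans (mul_le_mul_of_nonneg_left (le_of_eq ?_) hΦ) (hflow _ hm)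
    have hle : π.real {x | t < g x ^ 2} ≤ 1 / 2 := by
      refine (measureReal_mono fun x (hx : t < g x ^ 2) => ?_).trans hmed
      refine (hg0 x).lt_of_ne fun h0 => ?_
      rw [← h0] at hx
      simp only [mem_Ico] at ht
      norm_num at hx
      linarith
    rw [probReal_compl_eq_one_sub hm, min_eq_left (by linarith)]
  rw [← co] at co1
  have bd : BddMeas (fun z : X × X => |g z.1 - g z.2|) := by
    have := hg.fst.sub (hg.snd (Y := X))
    exact ⟨this.1.abs, this.2.imp fun C h x => by simpa using h x⟩
  have bp : BddMeas (fun z : X × X => g z.1 + g z.2) := hg.fst.add hg.snd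
  have co2 : ∫ z, s z * max (g z.1 ^ 2 - g z.2 ^ 2) 0 ∂(π.prod π)
      ≤ ∫ z, s z * |g z.1 - g z.2| * (g z.1 + g z.2) ∂(π.prod π) := by
    have bm : BddMeas (fun z : X × X => max (g z.1 ^ 2 - g z.2 ^ 2) 0) := by
      have := bf.fst.sub (bf.snd (Y := X))
      refine ⟨this.1.max measurable_const, this.2.imp fun C h x => ?_⟩
      rw [abs_of_nonneg (le_max_right _ _)]
      exact max_le ((le_abs_self _).trans (h x)) ((abs_nonneg _).trans (h x))
    refine integral_mono ((hs.mul bm).integrable _) (((hs.mul bd).mul bp).integrable _) fun z => ?_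
    simp only
    rw [mul_assoc]
    refine mul_le_mul_of_nonneg_left (max_le ?_ ?_) (hs0 z)
    · have := le_abs_self (g z.1 - g z.2)
      nlinarith [hg0 z.1, hg0 z.2]
    · exact mul_nonneg (abs_nonneg _) (add_nonneg (hg0 _) (hg0 _))
  have cs := sq_integral_mul_le (π.prod π) hs bd bp hs0
  simp only [sq_abs] at cs
  have hE2 : ∫ z, s z * (g z.1 - g z.2) ^ 2 ∂(π.prod π) = 2 * E := by
    rw [hE, dirichlet_self]; ring
  have h4N : ∫ z, s z * (g z.1 + g z.2) ^ 2 ∂(π.prod π) ≤ 4 * N := by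
    have h1 := integral_fst_sq_le π hs hrow hg
    have h2 : ∫ z, s z * g z.2 ^ 2 ∂(π.prod π) = ∫ z, s z * g z.1 ^ 2 ∂(π.prod π) := by
      rw [← integral_prod_swap]
      refine integral_congr_ae (ae_of_all _ fun z => ?_)
      simp only [Prod.swap]
      rw [hsymm z.2 z.1]
    have i1 := hs.mul (hg.fst.pow 2)
    have i2 := hs.mul (hg.snd.pow 2)
    have : ∫ z, s z * (g z.1 + g z.2) ^ 2 ∂(π.prod π)
        ≤ ∫ z, 2 * (s z * g z.1 ^ 2) + 2 * (s z * g z.2 ^ 2) ∂(π.prod π) := by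
      refine integral_mono ((hs.mul (bp.pow 2)).integrable _)
        (((i1.const_mul 2).add (i2.const_mul 2)).integrable _) fun z => ?_
      simp only
      nlinarith [hs0 z, mul_nonneg (hs0 z) (sq_nonneg (g z.1 - g z.2))]
    rw [(i1.const_mul 2).integral_add (i2.const_mul 2), integral_const_mul, integral_const_mul,
      h2] at this
    linarith
  have hE0 : 0 ≤ E := dirichlet_self_nonneg π hs0 g
  rw [hE2] at cs
  have hfin : (Φ * N) ^ 2 ≤ 2 * E * (4 * N) :=
    (pow_le_pow_left₀ (mul_nonneg hΦ hN0) (co1.trans co2) 2).trans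
      (cs.trans (mul_le_mul_of_nonneg_left h4N (by positivity)))
  rcases hN0.eq_or_lt with h0 | h0
  · rw [← h0]; simpa using hE0
  · have : (Φ ^ 2 * N) * N ≤ (8 * E) * N := by nlinarith
    have := le_of_mul_le_mul_right this h0
    linarith

/-- **Discrete Cheeger inequality** for a reversible jump kernel. -/
lemma cheeger_poincare (hs : BddMeas s) (hsymm : ∀ u v, s (u, v) = s (v, u))
    (hs0 : ∀ z, 0 ≤ s z) (hrow : ∀ u, ∫ v, s (u, v) ∂π ≤ 1) {Φ : ℝ} (hΦ : 0 ≤ Φ)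
    (hflow : ∀ A, MeasurableSet A → Φ * min (π.real A) (π.real Aᶜ) ≤ flow π s A)
    (hh : BddMeas h) (hmean : ∫ x, h x ∂π = 0) :
    Φ ^ 2 / 8 * ∫ x, h x ^ 2 ∂π ≤ dirichlet π s h h := by
  -- Splitting at a median makes both (h - m)⁺ and (m - h)⁺ live on sets of mass at most 1/2.
  obtain ⟨m, hm1, hm2⟩ := exists_quantile π hh (q := 1 / 2) (by norm_num) (by norm_num)
  have bmax : ∀ {k : X → ℝ}, BddMeas k → BddMeas (fun x => max (k x) 0) := by
    intro k hk
    refine ⟨hk.1.max measurable_const, hk.2.imp fun C h x => ?_⟩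
    rw [abs_of_nonneg (le_max_right _ _)]
    exact max_le ((le_abs_self _).trans (h x)) ((abs_nonneg _).trans (h x))
  have bp := bmax (hh.sub (BddMeas.const m))
  have bn := bmax ((BddMeas.const m).sub hh)
  have h1 := sq_norm_le_dirichlet π hs hsymm hs0 hrow hΦ hflow bp (fun x => le_max_right _ _) (by
    have e : {x | 0 < max (h x - m) 0} = {x | h x ≤ m}ᶜ := by
      ext x; simp
    rw [e, probReal_compl_eq_one_sub (measurableSet_le hh.1 measurable_const)]
    linarith)
  have h2 := sq_norm_le_dirichlet π hs hsymm hs0 hrow hΦ hflow bn (fun x => le_max_right _ _) (by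
    have e : {x | 0 < max (m - h x) 0} = {x | h x < m} := by
      ext x; simp
    rw [e]
    exact hm1)
  -- The two parts have disjoint supports, so for a pair on opposite sides of m the increment of h
  -- is the sum of the two increments, and the dropped cross term is nonnegative.
  have h3 : dirichlet π s (fun x => max (h x - m) 0) (fun x => max (h x - m) 0)
      + dirichlet π s (fun x => max (m - h x) 0) (fun x => max (m - h x) 0)
      ≤ dirichlet π s h h := by
    rw [dirichlet_self, dirichlet_self, dirichlet_self, ← mul_add]
    refine mul_le_mul_of_nonneg_left ?_ (by norm_num)
    have i1 := hs.mul ((bp.fst.sub (bp.snd (Y := X))).pow 2)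
    have i2 := hs.mul ((bn.fst.sub (bn.snd (Y := X))).pow 2)
    rw [← i1.integral_add i2]
    refine integral_mono ((i1.add i2).integrable _)
      ((hs.mul ((hh.fst.sub hh.snd).pow 2)).integrable _) fun z => ?_
    simp only
    rw [← mul_add]
    refine mul_le_mul_of_nonneg_left ?_ (hs0 z)
    rcases le_total (h z.1) m with ha | ha <;> rcases le_total (h z.2) m with hb | hb
    · rw [max_eq_right (sub_nonpos.2 ha), max_eq_right (sub_nonpos.2 hb),
        max_eq_left (sub_nonneg.2 ha), max_eq_left (sub_nonneg.2 hb)]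
      nlinarith
    · rw [max_eq_right (sub_nonpos.2 ha), max_eq_left (sub_nonneg.2 hb),
        max_eq_left (sub_nonneg.2 ha), max_eq_right (sub_nonpos.2 hb)]
      nlinarith [mul_nonneg (sub_nonneg.2 ha) (sub_nonneg.2 hb)]
    · rw [max_eq_left (sub_nonneg.2 ha), max_eq_right (sub_nonpos.2 hb),
        max_eq_right (sub_nonpos.2 ha), max_eq_left (sub_nonneg.2 hb)]
      nlinarith [mul_nonneg (sub_nonneg.2 ha) (sub_nonneg.2 hb)]
    · rw [max_eq_left (sub_nonneg.2 ha), max_eq_left (sub_nonneg.2 hb),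
        max_eq_right (sub_nonpos.2 ha), max_eq_right (sub_nonpos.2 hb)]
      nlinarith
  -- For mean zero, recentring at m only adds m² to the second moment.
  have h4 : ∫ x, h x ^ 2 ∂π ≤ ∫ x, max (h x - m) 0 ^ 2 ∂π + ∫ x, max (m - h x) 0 ^ 2 ∂π := by
    rw [← (bp.pow 2).integral_add (bn.pow 2)]
    have e : ∀ x, max (h x - m) 0 ^ 2 + max (m - h x) 0 ^ 2 = h x ^ 2 - (2 * m) * h x + m ^ 2 := by
      intro x
      rcases le_total (h x) m with ha | ha
      · rw [max_eq_right (sub_nonpos.2 ha), max_eq_left (sub_nonneg.2 ha)]; ring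
      · rw [max_eq_left (sub_nonneg.2 ha), max_eq_right (sub_nonpos.2 ha)]; ring
    simp only [e]
    have i1 := hh.pow 2
    have i2 := hh.const_mul (2 * m)
    rw [(i1.sub i2).integral_add (BddMeas.const _), i1.integral_sub i2, integral_const_mul, hmean]
    simp
    positivity
  have h5 := mul_le_mul_of_nonneg_left h4 (show 0 ≤ Φ ^ 2 / 8 by positivity)
  linarith

end CSSGLD

/-! ### Gaussian densities, tail bounds and positive definiteness. -/

namespace CSSGLD

section Gaussian

variable {d : ℕ}

local notation "E" => EuclideanSpace ℝ (Fin d)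

/-- Density of the centered isotropic Gaussian distribution with covariance `(2b)⁻¹ I`. -/
noncomputable def gaussKer {d : ℕ} (b : ℝ) (x : EuclideanSpace ℝ (Fin d)) : ℝ :=
  (b / Real.pi) ^ ((d : ℝ) / 2) * Real.exp (-b * ‖x‖ ^ 2)

lemma continuous_gaussKer (b : ℝ) : Continuous (gaussKer b : E → ℝ) := by
  unfold gaussKer; fun_prop

lemma gaussKer_pos {b : ℝ} (hb : 0 < b) (x : E) : 0 < gaussKer b x := by
  unfold gaussKer; positivity

lemma gaussKer_neg (b : ℝ) (x : E) : gaussKer b (-x) = gaussKer b x := by simp [gaussKer]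

lemma bddMeas_gaussKer {b : ℝ} (hb : 0 < b) : BddMeas (gaussKer b : E → ℝ) := by
  refine ⟨(continuous_gaussKer b).measurable, (b / Real.pi) ^ ((d : ℝ) / 2), fun x => ?_⟩
  rw [abs_of_pos (gaussKer_pos hb x), gaussKer]
  refine mul_le_of_le_one_right (by positivity) (Real.exp_le_one_iff.2 ?_)
  nlinarith [mul_nonneg hb.le (sq_nonneg ‖x‖)]

lemma integral_exp_neg_mul_sq_norm {b : ℝ} (hb : 0 < b) :
    ∫ x : E, Real.exp (-b * ‖x‖ ^ 2) = (Real.pi / b) ^ ((d : ℝ) / 2) := by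
  simpa using GaussianFourier.integral_rexp_neg_mul_sq_norm (V := E) hb

lemma integral_gaussKer {b : ℝ} (hb : 0 < b) : ∫ x : E, gaussKer b x = 1 := by
  unfold gaussKer
  rw [integral_const_mul, integral_exp_neg_mul_sq_norm hb, ← Real.mul_rpow (by positivity)
    (by positivity)]
  have : b / Real.pi * (Real.pi / b) = 1 := by field_simp
  rw [this, Real.one_rpow]

lemma integrable_gaussKer {b : ℝ} (hb : 0 < b) : Integrable (gaussKer b : E → ℝ) :=
  Integrable.of_integral_ne_zero (by rw [integral_gaussKer hb]; exact one_ne_zero)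

lemma lintegral_gaussKer {b : ℝ} (hb : 0 < b) : ∫⁻ x : E, ENNReal.ofReal (gaussKer b x) = 1 := by
  rw [← ofReal_integral_eq_lintegral_ofReal (integrable_gaussKer hb)
    (ae_of_all _ fun x => (gaussKer_pos hb x).le), integral_gaussKer hb, ENNReal.ofReal_one]

/-- Serves to identify this density with the law of a scaled standard Gaussian vector, by comparing
characteristic functions. -/
lemma charFun_gaussKer {b : ℝ} (hb : 0 < b) (t : E) :
    charFun (volume.withDensity fun x : E => ENNReal.ofReal (gaussKer b x)) t
      = Complex.exp (-(‖t‖ ^ 2 / (4 * b) : ℝ)) := by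
  have hbc : (0 : ℝ) < (b : ℂ).re := by simpa using hb
  rw [charFun_apply, integral_withDensity_eq_integral_toReal_smul
    (continuous_gaussKer b).measurable.ennreal_ofReal (ae_of_all _ fun _ => ENNReal.ofReal_lt_top)]
  have h := GaussianFourier.integral_cexp_neg_mul_sq_norm_add hbc Complex.I t
  have e : ∀ x : E, (ENNReal.ofReal (gaussKer b x)).toReal • Complex.exp (inner ℝ x t * Complex.I)
      = ((b / Real.pi) ^ ((d : ℝ) / 2) : ℝ) *
        Complex.exp (-b * ‖x‖ ^ 2 + Complex.I * inner ℝ t x) := by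
    intro x
    rw [ENNReal.toReal_ofReal (gaussKer_pos hb x).le, gaussKer, real_inner_comm, Complex.exp_add,
      Complex.real_smul]
    push_cast
    ring_nf
  simp only [e]
  rw [integral_const_mul, h, ← mul_assoc, finrank_euclideanSpace_fin]
  have e2 : (((b / Real.pi) ^ ((d : ℝ) / 2) : ℝ) : ℂ) * (Real.pi / b : ℂ) ^ ((d : ℂ) / 2) = 1 := by
    have : (Real.pi / b : ℂ) ^ ((d : ℂ) / 2) = (((Real.pi / b) ^ ((d : ℝ) / 2) : ℝ) : ℂ) := by
      rw [Complex.ofReal_cpow (by positivity)]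
      push_cast
      rfl
    rw [this, ← Complex.ofReal_mul, ← Real.mul_rpow (by positivity) (by positivity)]
    have : b / Real.pi * (Real.pi / b) = 1 := by field_simp
    rw [this, Real.one_rpow, Complex.ofReal_one]
  rw [e2, one_mul, Complex.I_sq]
  congr 1
  push_cast
  ring

/-- The law of `a + σ ξ` for a standard Gaussian vector `ξ`. -/
lemma map_stdGaussian_eq_withDensity {σ : ℝ} (hσ : 0 < σ) (a : E) :
    (stdGaussian E).map (fun ξ => a + σ • ξ)
      = volume.withDensity fun x => ENNReal.ofReal (gaussKer (1 / (2 * σ ^ 2)) (x - a)) := by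
  have hb : 0 < 1 / (2 * σ ^ 2) := by positivity
  have : IsFiniteMeasure
      (volume.withDensity fun x : E => ENNReal.ofReal (gaussKer (1 / (2 * σ ^ 2)) x)) :=
    ⟨by rw [withDensity_apply _ MeasurableSet.univ, setLIntegral_univ, lintegral_gaussKer hb]; simp⟩
  have h1 : (stdGaussian E).map (fun ξ => σ • ξ)
      = volume.withDensity fun x => ENNReal.ofReal (gaussKer (1 / (2 * σ ^ 2)) x) := by
    have : IsProbabilityMeasure ((stdGaussian E).map (fun ξ => σ • ξ)) :=
      Measure.isProbabilityMeasure_map (by fun_prop)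
    refine Measure.ext_of_charFun ?_
    ext t
    rw [charFun_map_smul, charFun_stdGaussian, charFun_gaussKer hb, norm_smul, Real.norm_eq_abs]
    congr 1
    push_cast
    rw [mul_pow, ← Complex.ofReal_pow |σ|, sq_abs]
    have : (σ : ℂ) ≠ 0 := by exact_mod_cast hσ.ne'
    field_simp
    push_cast
    ring
  have h2 : (fun ξ : E => a + σ • ξ) = (fun x => a + x) ∘ fun ξ => σ • ξ := rfl
  rw [h2, ← Measure.map_map (by fun_prop) (by fun_prop), h1]
  ext s hs
  rw [Measure.map_apply (by fun_prop) hs, withDensity_apply _ hs, withDensity_apply _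
    (hs.preimage (by fun_prop)), ← lintegral_indicator hs, ← lintegral_indicator
    (hs.preimage (by fun_prop)), ← lintegral_add_left_eq_self
    (s.indicator fun x => ENNReal.ofReal (gaussKer (1 / (2 * σ ^ 2)) (x - a))) a]
  refine lintegral_congr fun x => ?_
  by_cases h : a + x ∈ s
  · rw [indicator_of_mem (show x ∈ (fun x => a + x) ⁻¹' s from h), indicator_of_mem h,
      add_sub_cancel_left]
  · rw [indicator_of_notMem (show x ∉ (fun x => a + x) ⁻¹' s from h), indicator_of_notMem h]

lemma stdGaussian_real_eq {σ : ℝ} (hσ : 0 < σ) (a : E) {A : Set E} (hA : MeasurableSet A) :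
    (stdGaussian E).real {ξ | a + σ • ξ ∈ A}
      = ∫ x in A, gaussKer (1 / (2 * σ ^ 2)) (x - a) := by
  have hb : 0 < 1 / (2 * σ ^ 2) := by positivity
  have h := congrArg (fun μ : Measure E => μ A) (map_stdGaussian_eq_withDensity hσ a)
  simp only at h
  rw [Measure.map_apply (by fun_prop) hA, withDensity_apply _ hA] at h
  rw [integral_eq_lintegral_of_nonneg_ae (ae_of_all _ fun x => (gaussKer_pos hb _).le)
    ((continuous_gaussKer _).comp (by fun_prop)).aestronglyMeasurable, ← h]
  rfl

/-- A one-dimensional marginal of a standard Gaussian vector is standard Gaussian. -/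
lemma stdGaussian_map_inner {e : E} (he : ‖e‖ = 1) :
    (stdGaussian E).map (fun ξ => inner ℝ e ξ) = gaussianReal 0 1 := by
  have h := IsGaussian.map_eq_gaussianReal (μ := stdGaussian E) (innerSL ℝ e)
  rw [integral_strongDual_stdGaussian, variance_dual_stdGaussian, innerSL_apply_norm, he] at h
  simpa using h

/-- The standard normal density is at most 1. -/
lemma gaussianReal_Ico_le (a : ℝ) {ε : ℝ} (hε : 0 ≤ ε) :
    (gaussianReal 0 1).real (Ico a (a + ε)) ≤ ε := by
  rw [measureReal_def, gaussianReal_apply_eq_integral 0 one_ne_zero]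
  have h0 : 0 ≤ ∫ x in Ico a (a + ε), gaussianPDFReal 0 1 x :=
    integral_nonneg fun x => gaussianPDFReal_nonneg _ _ _
  rw [ENNReal.toReal_ofReal h0]
  have h1 : ∫ x in Ico a (a + ε), gaussianPDFReal 0 1 x ≤ ∫ x in Ico a (a + ε), (1 : ℝ) := by
    refine setIntegral_mono (integrable_gaussianPDFReal 0 1).integrableOn
      (integrableOn_const (by simp)) fun x => ?_
    rw [gaussianPDFReal]
    have a1 : (√(2 * Real.pi * (1 : NNReal)))⁻¹ ≤ 1 := by
      refine inv_le_one_of_one_le₀ (Real.one_le_sqrt.2 ?_)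
      have := Real.pi_gt_three
      simp only [NNReal.coe_one]
      linarith
    have a2 : Real.exp (-(x - 0) ^ 2 / (2 * (1 : NNReal))) ≤ 1 := by
      refine Real.exp_le_one_iff.2 ?_
      simp only [NNReal.coe_one]
      nlinarith [sq_nonneg (x - 0)]
    exact mul_le_one₀ a1 (Real.exp_pos _).le a2
  refine h1.trans ?_
  simp [hε]

lemma half_le_gaussianReal_Iic : 1 / 2 ≤ (gaussianReal 0 1).real (Iic 0) := by
  have h := gaussianReal_map_neg (μ := 0) (v := 1)
  have h1 : (gaussianReal 0 1).real (Ici 0) = (gaussianReal 0 1).real (Iic 0) := by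
    have h2 := congrArg (fun μ : Measure ℝ => μ.real (Iic 0)) h
    simp only [neg_zero] at h2
    rw [← h2, map_measureReal_apply (by fun_prop) measurableSet_Iic]
    congr 1
    ext x
    simp
  have h3 : (univ : Set ℝ) = Iic 0 ∪ Ici 0 := by simp
  have h4 := measureReal_union_le (μ := gaussianReal 0 1) (Iic (0 : ℝ)) (Ici 0)
  rw [← h3, probReal_univ] at h4
  linarith

lemma stdGaussian_inner_mem_Ico {e : E} (he : ‖e‖ = 1) (a : ℝ) {ε : ℝ} (hε : 0 ≤ ε) :
    (stdGaussian E).real {ξ | inner ℝ e ξ ∈ Ico a (a + ε)} ≤ ε := by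
  have h := gaussianReal_Ico_le a hε
  rw [← stdGaussian_map_inner he, map_measureReal_apply (by fun_prop) measurableSet_Ico] at h
  exact h

/-- The left half-line carries half of the mass, and the strip of width ε next to the origin costs
at most ε. -/
lemma stdGaussian_inner_le {e : E} (he : ‖e‖ = 1) {ε : ℝ} (hε : 0 ≤ ε) :
    1 / 2 - ε ≤ (stdGaussian E).real {ξ | inner ℝ e ξ < -ε} := by
  have h1 := half_le_gaussianReal_Iic
  have h2 := gaussianReal_Ico_le (-ε) hε
  have h4 : (gaussianReal 0 1).real (Iic 0) ≤ (gaussianReal 0 1).real (Iio (-ε))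
      + (gaussianReal 0 1).real (Ico (-ε) (-ε + ε)) + (gaussianReal 0 1).real {0} := by
    refine (measureReal_mono (s₂ := (Iio (-ε) ∪ Ico (-ε) (-ε + ε)) ∪ {0}) ?_).trans
      ((measureReal_union_le _ _).trans (add_le_add (measureReal_union_le _ _) le_rfl))
    intro x hx
    simp only [mem_Iic] at hx
    rcases hx.eq_or_lt with h | h
    · exact Or.inr h
    · left
      rcases lt_or_ge x (-ε) with h' | h'
      · exact Or.inl h'
      · exact Or.inr ⟨h', by linarith⟩
  have h5 : (gaussianReal 0 1).real {0} = 0 := by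
    have := nullSingletonClass_gaussianReal (μ := 0) (v := 1) one_ne_zero
    simp [measureReal_def]
  have h6 : (gaussianReal 0 1).real (Iio (-ε))
      = (stdGaussian E).real {ξ | inner ℝ e ξ < -ε} := by
    rw [← stdGaussian_map_inner he, map_measureReal_apply (by fun_prop) measurableSet_Iio]
    rfl
  linarith

lemma integral_inner_sq_stdGaussian {e : E} (he : ‖e‖ = 1) :
    Integrable (fun ξ : E => inner ℝ e ξ ^ 2) (stdGaussian E) ∧
      ∫ ξ, inner ℝ e ξ ^ 2 ∂(stdGaussian E) = 1 := by
  have hm := stdGaussian_map_inner he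
  have h1 : ∫ x, x ^ 2 ∂(gaussianReal 0 1) = 1 := by
    have := variance_fun_id_gaussianReal (μ := 0) (v := 1)
    rw [variance_eq_integral (by fun_prop)] at this
    simpa using this
  constructor
  · have : Integrable (fun x : ℝ => x ^ 2) (gaussianReal 0 1) := by
      refine Integrable.of_integral_ne_zero ?_
      rw [h1]; exact one_ne_zero
    rw [← hm] at this
    exact (integrable_map_measure (by fun_prop) (by fun_prop)).1 this
  · rw [← h1, ← hm, integral_map (by fun_prop) (by fun_prop)]

lemma integral_sq_norm_stdGaussian :
    Integrable (fun ξ : E => ‖ξ‖ ^ 2) (stdGaussian E) ∧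
      ∫ ξ : E, ‖ξ‖ ^ 2 ∂(stdGaussian E) = d := by
  have hb : ∀ i, ‖EuclideanSpace.basisFun (Fin d) ℝ i‖ = 1 := fun i =>
    (EuclideanSpace.basisFun (Fin d) ℝ).norm_eq_one i
  have e : ∀ ξ : E, ‖ξ‖ ^ 2 = ∑ i, inner ℝ (EuclideanSpace.basisFun (Fin d) ℝ i) ξ ^ 2 := by
    intro ξ
    rw [← (EuclideanSpace.basisFun (Fin d) ℝ).sum_sq_norm_inner_right ξ]
    simp
  simp only [e]
  refine ⟨integrable_finsetSum _ fun i _ => (integral_inner_sq_stdGaussian (hb i)).1, ?_⟩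
  rw [integral_finsetSum _ fun i _ => (integral_inner_sq_stdGaussian (hb i)).1]
  rw [Finset.sum_congr rfl fun i _ => (integral_inner_sq_stdGaussian (hb i)).2]
  simp

/-- Markov's inequality for ‖ξ‖², whose mean is d. A constant tail probability is enough everywhere
below, so no concentration is needed. -/
lemma stdGaussian_norm_tail (hd : 1 ≤ d) {c : ℝ} (hc : 0 < c) :
    (stdGaussian E).real {ξ | c * d ≤ ‖ξ‖ ^ 2} ≤ 1 / c := by
  have hd' : (0 : ℝ) < d := by exact_mod_cast hd
  have h := mul_meas_ge_le_integral_of_nonneg (μ := stdGaussian E)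
    (ae_of_all _ fun ξ : E => sq_nonneg ‖ξ‖) integral_sq_norm_stdGaussian.1 (c * d)
  rw [integral_sq_norm_stdGaussian.2] at h
  rw [le_div_iff₀ hc]
  refine le_of_mul_le_mul_right ?_ hd'
  linarith

lemma stdGaussian_inner_tail {e : E} (he : ‖e‖ = 1) {c : ℝ} (hc : 0 < c) :
    (stdGaussian E).real {ξ | c ≤ inner ℝ e ξ} ≤ 1 / c ^ 2 := by
  have h := mul_meas_ge_le_integral_of_nonneg (μ := stdGaussian E)
    (ae_of_all _ fun ξ : E => sq_nonneg (inner ℝ e ξ)) (integral_inner_sq_stdGaussian he).1 (c ^ 2)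
  rw [(integral_inner_sq_stdGaussian he).2] at h
  rw [le_div_iff₀ (by positivity)]
  refine le_trans ?_ h
  rw [mul_comm]
  refine mul_le_mul_of_nonneg_left (measureReal_mono fun ξ hξ => ?_) (by positivity)
  simp only [mem_ofPred_eq] at hξ ⊢
  exact pow_le_pow_left₀ hc.le hξ 2

/-- The Gaussian kernel is an autocorrelation. -/
lemma exp_neg_sq_norm_sub_eq_integral {b : ℝ} (hb : 0 < b) (u v : E) :
    (4 * b / Real.pi) ^ ((d : ℝ) / 2) *
      ∫ x : E, Real.exp (-(2 * b) * ‖x - u‖ ^ 2) * Real.exp (-(2 * b) * ‖x - v‖ ^ 2)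
      = Real.exp (-b * ‖u - v‖ ^ 2) := by
  -- The parallelogram law recentres the product of the two Gaussians at the midpoint of u and v.
  have e : ∀ x : E, Real.exp (-(2 * b) * ‖x - u‖ ^ 2) * Real.exp (-(2 * b) * ‖x - v‖ ^ 2)
      = Real.exp (-b * ‖u - v‖ ^ 2) *
        Real.exp (-(4 * b) * ‖x - (1 / 2 : ℝ) • (u + v)‖ ^ 2) := by
    intro x
    rw [← Real.exp_add, ← Real.exp_add]
    congr 1
    have h1 : x - (1 / 2 : ℝ) • (u + v) = (1 / 2 : ℝ) • ((x - u) + (x - v)) := by module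
    have h2 : u - v = (x - v) - (x - u) := by abel
    rw [h1, norm_smul, mul_pow]
    have := parallelogram_law_with_norm ℝ (x - u) (x - v)
    have h3 : ‖(x - u) - (x - v)‖ = ‖(x - v) - (x - u)‖ := norm_sub_rev _ _
    rw [h3, ← h2] at this
    norm_num
    linear_combination b * this
  simp only [e]
  rw [integral_const_mul, integral_sub_right_eq_self
    (fun x : E => Real.exp (-(4 * b) * ‖x‖ ^ 2)), integral_exp_neg_mul_sq_norm (by positivity),
    mul_left_comm, ← Real.mul_rpow (by positivity) (by positivity)]
  have : 4 * b / Real.pi * (Real.pi / (4 * b)) = 1 := by field_simp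
  rw [this, Real.one_rpow, mul_one]

/-- The Gaussian kernel is positive semidefinite. -/
lemma gaussKer_posSemidef {b : ℝ} (hb : 0 < b) (μ : Measure E) [IsFiniteMeasure μ] {φ : E → ℝ}
    (hφ : BddMeas φ) :
    0 ≤ ∫ z, gaussKer b (z.1 - z.2) * φ z.1 * φ z.2 ∂(μ.prod μ) := by
  set K : E → E → ℝ := fun u x => Real.exp (-(2 * b) * ‖x - u‖ ^ 2) with hK
  have hK0 : ∀ u x, 0 ≤ K u x := fun u x => (Real.exp_pos _).le
  have hK1 : ∀ u x, K u x ≤ 1 := fun u x => by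
    refine Real.exp_le_one_iff.2 ?_
    nlinarith [mul_nonneg hb.le (sq_nonneg ‖x - u‖)]
  have hKc : Continuous fun p : E × E => K p.1 p.2 := by
    simp only [hK]; fun_prop
  obtain ⟨hφm, C, hC⟩ := hφ
  set H : E × E → E → ℝ := fun z x => (K z.1 x * φ z.1) * (K z.2 x * φ z.2) with hH
  have hHm : Measurable fun p : (E × E) × E => H p.1 p.2 := by
    have m1 : Measurable fun p : (E × E) × E => K p.1.1 p.2 := by
      simp only [hK]; fun_prop
    have m2 : Measurable fun p : (E × E) × E => K p.1.2 p.2 := by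
      simp only [hK]; fun_prop
    have m3 : Measurable fun p : (E × E) × E => φ p.1.1 := hφm.comp (by fun_prop)
    have m4 : Measurable fun p : (E × E) × E => φ p.1.2 := hφm.comp (by fun_prop)
    exact (m1.mul m3).mul (m2.mul m4)
  have hKi : ∀ u, Integrable (K u) := fun u => by
    have h := (integrable_gaussKer (d := d) (b := 2 * b) (by positivity)).comp_sub_right u
    have h' := h.const_mul (((2 * b) / Real.pi) ^ ((d : ℝ) / 2))⁻¹
    refine h'.congr (ae_of_all _ fun x => ?_)
    simp only [gaussKer, hK]
    rw [← mul_assoc, inv_mul_cancel₀ (by positivity), one_mul]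
  have hKint : ∀ u, ∫ x, K u x = (Real.pi / (2 * b)) ^ ((d : ℝ) / 2) := fun u => by
    simp only [hK]
    rw [integral_sub_right_eq_self (fun x : E => Real.exp (-(2 * b) * ‖x‖ ^ 2)),
      integral_exp_neg_mul_sq_norm (by positivity)]
  have hC0 : 0 ≤ C := (abs_nonneg _).trans (hC 0)
  have hHb : ∀ z x, ‖H z x‖ ≤ C ^ 2 * K z.1 x := by
    intro z x
    simp only [hH, Real.norm_eq_abs, abs_mul, abs_of_nonneg (hK0 _ _)]
    have h1 := hC z.1
    have h2 := hC z.2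
    have : |φ z.1| * |φ z.2| ≤ C * C := mul_le_mul h1 h2 (abs_nonneg _) hC0
    calc K z.1 x * |φ z.1| * (K z.2 x * |φ z.2|)
        = (K z.1 x * K z.2 x) * (|φ z.1| * |φ z.2|) := by ring
      _ ≤ (K z.1 x * 1) * (C * C) := by
        refine mul_le_mul (mul_le_mul_of_nonneg_left (hK1 _ _) (hK0 _ _)) this (by positivity)
          (by simpa using hK0 _ _)
      _ = _ := by ring
  -- Fubini involves Lebesgue measure in x; the domination by C² K(z.1, x) is integrable uniformly
  -- in z because `μ` is finite.
  have hHi : Integrable (fun p : (E × E) × E => H p.1 p.2) ((μ.prod μ).prod volume) := by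
    rw [integrable_prod_iff hHm.aestronglyMeasurable]
    refine ⟨ae_of_all _ fun z => ((hKi z.1).const_mul (C ^ 2)).mono'
      (hHm.comp measurable_prodMk_left).aestronglyMeasurable (ae_of_all _ (hHb z)), ?_⟩
    refine Integrable.of_bound
      (hHm.norm.stronglyMeasurable.integral_prod_right' (ν := volume)).aestronglyMeasurable
      (C ^ 2 * (Real.pi / (2 * b)) ^ ((d : ℝ) / 2)) (ae_of_all _ fun z => ?_)
    rw [Real.norm_eq_abs, abs_of_nonneg (integral_nonneg fun x => norm_nonneg _), ← hKint z.1,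
      ← integral_const_mul]
    exact integral_mono_of_nonneg (ae_of_all _ fun x => norm_nonneg _)
      ((hKi z.1).const_mul _) (ae_of_all _ (hHb z))
  have sw := integral_integral_swap (f := H) hHi
  -- For fixed x the integral over the pair (u, v) factors into a square.
  have pos : 0 ≤ ∫ z, (∫ x, H z x) ∂(μ.prod μ) := by
    rw [sw]
    refine integral_nonneg fun x => ?_
    simp only [hH]
    rw [integral_prod_mul (fun u => K u x * φ u) (fun u => K u x * φ u)]
    exact mul_self_nonneg _
  have e : ∀ z : E × E, gaussKer b (z.1 - z.2) * φ z.1 * φ z.2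
      = ((b / Real.pi) ^ ((d : ℝ) / 2) * (4 * b / Real.pi) ^ ((d : ℝ) / 2)) * ∫ x, H z x := by
    intro z
    have e1 : ∀ x, H z x = (φ z.1 * φ z.2) * (K z.1 x * K z.2 x) := fun x => by
      simp only [hH]; ring
    simp only [e1]
    rw [integral_const_mul, gaussKer, ← exp_neg_sq_norm_sub_eq_integral hb]
    ring
  simp only [e]
  rw [integral_const_mul]
  exact mul_nonneg (by positivity) pos

end Gaussian

end CSSGLD

/-! ### From the infinitesimal isoperimetric inequality to separated sets. -/

namespace CSSGLD

section Isoperimetry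

variable {d : ℕ}

local notation "E" => EuclideanSpace ℝ (Fin d)

lemma measurableSet_domain (R : ℝ) : MeasurableSet (domain d R) :=
  Metric.isClosed_closedBall.measurableSet

lemma enlarge_cthickening_subset {R τ t : ℝ} (hτ : 0 ≤ τ) (ht : 0 ≤ t) (A : Set E) :
    enlarge R (domain d R ∩ Metric.cthickening τ A) t
      ⊆ domain d R ∩ Metric.cthickening (τ + t) A := by
  rintro u ⟨hu, v, ⟨-, hv⟩, huv⟩
  refine ⟨hu, ?_⟩
  rw [Metric.mem_cthickening_iff] at hv ⊢
  refine Metric.infEDist_le_edist_add_infEDist.trans 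
    ((add_le_add (b := ENNReal.ofReal t) ?_ hv).trans_eq ?_)
  · rw [edist_dist, dist_eq_norm]
    exact ENNReal.ofReal_le_ofReal huv
  · rw [add_comm, ENNReal.ofReal_add hτ ht]

/-- Integrated form of the isoperimetric inequality, for two sets at distance at least `h`. -/
lemma isoperimetry_of_separated {R ρ : ℝ} {π : Measure E} [IsProbabilityMeasure π]
    (hch : HasCheegerConstant R ρ π) (hρ : 0 < ρ) {A₁ A₂ : Set E}
    (hA₂ : MeasurableSet A₂) (hD₁ : A₁ ⊆ domain d R) {h : ℝ} (hh : 0 < h)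
    (hsep : ∀ u ∈ A₁, ∀ v ∈ A₂, h ≤ ‖u - v‖) :
    ρ * h * min (π.real A₁) (π.real A₂) ≤ 1 - π.real A₁ - π.real A₂ := by
  set m := min (π.real A₁) (π.real A₂) with hm
  -- Closed neighbourhoods of `A₁` inside the ball stay disjoint from `A₂` up to radius h, so both
  -- they and their complements keep mass at least m, and the isoperimetric inequality drives their
  -- growth at rate ρm.
  set U : ℝ → Set E := fun t => domain d R ∩ Metric.cthickening t A₁ with hU
  have hUm : ∀ t, MeasurableSet (U t) := fun t =>
    (measurableSet_domain R).inter Metric.isClosed_cthickening.measurableSet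
  have hU1 : ∀ t, A₁ ⊆ U t := fun t => subset_inter hD₁ (Metric.self_subset_cthickening _)
  have hUdisj : ∀ t < h, Disjoint (U t) A₂ := by
    intro t ht
    refine Set.disjoint_left.2 fun v hv hv2 => ?_
    have h1 := Metric.mem_cthickening_iff.1 hv.2
    have h2 : ENNReal.ofReal h ≤ Metric.infEDist v A₁ := by
      refine Metric.le_infEDist.2 fun u hu => ?_
      rw [edist_dist, dist_eq_norm, norm_sub_rev]
      exact ENNReal.ofReal_le_ofReal (hsep u hu v hv2)
    exact absurd (h2.trans h1) (not_le.2 ((ENNReal.ofReal_lt_ofReal_iff hh).2 ht))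
  have hUle : ∀ t < h, π.real (U t) + π.real A₂ ≤ 1 := by
    intro t ht
    rw [← measureReal_union (hUdisj t ht) hA₂]
    exact measureReal_le_one
  -- The slope b is strictly below ρm so that the bound on the lower limit yields actual small
  -- increments t with growth at least bt.
  have hmain : 0 < m → ∀ b, b < ρ * m → 0 < b → ∀ T, 0 < T → T < h →
      π.real A₁ + b * T ≤ π.real (U T) := by
    intro hm0 b hb hb0 T hT0 hT
    set S : Set ℝ := {t | t ∈ Icc 0 T ∧ π.real A₁ + b * t ≤ π.real (U t)} with hS
    have hS0 : (0 : ℝ) ∈ S := ⟨⟨le_rfl, hT0.le⟩, by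
      rw [mul_zero, add_zero]; exact measureReal_mono (hU1 0)⟩
    have hSb : BddAbove S := ⟨T, fun t ht => ht.1.2⟩
    set τ := sSup S with hτ
    have hτ0 : 0 ≤ τ := le_csSup hSb hS0
    have hτT : τ ≤ T := csSup_le ⟨0, hS0⟩ fun t ht => ht.1.2
    have hUmono : ∀ {s t : ℝ}, s ≤ t → π.real (U s) ≤ π.real (U t) := fun hst =>
      measureReal_mono (inter_subset_inter_right _ (Metric.cthickening_mono hst _))
    -- Monotonicity of the neighbourhoods puts the supremum in `S`, although t ↦ π(U t) need not be
    -- continuous. If it were below T, one more increment would exceed it.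
    have hτS : π.real A₁ + b * τ ≤ π.real (U τ) := by
      have : τ ≤ (π.real (U τ) - π.real A₁) / b := by
        refine csSup_le ⟨0, hS0⟩ fun t ht => ?_
        rw [le_div_iff₀ hb0]
        have := ht.2.trans (hUmono (le_csSup hSb ht))
        linarith
      rw [le_div_iff₀ hb0] at this
      linarith
    rcases hτT.eq_or_lt with h0 | hlt
    · rwa [h0] at hτS
    exfalso
    have hA1τ : π.real A₁ ≤ π.real (U τ) := measureReal_mono (hU1 τ)
    have hlow : ENNReal.ofReal b < ENNReal.ofReal ρ * min (π (U τ)) (1 - π (U τ)) := by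
      have h1 : ENNReal.ofReal m ≤ π (U τ) := by
        rw [← ofReal_measureReal]
        exact ENNReal.ofReal_le_ofReal ((min_le_left _ _).trans hA1τ)
      have h2 : ENNReal.ofReal m ≤ 1 - π (U τ) := by
        rw [← ofReal_measureReal (s := U τ), ← ENNReal.ofReal_one,
          ← ENNReal.ofReal_sub _ measureReal_nonneg]
        refine ENNReal.ofReal_le_ofReal ((min_le_right _ _).trans ?_)
        linarith [hUle τ (hlt.trans hT)]
      calc ENNReal.ofReal b < ENNReal.ofReal (ρ * m) :=
            (ENNReal.ofReal_lt_ofReal_iff (by positivity)).2 hb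
        _ = ENNReal.ofReal ρ * ENNReal.ofReal m := ENNReal.ofReal_mul hρ.le
        _ ≤ _ := mul_le_mul_right (le_min h1 h2) _
    have hev := eventually_lt_of_lt_liminf
      (hlow.trans_le (hch (U τ) inter_subset_left (hUm τ)))
    have hmem : ∀ᶠ t : ℝ in 𝓝[>] 0, t ∈ Ioo 0 (T - τ) :=
      Ioo_mem_nhdsGT (sub_pos.2 hlt)
    obtain ⟨t, ht1, ht2⟩ := (hev.and hmem).exists
    have ht0 : ENNReal.ofReal t ≠ 0 := by simpa using ht2.1
    have h3 : ENNReal.ofReal b * ENNReal.ofReal t < π (enlarge R (U τ) t) - π (U τ) :=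
      (ENNReal.lt_div_iff_mul_lt (Or.inl ht0) (Or.inl ENNReal.ofReal_ne_top)).1 ht1
    have h4 : π (enlarge R (U τ) t) ≤ π (U (τ + t)) :=
      measure_mono (enlarge_cthickening_subset hτ0 ht2.1.le A₁)
    have h5 : ENNReal.ofReal b * ENNReal.ofReal t + π (U τ) ≤ π (U (τ + t)) := by
      have := lt_tsub_iff_right.1 h3
      exact this.le.trans h4
    rw [← ENNReal.ofReal_mul hb0.le] at h5
    have h6 : b * t + π.real (U τ) ≤ π.real (U (τ + t)) := by
      have := ENNReal.toReal_mono (measure_ne_top π _) h5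
      rwa [ENNReal.toReal_add ENNReal.ofReal_ne_top (measure_ne_top π _),
        ENNReal.toReal_ofReal (mul_nonneg hb0.le ht2.1.le)] at this
    have h7 : τ + t ∈ S := ⟨⟨by linarith [ht2.1], by linarith [ht2.2]⟩, by
      rw [mul_add]; linarith⟩
    have := le_csSup hSb h7
    linarith [ht2.1]
  have hm0 : 0 ≤ m := le_min measureReal_nonneg measureReal_nonneg
  rcases hm0.eq_or_lt with h0 | h0
  · rw [← h0, mul_zero]
    have := hUle 0 hh
    have h1 : π.real A₁ ≤ π.real (U 0) := measureReal_mono (hU1 0)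
    linarith
  -- The slope and the radius tend to ρm and h together, as θρm and θh with θ → 1.
  have hlim : Tendsto (fun θ : ℝ => θ * θ * (ρ * h * m)) (𝓝[<] 1) (𝓝 (1 * 1 * (ρ * h * m))) :=
    (Continuous.tendsto (by fun_prop) 1).mono_left inf_le_left
  have hev : ∀ᶠ θ : ℝ in 𝓝[<] 1, θ * θ * (ρ * h * m) ≤ 1 - π.real A₁ - π.real A₂ := by
    filter_upwards [Ioo_mem_nhdsLT (show (0 : ℝ) < 1 by norm_num)] with θ hθ
    have h1 : θ * h < h := by nlinarith [hθ.2]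
    have hρm : 0 < ρ * m := by positivity
    have h2 := hmain h0 (θ * (ρ * m)) (by nlinarith [hθ.2]) (mul_pos hθ.1 hρm) (θ * h)
      (mul_pos hθ.1 hh) h1
    have h3 := hUle (θ * h) h1
    have h4 : θ * θ * (ρ * h * m) = θ * (ρ * m) * (θ * h) := by ring
    linarith
  have := le_of_tendsto hlim hev
  linarith

end Isoperimetry

end CSSGLD

/-! ### The jump density of CS-SGLD and its reversible approximation. -/

namespace CSSGLD

section Kernel

variable {d : ℕ}

local notation "E" => EuclideanSpace ℝ (Fin d)

/-- A measurable potential `F` with gradient `g` on the ball, together with step-size parameters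
(`σ² = 2η/β` is the noise level, `r` the truncation radius) which are small compared to the
smoothness constants of `F`. -/
structure SmallStep {d : ℕ} (R β η σ r L₁ L₂ : ℝ) (F : EuclideanSpace ℝ (Fin d) → ℝ)
    (g : EuclideanSpace ℝ (Fin d) → EuclideanSpace ℝ (Fin d)) : Prop where
  one_le_dim : 1 ≤ d
  R_pos : 0 < R
  β_pos : 0 < β
  η_pos : 0 < η
  σ_pos : 0 < σ
  r_pos : 0 < r
  σ_sq : σ ^ 2 = 2 * η / β
  r_sq : r ^ 2 = 5 * d * σ ^ 2
  L₁_nonneg : 0 ≤ L₁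
  L₂_nonneg : 0 ≤ L₂
  measurable_F : Measurable F
  measurable_g : Measurable g
  norm_grad : ∀ u ∈ domain d R, ‖g u‖ ≤ L₁
  grad_lip : ∀ u ∈ domain d R, ∀ v ∈ domain d R, ‖g v - g u‖ ≤ L₂ * ‖v - u‖
  lip : ∀ u ∈ domain d R, ∀ v ∈ domain d R, |F v - F u| ≤ L₁ * ‖v - u‖
  taylor : ∀ u ∈ domain d R, ∀ v ∈ domain d R,
    |F v - F u - inner ℝ (g u) (v - u)| ≤ L₂ * ‖v - u‖ ^ 2
  -- In turn: the log-ratio Δ of the two kernels is small; βr is at most 4d; the drift and the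
  -- change of βF over a noise length σ are small; a typical step is short enough for its inward
  -- component to keep it in the ball.
  small_curv : (5 * L₂ + L₁ * L₂) * η * d ≤ 1 / 100
  small_temp : β * η ≤ 1
  small_drift : β * σ * L₁ ≤ 1 / 200
  small_dim : 405 * σ * d ≤ R

/-- Normalizing constant of the Gibbs measure. -/
noncomputable def partition {d : ℕ} (R β : ℝ) (F : EuclideanSpace ℝ (Fin d) → ℝ) : ℝ :=
  ∫ x in domain d R, Real.exp (-β * F x)

/-- Admissible jumps. -/
def jumpSet (d : ℕ) (R r : ℝ) : Set (EuclideanSpace ℝ (Fin d) × EuclideanSpace ℝ (Fin d)) :=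
  {z | z.1 ∈ domain d R ∧ z.2 ∈ domain d R ∧ ‖z.2 - z.1‖ ≤ r}

/-- Jump density of CS-SGLD with respect to the Gibbs measure. -/
noncomputable def jumpDens {d : ℕ} (R β η σ r : ℝ) (F : EuclideanSpace ℝ (Fin d) → ℝ)
    (g : EuclideanSpace ℝ (Fin d) → EuclideanSpace ℝ (Fin d)) :
    EuclideanSpace ℝ (Fin d) × EuclideanSpace ℝ (Fin d) → ℝ :=
  (jumpSet d R r).indicator fun z => partition R β F *
    gaussKer (1 / (2 * σ ^ 2)) (z.2 - (z.1 - η • g z.1)) * Real.exp (β * F z.2)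

/-- Logarithmic distance between CS-SGLD and its reversible approximation. -/
def curvErr (η L₁ L₂ : ℝ) (d : ℕ) : ℝ := (5 * L₂ + L₁ * L₂) * η * d

/-- Symmetric weight of the reversible approximation. -/
noncomputable def symWeight {d : ℕ} (β η : ℝ) (F : EuclideanSpace ℝ (Fin d) → ℝ)
    (g : EuclideanSpace ℝ (Fin d) → EuclideanSpace ℝ (Fin d)) (x : EuclideanSpace ℝ (Fin d)) : ℝ :=
  Real.exp (β / 2 * F x - β * η / 8 * ‖g x‖ ^ 2)

/-- Jump density, with respect to the Gibbs measure, of a reversible approximation of CS-SGLD. -/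
noncomputable def symDens {d : ℕ} (R β η σ r L₁ L₂ : ℝ) (F : EuclideanSpace ℝ (Fin d) → ℝ)
    (g : EuclideanSpace ℝ (Fin d) → EuclideanSpace ℝ (Fin d)) :
    EuclideanSpace ℝ (Fin d) × EuclideanSpace ℝ (Fin d) → ℝ :=
  (jumpSet d R r).indicator fun z => Real.exp (-curvErr η L₁ L₂ d) * partition R β F *
    gaussKer (1 / (2 * σ ^ 2)) (z.1 - z.2) * symWeight β η F g z.1 * symWeight β η F g z.2

lemma measurableSet_jumpSet (R r : ℝ) : MeasurableSet (jumpSet d R r) := by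
  have h : jumpSet d R r = (Prod.fst ⁻¹' domain d R ∩ Prod.snd ⁻¹' domain d R) ∩
      {z : E × E | ‖z.2 - z.1‖ ≤ r} := by
    ext z; simp [jumpSet, and_assoc]
  rw [h]
  exact ((measurable_fst (measurableSet_domain R)).inter
    (measurable_snd (measurableSet_domain R))).inter
      (measurableSet_le (by fun_prop) measurable_const)

lemma BddMeas.of_indicator {X : Type*} [MeasurableSpace X] {S : Set X} (hS : MeasurableSet S)
    {f : X → ℝ} (hf : Measurable f) {C : ℝ} (hC : ∀ x ∈ S, |f x| ≤ C) :
    BddMeas (S.indicator f) := by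
  refine ⟨hf.indicator hS, max C 0, fun x => ?_⟩
  by_cases hx : x ∈ S
  · rw [indicator_of_mem hx]; exact (hC x hx).trans (le_max_left _ _)
  · rw [indicator_of_notMem hx]; simp

namespace SmallStep

variable {R β η σ r L₁ L₂ : ℝ} {F : EuclideanSpace ℝ (Fin d) → ℝ}
  {g : EuclideanSpace ℝ (Fin d) → EuclideanSpace ℝ (Fin d)}

lemma b_pos (h : SmallStep R β η σ r L₁ L₂ F g) : 0 < 1 / (2 * σ ^ 2) := by
  have := h.σ_pos; positivity

lemma b_eq (h : SmallStep R β η σ r L₁ L₂ F g) : 1 / (2 * σ ^ 2) = β / (4 * η) := by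
  have := h.β_pos; have := h.η_pos
  rw [h.σ_sq]; field_simp; norm_num

lemma zero_mem (h : SmallStep R β η σ r L₁ L₂ F g) : (0 : E) ∈ domain d R := by
  simp [domain, h.R_pos.le]

lemma curvErr_nonneg (h : SmallStep R β η σ r L₁ L₂ F g) : 0 ≤ curvErr η L₁ L₂ d := by
  have := h.L₁_nonneg; have := h.L₂_nonneg; have := h.η_pos
  unfold curvErr; positivity

lemma exists_bound (h : SmallStep R β η σ r L₁ L₂ F g) :
    ∃ C, ∀ x ∈ domain d R, |F x| ≤ C := by
  refine ⟨L₁ * R + |F 0|, fun x hx => ?_⟩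
  have h1 := h.lip 0 h.zero_mem x hx
  have h2 : ‖x - 0‖ ≤ R := by simpa [domain] using hx
  have h3 := mul_le_mul_of_nonneg_left h2 h.L₁_nonneg
  have h4 := abs_add_le (F x - F 0) (F 0)
  rw [sub_add_cancel] at h4
  linarith

lemma integrableOn_exp (h : SmallStep R β η σ r L₁ L₂ F g) (c : ℝ) :
    IntegrableOn (fun x => Real.exp (c * F x)) (domain d R) := by
  obtain ⟨C, hC⟩ := h.exists_bound
  refine IntegrableOn.of_bound (C := Real.exp (|c| * C)) ?_ ?_ ?_
  · exact (isCompact_closedBall _ _).measure_lt_top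
  · exact ((h.measurable_F.const_mul c).exp).aestronglyMeasurable
  · refine (ae_restrict_iff' (measurableSet_domain R)).2 (ae_of_all _ fun x hx => ?_)
    rw [Real.norm_eq_abs, Real.abs_exp]
    refine Real.exp_le_exp.2 ((le_abs_self _).trans ?_)
    rw [abs_mul]
    exact mul_le_mul_of_nonneg_left (hC x hx) (abs_nonneg _)

lemma neZero (h : SmallStep R β η σ r L₁ L₂ F g) : NeZero (volume.restrict (domain d R)) := by
  refine ⟨fun h0 => ?_⟩
  rw [Measure.restrict_eq_zero] at h0
  exact (Metric.measure_closedBall_pos volume (0 : E) h.R_pos).ne' h0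

lemma partition_pos (h : SmallStep R β η σ r L₁ L₂ F g) : 0 < partition R β F := by
  have := h.neZero
  exact integral_exp_pos (h.integrableOn_exp (-β))

lemma isProbabilityMeasure (h : SmallStep R β η σ r L₁ L₂ F g) :
    IsProbabilityMeasure (gibbs R β F) := by
  have := h.neZero
  exact isProbabilityMeasure_tilted (h.integrableOn_exp (-β))

lemma gibbs_compl_domain : gibbs R β F (domain d R)ᶜ = 0 := by
  refine tilted_absolutelyContinuous _ _ ?_
  rw [Measure.restrict_apply (measurableSet_domain R).compl]
  simp

lemma ae_mem_domain : ∀ᵐ x ∂(gibbs R β F), x ∈ domain d R := gibbs_compl_domain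

lemma integral_gibbs (φ : E → ℝ) :
    ∫ x, φ x ∂(gibbs R β F)
      = ∫ x in domain d R, Real.exp (-β * F x) / partition R β F * φ x := by
  rw [gibbs, integral_tilted]
  simp [partition]

/-- Gaussian probabilities in terms of the Gibbs measure. -/
lemma integral_gaussKer_gibbs (h : SmallStep R β η σ r L₁ L₂ F g) (a : E) {A : Set E}
    (hA : MeasurableSet A) (hAD : A ⊆ domain d R) :
    ∫ x, A.indicator (fun x => partition R β F * gaussKer (1 / (2 * σ ^ 2)) (x - a) *
      Real.exp (β * F x)) x ∂(gibbs R β F) = (stdGaussian E).real {ξ | a + σ • ξ ∈ A} := by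
  rw [integral_gibbs, stdGaussian_real_eq h.σ_pos a hA, ← integral_indicator hA,
    ← integral_indicator (measurableSet_domain R)]
  congr 1
  ext x
  have hZ := h.partition_pos.ne'
  by_cases hx : x ∈ A
  · rw [indicator_of_mem (hAD hx), indicator_of_mem hx, indicator_of_mem hx]
    have : Real.exp (-β * F x) * Real.exp (β * F x) = 1 := by
      rw [← Real.exp_add]; simp
    rw [div_mul_eq_mul_div, div_eq_iff hZ]
    linear_combination (partition R β F * gaussKer (1 / (2 * σ ^ 2)) (x - a)) * this
  · rw [indicator_of_notMem hx]
    by_cases hxD : x ∈ domain d R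
    · rw [indicator_of_mem hxD, indicator_of_notMem hx, mul_zero]
    · rw [indicator_of_notMem hxD]

lemma bddMeas_jumpDens (h : SmallStep R β η σ r L₁ L₂ F g) :
    BddMeas (jumpDens R β η σ r F g) := by
  obtain ⟨C, hC⟩ := h.exists_bound
  obtain ⟨-, C', hC'⟩ := bddMeas_gaussKer (d := d) h.b_pos
  have hg := h.measurable_g
  have hF := h.measurable_F
  have hβ := h.β_pos
  refine BddMeas.of_indicator (C := partition R β F * C' * Real.exp (β * C))
    (measurableSet_jumpSet R r) ?_ fun z hz => ?_
  · have := (continuous_gaussKer (d := d) (1 / (2 * σ ^ 2))).measurable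
    fun_prop
  · rw [abs_mul, abs_mul, abs_of_pos h.partition_pos, Real.abs_exp]
    have h1 := hC' (z.2 - (z.1 - η • g z.1))
    refine mul_le_mul (mul_le_mul_of_nonneg_left h1 h.partition_pos.le) (Real.exp_le_exp.2 ?_)
      (Real.exp_pos _).le (mul_nonneg h.partition_pos.le ((abs_nonneg _).trans h1))
    exact mul_le_mul_of_nonneg_left ((le_abs_self _).trans (hC _ hz.2.1)) hβ.le

lemma symWeight_le (h : SmallStep R β η σ r L₁ L₂ F g) {C : ℝ}
    (hC : ∀ x ∈ domain d R, |F x| ≤ C) {x : E} (hx : x ∈ domain d R) :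
    symWeight β η F g x ≤ Real.exp (β / 2 * C) := by
  have hβ := h.β_pos; have hη := h.η_pos
  refine Real.exp_le_exp.2 ?_
  have h1 := mul_le_mul_of_nonneg_left ((le_abs_self _).trans (hC x hx)) (half_pos hβ).le
  have h2 : 0 ≤ β * η / 8 * ‖g x‖ ^ 2 := by positivity
  linarith

lemma symWeight_pos (x : E) : 0 < symWeight β η F g x := Real.exp_pos _

lemma measurable_symWeight (h : SmallStep R β η σ r L₁ L₂ F g) :
    Measurable (symWeight β η F g) := by
  have hg := h.measurable_g
  have hF := h.measurable_F
  unfold symWeight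
  fun_prop

lemma bddMeas_symDens (h : SmallStep R β η σ r L₁ L₂ F g) :
    BddMeas (symDens R β η σ r L₁ L₂ F g) := by
  obtain ⟨C, hC⟩ := h.exists_bound
  obtain ⟨-, C', hC'⟩ := bddMeas_gaussKer (d := d) h.b_pos
  have hg := h.measurable_g
  have hF := h.measurable_F
  have hβ := h.β_pos
  refine BddMeas.of_indicator (C := Real.exp (-curvErr η L₁ L₂ d) * partition R β F * C' *
    Real.exp (β / 2 * C) * Real.exp (β / 2 * C)) (measurableSet_jumpSet R r) ?_ fun z hz => ?_
  · have := (continuous_gaussKer (d := d) (1 / (2 * σ ^ 2))).measurable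
    have := h.measurable_symWeight
    fun_prop
  · have hZ := h.partition_pos
    rw [abs_mul, abs_mul, abs_mul, abs_mul, abs_of_pos hZ, Real.abs_exp,
      abs_of_pos (symWeight_pos _), abs_of_pos (symWeight_pos _)]
    have h1 := hC' (z.1 - z.2)
    have h2 := h.symWeight_le hC hz.1
    have h3 := h.symWeight_le hC hz.2.1
    have h4 := (symWeight_pos (β := β) (η := η) (F := F) (g := g) z.1).le
    have h5 := (symWeight_pos (β := β) (η := η) (F := F) (g := g) z.2).le
    have hC'0 : 0 ≤ C' := (abs_nonneg _).trans h1
    gcongr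

lemma symDens_symm (u v : E) :
    symDens R β η σ r L₁ L₂ F g (u, v) = symDens R β η σ r L₁ L₂ F g (v, u) := by
  unfold symDens
  have e : ((u, v) ∈ jumpSet d R r) ↔ ((v, u) ∈ jumpSet d R r) := by
    simp only [jumpSet, mem_ofPred_eq, norm_sub_rev v u]
    tauto
  by_cases hz : (u, v) ∈ jumpSet d R r
  · rw [indicator_of_mem hz, indicator_of_mem (e.1 hz)]
    simp only
    rw [← gaussKer_neg _ (u - v), neg_sub]
    ring
  · rw [indicator_of_notMem hz, indicator_of_notMem (fun h => hz (e.2 h))]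

lemma symDens_nonneg (h : SmallStep R β η σ r L₁ L₂ F g) (z : E × E) :
    0 ≤ symDens R β η σ r L₁ L₂ F g z := by
  refine indicator_nonneg (fun z _ => ?_) z
  have h1 := h.partition_pos
  have h2 := gaussKer_pos h.b_pos (z.1 - z.2)
  have h3 := symWeight_pos (β := β) (η := η) (F := F) (g := g) z.1
  have h4 := symWeight_pos (β := β) (η := η) (F := F) (g := g) z.2
  positivity

/-- The logarithm of the ratio of the two jump densities. -/
lemma jumpDens_eq_mul_symDens (h : SmallStep R β η σ r L₁ L₂ F g) {u v : E}
    (hz : (u, v) ∈ jumpSet d R r) :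
    jumpDens R β η σ r F g (u, v) = symDens R β η σ r L₁ L₂ F g (u, v) *
      Real.exp (curvErr η L₁ L₂ d + β / 2 * (F v - F u - inner ℝ (g u) (v - u))
        + β * η / 8 * (‖g v‖ ^ 2 - ‖g u‖ ^ 2)) := by
  unfold jumpDens symDens
  rw [indicator_of_mem hz, indicator_of_mem hz]
  simp only [gaussKer, symWeight]
  have hη := h.η_pos
  -- As 1/(2σ²) = β/(4η), the cross term contributes -(β/2)⟨g(u), v - u⟩ and the last one
  -- -(βη/4)‖g(u)‖². The latter is symmetrized into -(βη/8)(‖g(u)‖² + ‖g(v)‖²) at the price of the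
  -- last term of the ratio.
  have e1 : ‖v - (u - η • g u)‖ ^ 2
      = ‖u - v‖ ^ 2 + 2 * η * inner ℝ (g u) (v - u) + η ^ 2 * ‖g u‖ ^ 2 := by
    have : v - (u - η • g u) = (v - u) + η • g u := by abel
    rw [this, norm_add_sq_real, inner_smul_right, real_inner_comm, norm_smul, mul_pow,
      norm_sub_rev v u, Real.norm_eq_abs, sq_abs]
    ring
  rw [e1, h.b_eq]
  have e2 : ∀ a b c e f p q : ℝ, p + q = a + b + c + e + f → ∀ A B : ℝ,
      A * (B * Real.exp p) * Real.exp q =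
        Real.exp a * A * (B * Real.exp b) * Real.exp c * Real.exp e * Real.exp f := by
    intro a b c e f p q hpq A B
    have : Real.exp p * Real.exp q
        = Real.exp a * Real.exp b * Real.exp c * Real.exp e * Real.exp f := by
      simp only [← Real.exp_add, hpq]
    linear_combination A * B * this
  refine e2 _ _ _ _ _ _ _ ?_ _ _
  field_simp
  ring

/-- On admissible jumps ‖v - u‖ ≤ r, with βr² = 10ηd and βr ≤ 4d. The Taylor remainder costs at most
(β/2) L₂ r² = 5 L₂ηd, and the Lipschitz gradient bounds the difference of squares by 2 L₁L₂ r. -/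
lemma abs_log_ratio_le (h : SmallStep R β η σ r L₁ L₂ F g) {u v : E}
    (hz : (u, v) ∈ jumpSet d R r) :
    |β / 2 * (F v - F u - inner ℝ (g u) (v - u)) + β * η / 8 * (‖g v‖ ^ 2 - ‖g u‖ ^ 2)|
      ≤ curvErr η L₁ L₂ d := by
  obtain ⟨hu, hv, huv⟩ := hz
  simp only at hu hv huv
  have hβ := h.β_pos; have hη := h.η_pos; have hL1 := h.L₁_nonneg; have hL2 := h.L₂_nonneg
  have hr := h.r_pos
  have hd : (1 : ℝ) ≤ d := by exact_mod_cast h.one_le_dim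
  have hr2 : β * r ^ 2 = 10 * η * d := by
    rw [h.r_sq, h.σ_sq]; field_simp; norm_num
  have h1 : |β / 2 * (F v - F u - inner ℝ (g u) (v - u))| ≤ 5 * L₂ * η * d := by
    rw [abs_mul, abs_of_pos (half_pos hβ)]
    have a1 := h.taylor u hu v hv
    have a2 : ‖v - u‖ ^ 2 ≤ r ^ 2 := pow_le_pow_left₀ (norm_nonneg _) huv 2
    have a3 := mul_le_mul_of_nonneg_left a2 hL2
    calc β / 2 * |F v - F u - inner ℝ (g u) (v - u)| ≤ β / 2 * (L₂ * r ^ 2) :=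
          mul_le_mul_of_nonneg_left (a1.trans a3) (half_pos hβ).le
      _ = L₂ / 2 * (β * r ^ 2) := by ring
      _ = _ := by rw [hr2]; ring
  have hβr : β * r ≤ 4 * d := by
    refine le_of_sq_le_sq ?_ (by positivity)
    calc (β * r) ^ 2 = β * (β * r ^ 2) := by ring
      _ = 10 * (β * η) * d := by rw [hr2]; ring
      _ ≤ 10 * 1 * d := by have := h.small_temp; gcongr
      _ ≤ (4 * d) ^ 2 := by nlinarith
  have h2 : |β * η / 8 * (‖g v‖ ^ 2 - ‖g u‖ ^ 2)| ≤ L₁ * L₂ * η * d := by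
    have a1 : |‖g v‖ ^ 2 - ‖g u‖ ^ 2| ≤ 2 * L₁ * (L₂ * r) := by
      have b1 := abs_norm_sub_norm_le (g v) (g u)
      have b2 := (b1.trans (h.grad_lip u hu v hv)).trans (mul_le_mul_of_nonneg_left huv hL2)
      have b3 : ‖g v‖ ^ 2 - ‖g u‖ ^ 2 = (‖g v‖ + ‖g u‖) * (‖g v‖ - ‖g u‖) := by ring
      rw [b3, abs_mul, abs_of_nonneg (by positivity : 0 ≤ ‖g v‖ + ‖g u‖)]
      refine mul_le_mul ?_ b2 (abs_nonneg _) (by positivity)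
      linarith [h.norm_grad u hu, h.norm_grad v hv]
    rw [abs_mul, abs_of_pos (by positivity)]
    calc β * η / 8 * |‖g v‖ ^ 2 - ‖g u‖ ^ 2| ≤ β * η / 8 * (2 * L₁ * (L₂ * r)) :=
          mul_le_mul_of_nonneg_left a1 (by positivity)
      _ = L₁ * L₂ * η / 4 * (β * r) := by ring
      _ ≤ L₁ * L₂ * η / 4 * (4 * d) := mul_le_mul_of_nonneg_left hβr (by positivity)
      _ = _ := by ring
  refine (abs_add_le _ _).trans ?_
  unfold curvErr
  linarith

/-- The factor exp(-Δ) in `symDens` is there to make the comparison one-sided, so that t - s can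
serve as a nonnegative weight. -/
lemma symDens_le_jumpDens (h : SmallStep R β η σ r L₁ L₂ F g) (z : E × E) :
    symDens R β η σ r L₁ L₂ F g z ≤ jumpDens R β η σ r F g z := by
  by_cases hz : z ∈ jumpSet d R r
  · rw [h.jumpDens_eq_mul_symDens hz]
    refine le_mul_of_one_le_right (h.symDens_nonneg z) (Real.one_le_exp ?_)
    have := neg_le_of_abs_le (h.abs_log_ratio_le hz)
    linarith
  · simp [symDens, jumpDens, hz]

lemma jumpDens_le (h : SmallStep R β η σ r L₁ L₂ F g) (z : E × E) :
    jumpDens R β η σ r F g z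
      ≤ (1 + 4 * curvErr η L₁ L₂ d) * symDens R β η σ r L₁ L₂ F g z := by
  by_cases hz : z ∈ jumpSet d R r
  · rw [h.jumpDens_eq_mul_symDens hz, mul_comm]
    refine mul_le_mul_of_nonneg_right ?_ (h.symDens_nonneg z)
    have h1 := le_of_abs_le (h.abs_log_ratio_le hz)
    have h2 := h.small_curv
    change curvErr η L₁ L₂ d ≤ 1 / 100 at h2
    have h3 := h.curvErr_nonneg
    set Δ := curvErr η L₁ L₂ d
    -- The ratio is at most exp(2Δ), and exp(2Δ) ≤ 1/(1 - 2Δ) ≤ 1 + 4Δ since Δ ≤ 1/100.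
    calc _ ≤ Real.exp (2 * Δ) := Real.exp_le_exp.2 (by linarith)
      _ ≤ 1 + 4 * Δ := by
        have h4 := Real.one_sub_le_exp_neg (2 * Δ)
        rw [Real.exp_neg] at h4
        have h5 := Real.exp_pos (2 * Δ)
        have h6 : (1 - 2 * Δ) * Real.exp (2 * Δ) ≤ 1 := by
          calc (1 - 2 * Δ) * Real.exp (2 * Δ) ≤ (Real.exp (2 * Δ))⁻¹ * Real.exp (2 * Δ) :=
                mul_le_mul_of_nonneg_right h4 h5.le
            _ = 1 := inv_mul_cancel₀ h5.ne'
        nlinarith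
  · simp [symDens, jumpDens, hz]

/-- The jump probabilities of CS-SGLD. -/
lemma integral_jumpDens (h : SmallStep R β η σ r L₁ L₂ F g) {u : E} (hu : u ∈ domain d R)
    {A : Set E} (hA : MeasurableSet A) :
    ∫ v, A.indicator 1 v * jumpDens R β η σ r F g (u, v) ∂(gibbs R β F)
      = (stdGaussian E).real {ξ | u - η • g u + σ • ξ ∈
          A ∩ (Metric.closedBall u r ∩ domain d R)} := by
  rw [← h.integral_gaussKer_gibbs (u - η • g u)
    (hA.inter (Metric.isClosed_closedBall.measurableSet.inter (measurableSet_domain R)))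
    (inter_subset_right.trans inter_subset_right)]
  congr 1
  ext v
  unfold jumpDens
  by_cases hv : v ∈ A
  · by_cases hz : (u, v) ∈ jumpSet d R r
    · have hv2 : v ∈ A ∩ (Metric.closedBall u r ∩ domain d R) :=
        ⟨hv, by simpa [dist_eq_norm] using hz.2.2, hz.2.1⟩
      rw [indicator_of_mem hv, indicator_of_mem hz, indicator_of_mem hv2]
      simp
    · have hv2 : v ∉ A ∩ (Metric.closedBall u r ∩ domain d R) := fun h2 =>
        hz ⟨hu, h2.2.2, by simpa [dist_eq_norm] using h2.2.1⟩
      rw [indicator_of_notMem hz, indicator_of_notMem hv2, mul_zero]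
  · have hv2 : v ∉ A ∩ (Metric.closedBall u r ∩ domain d R) := fun h2 => hv h2.1
    rw [indicator_of_notMem hv, indicator_of_notMem hv2, zero_mul]

lemma integral_jumpDens_le_one (h : SmallStep R β η σ r L₁ L₂ F g) (u : E) :
    ∫ v, jumpDens R β η σ r F g (u, v) ∂(gibbs R β F) ≤ 1 := by
  by_cases hu : u ∈ domain d R
  · have := h.integral_jumpDens hu MeasurableSet.univ
    simp only [indicator_univ, Pi.one_apply, one_mul] at this
    rw [this]
    exact measureReal_le_one
  · have : ∀ v, jumpDens R β η σ r F g (u, v) = 0 := fun v =>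
      indicator_of_notMem (fun hz => hu hz.1) _
    simp [this]

/-- The jump operator of the reversible approximation is bounded below by `-1/5`. -/
lemma symDens_quadForm_ge (h : SmallStep R β η σ r L₁ L₂ F g) {f : E → ℝ} (hf : BddMeas f) :
    -(1 / 5) * ∫ u, f u ^ 2 ∂(gibbs R β F)
      ≤ ∫ z, symDens R β η σ r L₁ L₂ F g z * f z.1 * f z.2
        ∂((gibbs R β F).prod (gibbs R β F)) := by
  have := h.isProbabilityMeasure
  set π := gibbs R β F with hπ
  set b := 1 / (2 * σ ^ 2) with hb
  set Z := partition R β F with hZ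
  have hZ0 : 0 < Z := h.partition_pos
  have hβ := h.β_pos
  have hη := h.η_pos
  obtain ⟨C, hC⟩ := h.exists_bound
  have bw : BddMeas ((domain d R).indicator (symWeight β η F g)) :=
    BddMeas.of_indicator (measurableSet_domain R) h.measurable_symWeight fun x hx => by
      rw [abs_of_pos (symWeight_pos x)]; exact h.symWeight_le hC hx
  set w := (domain d R).indicator (symWeight β η F g) with hw
  have bψ : BddMeas (fun x => w x * f x) := bw.mul hf
  set ψ : E → ℝ := fun x => w x * f x with hψ
  have bK : BddMeas (fun z : E × E => gaussKer b (z.1 - z.2)) :=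
    (bddMeas_gaussKer h.b_pos).comp (measurable_fst.sub measurable_snd)
  set T : Set (E × E) := {z | ‖z.2 - z.1‖ ≤ r}ᶜ with hT
  have hTm : MeasurableSet T := (measurableSet_le (by fun_prop) measurable_const).compl
  have b1T : BddMeas (T.indicator (1 : E × E → ℝ)) := BddMeas.indicator_one hTm
  have bE : ∀ c, BddMeas ((domain d R).indicator fun x => Real.exp (c * F x)) := fun c =>
    BddMeas.of_indicator (C := Real.exp (|c| * C)) (measurableSet_domain R)
      (h.measurable_F.const_mul c).exp fun x hx => by
      rw [Real.abs_exp]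
      refine Real.exp_le_exp.2 ((le_abs_self _).trans ?_)
      rw [abs_mul]
      exact mul_le_mul_of_nonneg_left (hC x hx) (abs_nonneg _)
  -- The truncated kernel is the full Gaussian kernel, which is positive semidefinite, minus the
  -- part with ‖v - u‖ > r.
  have e1 : ∀ z, symDens R β η σ r L₁ L₂ F g z * f z.1 * f z.2
      = (Real.exp (-curvErr η L₁ L₂ d) * Z) *
        (gaussKer b (z.1 - z.2) * ψ z.1 * ψ z.2
          - T.indicator 1 z * gaussKer b (z.1 - z.2) * ψ z.1 * ψ z.2) := by
    intro z
    simp only [symDens, hψ, hw, hT]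
    by_cases h1 : z.1 ∈ domain d R
    · by_cases h2 : z.2 ∈ domain d R
      · by_cases h3 : ‖z.2 - z.1‖ ≤ r
        · have hz : z ∈ jumpSet d R r := ⟨h1, h2, h3⟩
          simp only [indicator_of_mem hz, indicator_of_mem h1, indicator_of_mem h2]
          rw [indicator_of_notMem (by simpa using h3)]
          ring
        · have hz : z ∉ jumpSet d R r := fun hz => h3 hz.2.2
          have hzT : z ∈ {z : E × E | ‖z.2 - z.1‖ ≤ r}ᶜ := h3
          simp only [indicator_of_notMem hz, indicator_of_mem hzT, Pi.one_apply]
          ring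
      · have hz : z ∉ jumpSet d R r := fun hz => h2 hz.2.1
        simp [indicator_of_notMem hz, indicator_of_notMem h2]
    · have hz : z ∉ jumpSet d R r := fun hz => h1 hz.1
      simp [indicator_of_notMem hz, indicator_of_notMem h1]
  have psd := gaussKer_posSemidef h.b_pos π bψ
  have i1 := (bK.mul bψ.fst).mul bψ.snd
  have i2 := ((b1T.mul bK).mul bψ.fst).mul bψ.snd
  -- Schur test for the tail part: AM-GM with the ratio exp(β(F(v) - F(u))/2) replaces ψ(u)ψ(v) by
  -- squares, and the weights are chosen so that integrating out v against `π` gives a Gaussian tail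
  -- probability.
  set G : E × E → ℝ := fun z => T.indicator 1 z * gaussKer b (z.1 - z.2) *
    (ψ z.1 ^ 2 * (domain d R).indicator (fun x => Real.exp (-β * F x)) z.1 *
      (domain d R).indicator (fun x => Real.exp (β * F x)) z.2) with hG
  have bG : BddMeas G := (b1T.mul bK).mul (((bψ.pow 2).fst.mul (bE (-β)).fst).mul (bE β).snd)
  have hK0 : ∀ z : E × E, 0 ≤ gaussKer b (z.1 - z.2) := fun z => (gaussKer_pos h.b_pos _).le
  have hT0 : ∀ z, 0 ≤ T.indicator (1 : E × E → ℝ) z := fun z =>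
    indicator_nonneg (fun _ _ => zero_le_one) z
  have hTs : ∀ z : E × E, T.indicator (1 : E × E → ℝ) z.swap = T.indicator 1 z := by
    intro z
    simp only [indicator, hT, mem_compl_iff, mem_ofPred_eq, Prod.fst_swap, Prod.snd_swap,
      norm_sub_rev z.1 z.2, Pi.one_apply]
  have pt : ∀ z, T.indicator 1 z * gaussKer b (z.1 - z.2) * ψ z.1 * ψ z.2
      ≤ 1 / 2 * G z + 1 / 2 * G z.swap := by
    intro z
    have hGs : G z.swap = T.indicator 1 z * gaussKer b (z.1 - z.2) *
        (ψ z.2 ^ 2 * (domain d R).indicator (fun x => Real.exp (-β * F x)) z.2 *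
          (domain d R).indicator (fun x => Real.exp (β * F x)) z.1) := by
      simp only [hG]
      rw [hTs, Prod.fst_swap, Prod.snd_swap, ← gaussKer_neg _ (z.2 - z.1), neg_sub]
    rw [hGs]
    simp only [hG]
    by_cases h1 : z.1 ∈ domain d R
    · by_cases h2 : z.2 ∈ domain d R
      · simp only [indicator_of_mem h1, indicator_of_mem h2]
        have k0 : 0 ≤ T.indicator (1 : E × E → ℝ) z * gaussKer b (z.1 - z.2) :=
          mul_nonneg (hT0 z) (hK0 z)
        have key : ψ z.1 * ψ z.2 ≤ 1 / 2 * (ψ z.1 ^ 2 * Real.exp (-β * F z.1) *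
            Real.exp (β * F z.2)) + 1 / 2 * (ψ z.2 ^ 2 * Real.exp (-β * F z.2) *
            Real.exp (β * F z.1)) := by
          set x := Real.exp (β / 2 * (F z.2 - F z.1)) with hx
          have x0 : 0 < x := Real.exp_pos _
          have ex1 : Real.exp (-β * F z.1) * Real.exp (β * F z.2) = x ^ 2 := by
            rw [hx, ← Real.exp_add, ← Real.exp_nat_mul]
            congr 1; push_cast; ring
          have ex2 : Real.exp (-β * F z.2) * Real.exp (β * F z.1) = x⁻¹ ^ 2 := by
            rw [hx, ← Real.exp_add, ← Real.exp_neg, ← Real.exp_nat_mul]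
            congr 1; push_cast; ring
          rw [mul_assoc (ψ z.1 ^ 2), mul_assoc (ψ z.2 ^ 2), ex1, ex2]
          have : (ψ z.1 * x) * (ψ z.2 * x⁻¹) = ψ z.1 * ψ z.2 := by field_simp
          nlinarith [sq_nonneg (ψ z.1 * x - ψ z.2 * x⁻¹)]
        have := mul_le_mul_of_nonneg_left key k0
        linarith
      · have : ψ z.2 = 0 := by simp [hψ, hw, indicator_of_notMem h2]
        simp [this, indicator_of_notMem h2]
    · have : ψ z.1 = 0 := by simp [hψ, hw, indicator_of_notMem h1]
      simp [this, indicator_of_notMem h1]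
  -- Up to Z, this is the probability that a Gaussian move from u ends in the ball but beyond r. As
  -- r² = 5dσ², it is at most P(‖ξ‖² ≥ 5d) ≤ 1/5.
  have tail : ∀ u, u ∈ domain d R → Z * ∫ v, T.indicator 1 (u, v) * gaussKer b (u - v) *
      (domain d R).indicator (fun x => Real.exp (β * F x)) v ∂π ≤ 1 / 5 := by
    intro u hu
    have hAm : MeasurableSet ((Metric.closedBall u r)ᶜ ∩ domain d R) :=
      Metric.isClosed_closedBall.measurableSet.compl.inter (measurableSet_domain R)
    have e := h.integral_gaussKer_gibbs u hAm inter_subset_right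
    have e' : ∫ x, ((Metric.closedBall u r)ᶜ ∩ domain d R).indicator (fun x => Z *
        gaussKer b (x - u) * Real.exp (β * F x)) x ∂π = Z * ∫ v, T.indicator 1 (u, v) *
        gaussKer b (u - v) * (domain d R).indicator (fun x => Real.exp (β * F x)) v ∂π := by
      rw [← integral_const_mul]
      congr 1
      ext v
      rw [← gaussKer_neg _ (u - v), neg_sub]
      have hTv : (u, v) ∈ T ↔ v ∈ (Metric.closedBall u r)ᶜ := by
        simp [hT, dist_eq_norm]
      by_cases h2 : v ∈ domain d R
      · by_cases h3 : v ∈ (Metric.closedBall u r)ᶜ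
        · rw [indicator_of_mem (show v ∈ (Metric.closedBall u r)ᶜ ∩ domain d R from ⟨h3, h2⟩), indicator_of_mem (hTv.2 h3), indicator_of_mem h2]
          simp only [Pi.one_apply]
          ring
        · rw [indicator_of_notMem (fun hh => h3 hh.1), indicator_of_notMem (fun hh => h3 (hTv.1 hh))]
          ring
      · rw [indicator_of_notMem (fun hh => h2 hh.2), indicator_of_notMem h2]
        ring
    rw [← e', e]
    have h5 := stdGaussian_norm_tail (d := d) h.one_le_dim (c := 5) (by norm_num)
    refine (measureReal_mono fun ξ hξ => ?_).trans h5
    have h6 := hξ.1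
    simp only [mem_compl_iff, Metric.mem_closedBall, not_le, dist_eq_norm, add_sub_cancel_left,
      norm_smul, Real.norm_eq_abs, abs_of_pos h.σ_pos] at h6
    have h7 : r ^ 2 ≤ (σ * ‖ξ‖) ^ 2 := pow_le_pow_left₀ h.r_pos.le h6.le 2
    rw [h.r_sq, mul_pow] at h7
    have h8 : 0 < σ ^ 2 := by have := h.σ_pos; positivity
    exact le_of_mul_le_mul_right (by linarith) h8
  have GI : Z * ∫ z, G z ∂(π.prod π) ≤ 1 / 5 * ∫ u, f u ^ 2 ∂π := by
    rw [integral_prod _ (bG.integrable _), ← integral_const_mul, ← integral_const_mul]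
    refine integral_mono ((bG.integral_right π).const_mul Z |>.integrable π)
      (((hf.pow 2).const_mul _).integrable π) fun u => ?_
    simp only
    by_cases hu : u ∈ domain d R
    · have e : ∀ v, G (u, v) = (ψ u ^ 2 * Real.exp (-β * F u)) * (T.indicator 1 (u, v) *
          gaussKer b (u - v) * (domain d R).indicator (fun x => Real.exp (β * F x)) v) := by
        intro v
        simp only [hG, indicator_of_mem hu]
        ring
      simp only [e]
      rw [integral_const_mul]
      -- The squared weight is exp(βF(u)) times a factor at most 1, so the density of `π`
      -- compensates it.
      have q : ψ u ^ 2 * Real.exp (-β * F u) ≤ f u ^ 2 := by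
        simp only [hψ, hw, indicator_of_mem hu, symWeight]
        rw [mul_pow, ← Real.exp_nat_mul, mul_right_comm, ← Real.exp_add]
        refine mul_le_of_le_one_left (sq_nonneg _) (Real.exp_le_one_iff.2 ?_)
        have : 0 ≤ β * η / 8 * ‖g u‖ ^ 2 := by positivity
        push_cast
        linarith
      have q0 : 0 ≤ ψ u ^ 2 * Real.exp (-β * F u) := by positivity
      have := mul_le_mul_of_nonneg_left (tail u hu) q0
      linarith
    · have e : ∀ v, G (u, v) = 0 := by
        intro v
        simp only [hG, indicator_of_notMem hu]
        ring
      simp only [e, integral_zero, mul_zero]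
      positivity
  have I2 : ∫ z, T.indicator 1 z * gaussKer b (z.1 - z.2) * ψ z.1 * ψ z.2 ∂(π.prod π)
      ≤ ∫ z, G z ∂(π.prod π) := by
    have bGs : BddMeas (fun z : E × E => G z.swap) := bG.comp measurable_swap
    refine (integral_mono (i2.integrable _)
      (((bG.const_mul _).add (bGs.const_mul _)).integrable _) pt).trans_eq ?_
    rw [(bG.const_mul _).integral_add (bGs.const_mul _), integral_const_mul, integral_const_mul,
      integral_prod_swap]
    ring
  simp only [e1]
  rw [integral_const_mul, i1.integral_sub i2]
  have hexp : Real.exp (-curvErr η L₁ L₂ d) ≤ 1 :=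
    Real.exp_le_one_iff.2 (neg_nonpos.2 h.curvErr_nonneg)
  have hexp0 := Real.exp_pos (-curvErr η L₁ L₂ d)
  have hN : 0 ≤ ∫ u, f u ^ 2 ∂π := integral_nonneg fun u => sq_nonneg _
  have k1 := mul_le_mul_of_nonneg_left I2 hZ0.le
  have k2 : -(1 / 5) * ∫ u, f u ^ 2 ∂π ≤ Z * (∫ z, gaussKer b (z.1 - z.2) * ψ z.1 * ψ z.2 ∂(π.prod π)
      - ∫ z, T.indicator 1 z * gaussKer b (z.1 - z.2) * ψ z.1 * ψ z.2 ∂(π.prod π)) := by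
    have := mul_nonneg hZ0.le psd
    linarith
  rw [mul_assoc]
  have k3 := mul_le_mul_of_nonneg_left k2 hexp0.le
  nlinarith

end SmallStep

end Kernel

end CSSGLD

/-! ### Ergodic flow and conductance. -/

namespace CSSGLD

section Flow

variable {X : Type*} [MeasurableSpace X] {π : Measure X} [IsProbabilityMeasure π] {s : X × X → ℝ}

lemma flow_eq_integral (hs : BddMeas s) {A : Set X} (hA : MeasurableSet A) :
    flow π s A = ∫ u, A.indicator 1 u * ∫ v, Aᶜ.indicator 1 v * s (u, v) ∂π ∂π := by
  have b1 : BddMeas (A.indicator (1 : X → ℝ)) := BddMeas.indicator_one hA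
  have b2 : BddMeas (Aᶜ.indicator (1 : X → ℝ)) := BddMeas.indicator_one hA.compl
  rw [flow, integral_prod _ ((hs.mul (b1.fst.mul b2.snd)).integrable _)]
  refine integral_congr_ae (ae_of_all _ fun u => ?_)
  simp only
  rw [← integral_const_mul]
  refine integral_congr_ae (ae_of_all _ fun v => ?_)
  simp only
  ring

lemma flow_compl (hsymm : ∀ u v, s (u, v) = s (v, u)) (A : Set X) :
    flow π s Aᶜ = flow π s A := by
  rw [flow, flow, ← integral_prod_swap]
  refine integral_congr_ae (ae_of_all _ fun z => ?_)
  simp only [Prod.fst_swap, Prod.snd_swap, compl_compl]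
  rw [show z.swap = (z.2, z.1) from rfl, hsymm z.2 z.1]
  ring

/-- The flow out of A is the integral over A of the escape probability, so it can be bounded on the
subset B alone. -/
lemma mul_measureReal_le_flow (hs : BddMeas s) (hs0 : ∀ z, 0 ≤ s z) {A B : Set X}
    (hA : MeasurableSet A) (hB : MeasurableSet B) (hBA : B ⊆ A) {c : ℝ}
    (hc : ∀ᵐ u ∂π, u ∈ B → c ≤ ∫ v, Aᶜ.indicator 1 v * s (u, v) ∂π) :
    c * π.real B ≤ flow π s A := by
  have b1 : BddMeas (A.indicator (1 : X → ℝ)) := BddMeas.indicator_one hA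
  have b2 : BddMeas (Aᶜ.indicator (1 : X → ℝ)) := BddMeas.indicator_one hA.compl
  have bB : BddMeas (B.indicator (1 : X → ℝ)) := BddMeas.indicator_one hB
  rw [flow_eq_integral hs hA, ← integral_indicator_one hB, ← integral_const_mul]
  refine integral_mono_ae ((bB.const_mul c).integrable π)
    ((b1.mul ((b2.snd.mul hs).integral_right π)).integrable π) ?_
  filter_upwards [hc] with u hu
  by_cases h1 : u ∈ B
  · rw [indicator_of_mem h1, indicator_of_mem (hBA h1)]
    simpa using hu h1
  · rw [indicator_of_notMem h1, mul_zero]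
    refine mul_nonneg (indicator_nonneg (fun _ _ => zero_le_one) _) (integral_nonneg fun v => ?_)
    exact mul_nonneg (indicator_nonneg (fun _ _ => zero_le_one) _) (hs0 _)

end Flow

section Conductance

variable {d : ℕ}

local notation "E" => EuclideanSpace ℝ (Fin d)

lemma exists_norm_eq_one (hd : 1 ≤ d) : ∃ e : E, ‖e‖ = 1 :=
  ⟨EuclideanSpace.single ⟨0, hd⟩ 1, by simp⟩

lemma exists_direction (hd : 1 ≤ d) (m : E) : ∃ e : E, ‖e‖ = 1 ∧ m = ‖m‖ • e := by
  by_cases hm : m = 0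
  · obtain ⟨e, he⟩ := exists_norm_eq_one hd
    exact ⟨e, he, by simp [hm]⟩
  · have : ‖m‖ ≠ 0 := norm_ne_zero_iff.2 hm
    refine ⟨‖m‖⁻¹ • m, ?_, ?_⟩
    · rw [norm_smul, norm_inv, norm_norm, inv_mul_cancel₀ this]
    · rw [smul_smul, mul_inv_cancel₀ this, one_smul]

/-- Points reached from `m` by a typical Gaussian move which stays in the ball and avoids a thin
slab. -/
def reachSet {d : ℕ} (R σ r L₁ : ℝ) (g : EuclideanSpace ℝ (Fin d) → EuclideanSpace ℝ (Fin d))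
    (e : EuclideanSpace ℝ (Fin d)) (a : ℝ) (m : EuclideanSpace ℝ (Fin d)) :
    Set (EuclideanSpace ℝ (Fin d)) :=
  (domain d R ∩ {x | ‖x - m‖ ≤ 9 / 10 * r}) ∩
    ({x | inner ℝ e x ∈ Ico a (a + σ / 100)}ᶜ ∩ {x | inner ℝ (g m) (x - m) ≤ 10 * σ * L₁})

lemma measurableSet_slab (e : E) (a c : ℝ) : MeasurableSet {x : E | inner ℝ e x ∈ Ico a c} :=
  measurableSet_Ico.preimage (by fun_prop : Measurable fun x : E => inner ℝ e x)

lemma measurableSet_reachSet (R σ r L₁ : ℝ) (g : E → E) (e : E) (a : ℝ) (m : E) :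
    MeasurableSet (reachSet R σ r L₁ g e a m) :=
  ((measurableSet_domain R).inter (measurableSet_le (by fun_prop) measurable_const)).inter
    ((measurableSet_slab e a _).compl.inter (measurableSet_le (by fun_prop) measurable_const))

namespace SmallStep

variable {R β η σ r L₁ L₂ : ℝ} {F : EuclideanSpace ℝ (Fin d) → ℝ}
  {g : EuclideanSpace ℝ (Fin d) → EuclideanSpace ℝ (Fin d)}

/-- In the outer half of the ball the inward component lowers the squared norm by at least σR/100,
which pays for σ²‖ξ‖² because 405σd ≤ R. In the inner half the step is too short to reach the
boundary. -/
lemma add_smul_mem_domain (h : SmallStep R β η σ r L₁ L₂ F g) {m ξ e : E} (hm : m ∈ domain d R)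
    (he : m = ‖m‖ • e) (h1 : inner ℝ e ξ < -(1 / 100)) (h2 : ‖ξ‖ ^ 2 < 81 / 20 * d) :
    m + σ • ξ ∈ domain d R := by
  have hσ := h.σ_pos
  have hR := h.R_pos
  have hd : (1 : ℝ) ≤ d := by exact_mod_cast h.one_le_dim
  have hmR : ‖m‖ ≤ R := by simpa [domain] using hm
  have hdim := h.small_dim
  suffices hsq : ‖m + σ • ξ‖ ^ 2 ≤ R ^ 2 by
    simpa [domain] using le_of_sq_le_sq hsq hR.le
  have e1 : inner ℝ m (σ • ξ) = σ * (‖m‖ * inner ℝ e ξ) := by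
    rw [inner_smul_right]
    congr 1
    conv_lhs => rw [he]
    rw [real_inner_smul_left]
  rw [norm_add_sq_real, e1, norm_smul, mul_pow, Real.norm_eq_abs, sq_abs]
  have a1 : σ ^ 2 * ‖ξ‖ ^ 2 ≤ σ ^ 2 * (81 / 20 * d) :=
    mul_le_mul_of_nonneg_left h2.le (sq_nonneg _)
  have a2 : ‖m‖ * inner ℝ e ξ ≤ ‖m‖ * (-(1 / 100)) :=
    mul_le_mul_of_nonneg_left h1.le (norm_nonneg _)
  have a3 := mul_le_mul_of_nonneg_left a2 hσ.le
  have a4 : σ ^ 2 * (81 / 20 * d) ≤ σ * R / 100 := by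
    have := mul_le_mul_of_nonneg_left hdim hσ.le
    nlinarith
  rcases le_total (R / 2) ‖m‖ with hc | hc
  · have a5 : ‖m‖ ^ 2 ≤ R ^ 2 := pow_le_pow_left₀ (norm_nonneg _) hmR 2
    have a6 := mul_le_mul_of_nonneg_left hc hσ.le
    linarith
  · have a5 : ‖m‖ ^ 2 ≤ (R / 2) ^ 2 := pow_le_pow_left₀ (norm_nonneg _) hc 2
    have a6 : σ ≤ R := by nlinarith
    have a7 := mul_le_mul_of_nonneg_right a6 hR.le
    have a8 : 0 ≤ σ * ‖m‖ := by positivity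
    nlinarith

lemma reachSet_prob (h : SmallStep R β η σ r L₁ L₂ F g) {m e : E} (hm : m ∈ domain d R)
    (he : ‖e‖ = 1) (a : ℝ) :
    22 / 100 ≤ (stdGaussian E).real {ξ | m + σ • ξ ∈ reachSet R σ r L₁ g e a m} := by
  have hσ := h.σ_pos
  obtain ⟨e₁, he₁, hme⟩ := exists_direction h.one_le_dim m
  obtain ⟨e₂, he₂, hge⟩ := exists_direction h.one_le_dim (g m)
  -- Union bound: an inward move has probability at least 49/100; excessive norm costs 20/81, a
  -- large gradient component 1/100 and the slab 1/100, leaving more than 22/100. The cutoff 81/20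
  -- is 5 · (9/10)², which matches the radius 9r/10.
  have p1 := stdGaussian_inner_le he₁ (ε := 1 / 100) (by norm_num)
  have p2 := stdGaussian_norm_tail (d := d) h.one_le_dim (c := 81 / 20) (by norm_num)
  have p3 := stdGaussian_inner_tail he₂ (c := 10) (by norm_num)
  have p4 := stdGaussian_inner_mem_Ico he ((a - inner ℝ e m) / σ) (ε := 1 / 100) (by norm_num)
  set V := {ξ : E | m + σ • ξ ∈ reachSet R σ r L₁ g e a m}
  set S₂ := {ξ : E | 81 / 20 * (d : ℝ) ≤ ‖ξ‖ ^ 2}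
  set S₃ := {ξ : E | 10 ≤ inner ℝ e₂ ξ}
  set S₄ := {ξ : E | inner ℝ e ξ ∈
    Ico ((a - inner ℝ e m) / σ) ((a - inner ℝ e m) / σ + 1 / 100)}
  have hsub : {ξ : E | inner ℝ e₁ ξ < -(1 / 100)} ⊆ ((V ∪ S₂) ∪ S₃) ∪ S₄ := by
    intro ξ hξ
    by_contra hcon
    simp only [mem_union, not_or] at hcon
    obtain ⟨⟨⟨hV, h2⟩, h3⟩, h4⟩ := hcon
    have h2' : ‖ξ‖ ^ 2 < 81 / 20 * d := not_le.1 h2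
    have h3' : inner ℝ e₂ ξ < 10 := not_le.1 h3
    refine hV ⟨⟨h.add_smul_mem_domain hm hme hξ h2', ?_⟩, ?_, ?_⟩
    · simp only [mem_ofPred_eq, add_sub_cancel_left, norm_smul, Real.norm_eq_abs, abs_of_pos hσ]
      have hr := h.r_pos
      refine le_of_sq_le_sq ?_ (by positivity)
      have : σ ^ 2 * ‖ξ‖ ^ 2 ≤ σ ^ 2 * (81 / 20 * d) :=
        mul_le_mul_of_nonneg_left h2'.le (sq_nonneg _)
      rw [mul_pow, mul_pow, h.r_sq]
      linarith
    · intro hx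
      refine h4 ?_
      simp only [mem_ofPred_eq, inner_add_right, inner_smul_right, mem_Ico] at hx
      obtain ⟨hx1, hx2⟩ := hx
      refine ⟨?_, ?_⟩
      · rw [div_le_iff₀ hσ]; linarith
      · rw [div_add' _ _ _ hσ.ne', lt_div_iff₀ hσ]; linarith
    · simp only [mem_ofPred_eq, add_sub_cancel_left, inner_smul_right]
      have e1 : inner ℝ (g m) ξ = ‖g m‖ * inner ℝ e₂ ξ := by
        conv_lhs => rw [hge]
        rw [real_inner_smul_left]
      rw [e1]
      have a1 : ‖g m‖ * inner ℝ e₂ ξ ≤ ‖g m‖ * 10 :=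
        mul_le_mul_of_nonneg_left h3'.le (norm_nonneg _)
      have a2 := h.norm_grad m hm
      have := mul_le_mul_of_nonneg_left (a1.trans (mul_le_mul_of_nonneg_right a2 (by norm_num)))
        hσ.le
      linarith
  have hle := (measureReal_mono (μ := stdGaussian E) hsub).trans
    ((measureReal_union_le _ _).trans (add_le_add
      ((measureReal_union_le _ _).trans (add_le_add (measureReal_union_le _ _) le_rfl)) le_rfl))
  norm_num at p1 p2 p3 p4 hle ⊢
  linarith

/-- Gaussian proposal density around `m`, relative to the Gibbs measure, restricted to
`reachSet`. -/
noncomputable def _root_.CSSGLD.reachDens {d : ℕ} (R β σ r L₁ : ℝ)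
    (F : EuclideanSpace ℝ (Fin d) → ℝ) (g : EuclideanSpace ℝ (Fin d) → EuclideanSpace ℝ (Fin d))
    (e : EuclideanSpace ℝ (Fin d)) (a : ℝ) (m : EuclideanSpace ℝ (Fin d)) :
    EuclideanSpace ℝ (Fin d) → ℝ :=
  (reachSet R σ r L₁ g e a m).indicator fun x => partition R β F *
    gaussKer (1 / (2 * σ ^ 2)) (x - m) * Real.exp (β * F x)

lemma bddMeas_reachDens (h : SmallStep R β η σ r L₁ L₂ F g) (e : E) (a : ℝ) (m : E) :
    BddMeas (reachDens R β σ r L₁ F g e a m) := by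
  obtain ⟨C, hC⟩ := h.exists_bound
  obtain ⟨-, C', hC'⟩ := bddMeas_gaussKer (d := d) h.b_pos
  have hF := h.measurable_F
  have hβ := h.β_pos
  refine BddMeas.of_indicator (C := partition R β F * C' * Real.exp (β * C))
    (measurableSet_reachSet R σ r L₁ g e a m) ?_ fun x hx => ?_
  · have := (continuous_gaussKer (d := d) (1 / (2 * σ ^ 2))).measurable
    fun_prop
  · rw [abs_mul, abs_mul, abs_of_pos h.partition_pos, Real.abs_exp]
    have h1 := hC' (x - m)
    refine mul_le_mul (mul_le_mul_of_nonneg_left h1 h.partition_pos.le) (Real.exp_le_exp.2 ?_)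
      (Real.exp_pos _).le (mul_nonneg h.partition_pos.le ((abs_nonneg _).trans h1))
    exact mul_le_mul_of_nonneg_left ((le_abs_self _).trans (hC _ hx.1.1)) hβ.le

lemma le_integral_reachDens (h : SmallStep R β η σ r L₁ L₂ F g) {m e : E} (hm : m ∈ domain d R)
    (he : ‖e‖ = 1) (a : ℝ) :
    22 / 100 ≤ ∫ x, reachDens R β σ r L₁ F g e a m x ∂(gibbs R β F) := by
  have h1 := h.integral_gaussKer_gibbs m (measurableSet_reachSet R σ r L₁ g e a m)
    (inter_subset_left.trans inter_subset_left)
  unfold reachDens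
  rw [h1]
  exact h.reachSet_prob hm he a

/-- The drift condition controls this term because (βσL₁)² = 2βηL₁². -/
lemma grad_term_le (h : SmallStep R β η σ r L₁ L₂ F g) {x : E} (hx : x ∈ domain d R) :
    β * η / 8 * ‖g x‖ ^ 2 ≤ 1 / 1000 := by
  have hβ := h.β_pos; have hη := h.η_pos; have hL := h.L₁_nonneg; have hσ := h.σ_pos
  have h1 : ‖g x‖ ^ 2 ≤ L₁ ^ 2 := pow_le_pow_left₀ (norm_nonneg _) (h.norm_grad x hx) 2
  have h2 : (β * σ * L₁) ^ 2 ≤ (1 / 200) ^ 2 := pow_le_pow_left₀ (by positivity) h.small_drift 2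
  have h3 : (β * σ * L₁) ^ 2 = 2 * (β * η) * L₁ ^ 2 := by
    rw [mul_pow, mul_pow, h.σ_sq]; field_simp
  have h4 := mul_le_mul_of_nonneg_left h1 (show 0 ≤ β * η / 8 by positivity)
  nlinarith

/-- The half-space condition in `reachSet` bounds the first-order increase of F by 10σL₁, and the
radius 9r/10 bounds the Taylor remainder. After multiplication by β/2 these contribute at most 1/40
and 81/10000. -/
lemma reachSet_exponent (h : SmallStep R β η σ r L₁ L₂ F g) {m e x : E} {a : ℝ}
    (hm : m ∈ domain d R) (hx : x ∈ reachSet R σ r L₁ g e a m) :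
    -(4 / 100) ≤ β / 2 * (F m - F x) := by
  have hβ := h.β_pos; have hη := h.η_pos; have hL := h.L₁_nonneg; have hL2 := h.L₂_nonneg
  have hr := h.r_pos
  obtain ⟨⟨hxD, hxr⟩, -, hxg⟩ := hx
  simp only [mem_ofPred_eq] at hxr hxg
  have h1 := le_of_abs_le (h.taylor m hm x hxD)
  have h2 : ‖x - m‖ ^ 2 ≤ (9 / 10 * r) ^ 2 := pow_le_pow_left₀ (norm_nonneg _) hxr 2
  have h3 := mul_le_mul_of_nonneg_left h2 hL2
  have h4 : F x - F m ≤ 10 * σ * L₁ + L₂ * (9 / 10 * r) ^ 2 := by linarith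
  have h5 := mul_le_mul_of_nonneg_left h4 (half_pos hβ).le
  have h6 : β * r ^ 2 = 10 * η * d := by
    rw [h.r_sq, h.σ_sq]; field_simp; ring
  have h7 := h.small_drift
  have h8 := h.small_curv
  have h9 : 0 ≤ L₁ * L₂ * η * d := by positivity
  have h10 : β / 2 * (L₂ * (9 / 10 * r) ^ 2) = 81 / 20 * L₂ * η * d := by
    linear_combination (81 / 200 * L₂) * h6
  have h11 : 0 ≤ L₂ * η * d := by positivity
  nlinarith

lemma exp_ge_of_ge {x : ℝ} (hx : -(1 / 10) ≤ x) : 9 / 10 ≤ Real.exp x := by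
  linarith [Real.add_one_le_exp x]

/-- From any point, the reversible approximation leaves a thin slab with probability bounded
below. -/
lemma slab_escape (h : SmallStep R β η σ r L₁ L₂ F g) {u e : E} (hu : u ∈ domain d R)
    (he : ‖e‖ = 1) (a : ℝ) :
    19 / 100 ≤ ∫ v, {x : E | inner ℝ e x ∈ Ico a (a + σ / 100)}ᶜ.indicator 1 v *
      symDens R β η σ r L₁ L₂ F g (u, v) ∂(gibbs R β F) := by
  have := h.isProbabilityMeasure
  have h0 := h.le_integral_reachDens hu he a
  have bs := h.bddMeas_symDens
  have b1 : BddMeas ({x : E | inner ℝ e x ∈ Ico a (a + σ / 100)}ᶜ.indicator (1 : E → ℝ)) :=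
    BddMeas.indicator_one (measurableSet_slab e a _).compl
  -- Off the slab and within reach, `symDens` differs from the Gaussian density relative to `π` only
  -- by the exponential of a quantity above -1/10.
  have key : ∀ v, 9 / 10 * reachDens R β σ r L₁ F g e a u v
      ≤ {x : E | inner ℝ e x ∈ Ico a (a + σ / 100)}ᶜ.indicator 1 v *
        symDens R β η σ r L₁ L₂ F g (u, v) := by
    intro v
    by_cases hv : v ∈ reachSet R σ r L₁ g e a u
    · have hz : (u, v) ∈ jumpSet d R r := ⟨hu, hv.1.1, by
        have := hv.1.2
        have hr := h.r_pos
        simp only [mem_ofPred_eq] at this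
        simp only
        linarith⟩
      have hexp : 9 / 10 ≤ Real.exp (-curvErr η L₁ L₂ d + β / 2 * (F u - F v)
          - β * η / 8 * ‖g u‖ ^ 2 - β * η / 8 * ‖g v‖ ^ 2) := by
        refine exp_ge_of_ge ?_
        have h1 := h.reachSet_exponent hu hv
        have h2 := h.grad_term_le hu
        have h3 := h.grad_term_le hv.1.1
        have h4 := h.small_curv
        change curvErr η L₁ L₂ d ≤ 1 / 100 at h4
        linarith
      rw [reachDens, symDens, indicator_of_mem hv, indicator_of_mem hz,
        indicator_of_mem hv.2.1]
      simp only [Pi.one_apply, one_mul]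
      have hK := gaussKer_pos h.b_pos (v - u)
      have hZ := h.partition_pos
      rw [← gaussKer_neg _ (u - v), neg_sub]
      have e1 : Real.exp (-curvErr η L₁ L₂ d) * symWeight β η F g u * symWeight β η F g v
          = Real.exp (-curvErr η L₁ L₂ d + β / 2 * (F u - F v)
          - β * η / 8 * ‖g u‖ ^ 2 - β * η / 8 * ‖g v‖ ^ 2) * Real.exp (β * F v) := by
        simp only [symWeight, ← Real.exp_add]
        congr 1; ring
      have hp : 0 ≤ partition R β F * gaussKer (1 / (2 * σ ^ 2)) (v - u) * Real.exp (β * F v) := by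
        positivity
      have := mul_le_mul_of_nonneg_right hexp hp
      refine this.trans_eq ?_
      linear_combination (-(partition R β F * gaussKer (1 / (2 * σ ^ 2)) (v - u))) * e1
    · rw [reachDens, indicator_of_notMem hv, mul_zero]
      exact mul_nonneg (indicator_nonneg (fun _ _ => zero_le_one) _) (h.symDens_nonneg _)
  have := integral_mono (μ := gibbs R β F)
    (((h.bddMeas_reachDens e a u).const_mul (9 / 10)).integrable _)
    ((b1.mul (bs.comp measurable_prodMk_left)).integrable _) key
  rw [integral_const_mul] at this
  linarith

/-- Nearby points have overlapping jump densities. -/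
lemma sq_reachDens_le (h : SmallStep R β η σ r L₁ L₂ F g) {u v e : E} (a : ℝ)
    (hu : u ∈ domain d R) (hv : v ∈ domain d R) (huv : ‖u - v‖ ≤ σ / 100) (x : E) :
    (9 / 10 * reachDens R β σ r L₁ F g e a ((1 / 2 : ℝ) • (u + v)) x) ^ 2
      ≤ symDens R β η σ r L₁ L₂ F g (u, x) * symDens R β η σ r L₁ L₂ F g (v, x) := by
  set m := (1 / 2 : ℝ) • (u + v) with hmdef
  by_cases hx : x ∈ reachSet R σ r L₁ g e a m
  swap
  · rw [reachDens, indicator_of_notMem hx]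
    simpa using mul_nonneg (h.symDens_nonneg _) (h.symDens_nonneg _)
  have hβ := h.β_pos; have hη := h.η_pos; have hL := h.L₁_nonneg; have hσ := h.σ_pos
  have hr := h.r_pos
  have hd : (1 : ℝ) ≤ d := by exact_mod_cast h.one_le_dim
  have hxD := hx.1.1
  have hum : u - m = (1 / 2 : ℝ) • (u - v) := by rw [hmdef]; module
  have hvm : v - m = -((1 / 2 : ℝ) • (u - v)) := by rw [hmdef]; module
  have num : ‖u - m‖ = ‖u - v‖ / 2 := by rw [hum, norm_smul]; norm_num; ring
  have nvm : ‖v - m‖ = ‖u - v‖ / 2 := by rw [hvm, norm_neg, norm_smul]; norm_num; ring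
  have hm : m ∈ domain d R := by
    have := (convex_closedBall (0 : E) R) hu hv (show (0 : ℝ) ≤ 1 / 2 by norm_num)
      (show (0 : ℝ) ≤ 1 / 2 by norm_num) (by norm_num)
    rwa [← smul_add] at this
  -- The midpoint is within σ/200 of u and of v, so points within 9r/10 of it are admissible jumps
  -- from both.
  have hr2 : 2 * σ ≤ r := by
    refine le_of_sq_le_sq ?_ hr.le
    rw [h.r_sq]
    nlinarith [sq_nonneg σ]
  have hxm : ‖x - m‖ ≤ 9 / 10 * r := hx.1.2
  have hzu : (u, x) ∈ jumpSet d R r := ⟨hu, hxD, by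
    have h1 : x - u = (x - m) - (u - m) := by abel
    have h2 := norm_sub_le (x - m) (u - m)
    rw [← h1, num] at h2
    simp only
    linarith⟩
  have hzv : (v, x) ∈ jumpSet d R r := ⟨hv, hxD, by
    have h1 : x - v = (x - m) - (v - m) := by abel
    have h2 := norm_sub_le (x - m) (v - m)
    rw [← h1, nvm] at h2
    simp only
    linarith⟩
  -- By the parallelogram law, two Gaussian densities centred at u and v multiply to the square of
  -- the one centred at the midpoint, up to exp(-‖u - v‖²/(4σ²)), which is close to 1 here.
  have hK : gaussKer (1 / (2 * σ ^ 2)) (u - x) * gaussKer (1 / (2 * σ ^ 2)) (v - x)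
      = gaussKer (1 / (2 * σ ^ 2)) (x - m) ^ 2 *
        Real.exp (-(1 / (2 * σ ^ 2)) * (‖u - v‖ ^ 2 / 2)) := by
    have pl := parallelogram_law_with_norm ℝ (u - x) (v - x)
    have e1 : (u - x) + (v - x) = -((2 : ℝ) • (x - m)) := by rw [hmdef]; module
    have e2 : (u - x) - (v - x) = u - v := by abel
    rw [e1, e2, norm_neg, norm_smul, Real.norm_eq_abs, abs_two, mul_pow] at pl
    simp only [gaussKer]
    rw [mul_pow, mul_mul_mul_comm, ← Real.exp_add, ← Real.exp_nat_mul, ← sq, mul_assoc,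
      ← Real.exp_add]
    congr 2
    push_cast
    linear_combination (1 / (2 * σ ^ 2) / 2) * pl
  -- The exponent is halved because the comparison is with the geometric mean of the two jump
  -- densities.
  have hexp : 9 / 10 ≤ Real.exp ((-2 * curvErr η L₁ L₂ d - (1 / (2 * σ ^ 2)) * (‖u - v‖ ^ 2 / 2)
      + β / 2 * (F u + F v) - β * F x - β * η / 8 * ‖g u‖ ^ 2 - β * η / 8 * ‖g v‖ ^ 2
      - 2 * (β * η / 8 * ‖g x‖ ^ 2)) / 2) := by
    refine exp_ge_of_ge ?_
    have h1 := h.reachSet_exponent hm hx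
    have h2 := h.grad_term_le hu
    have h3 := h.grad_term_le hv
    have h3' := h.grad_term_le hxD
    have h4 := h.small_curv
    change curvErr η L₁ L₂ d ≤ 1 / 100 at h4
    have h5 := neg_le_of_abs_le (h.lip m hm u hu)
    have h6 := neg_le_of_abs_le (h.lip m hm v hv)
    rw [num] at h5
    rw [nvm] at h6
    have h7 : 1 / (2 * σ ^ 2) * (‖u - v‖ ^ 2 / 2) ≤ 1 / 1000 := by
      have : ‖u - v‖ ^ 2 ≤ (σ / 100) ^ 2 := pow_le_pow_left₀ (norm_nonneg _) huv 2
      rw [div_mul_eq_mul_div, div_le_iff₀ (by positivity)]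
      nlinarith
    have h8 : β / 2 * (F u + F v) ≥ β * F m - 1 / 1000 := by
      have h9 := h.small_drift
      have h10 := mul_le_mul_of_nonneg_left huv (show 0 ≤ β * L₁ by positivity)
      have h11 : 2 * F m - L₁ * ‖u - v‖ ≤ F u + F v := by linarith
      have h12 := mul_le_mul_of_nonneg_left h11 (half_pos hβ).le
      nlinarith
    linarith
  have e1 : symDens R β η σ r L₁ L₂ F g (u, x) * symDens R β η σ r L₁ L₂ F g (v, x)
      = (Real.exp ((-2 * curvErr η L₁ L₂ d - (1 / (2 * σ ^ 2)) * (‖u - v‖ ^ 2 / 2)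
      + β / 2 * (F u + F v) - β * F x - β * η / 8 * ‖g u‖ ^ 2 - β * η / 8 * ‖g v‖ ^ 2
      - 2 * (β * η / 8 * ‖g x‖ ^ 2)) / 2) * (partition R β F *
        gaussKer (1 / (2 * σ ^ 2)) (x - m) * Real.exp (β * F x))) ^ 2 := by
    rw [symDens, indicator_of_mem hzu, indicator_of_mem hzv]
    simp only [symWeight]
    have e2 : ∀ c p q a b Z K₁ K₂ : ℝ, c * Z * K₁ * p * a * (c * Z * K₂ * q * b)
        = Z ^ 2 * (K₁ * K₂) * (c * c * p * q * a * b) := by intros; ring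
    rw [e2, hK, mul_pow, mul_pow, mul_pow, ← Real.exp_nat_mul, ← Real.exp_nat_mul]
    simp only [← Real.exp_add]
    have e3 : ∀ a b c e K Z : ℝ, a + b = c + e → Z ^ 2 * (K ^ 2 * Real.exp a) * Real.exp b
        = Real.exp c * (Z ^ 2 * K ^ 2 * Real.exp e) := by
      intro a b c e K Z hab
      have : Real.exp a * Real.exp b = Real.exp c * Real.exp e := by
        rw [← Real.exp_add, ← Real.exp_add, hab]
      linear_combination Z ^ 2 * K ^ 2 * this
    refine e3 _ _ _ _ _ _ ?_
    push_cast
    ring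
  rw [e1, reachDens, indicator_of_mem hx]
  have hp : 0 ≤ partition R β F * gaussKer (1 / (2 * σ ^ 2)) (x - m) * Real.exp (β * F x) := by
    have := h.partition_pos
    have := gaussKer_pos h.b_pos (x - m)
    positivity
  exact pow_le_pow_left₀ (by positivity) (mul_le_mul_of_nonneg_right hexp hp) 2

lemma integral_symDens_le_one (h : SmallStep R β η σ r L₁ L₂ F g) (u : E) :
    ∫ v, symDens R β η σ r L₁ L₂ F g (u, v) ∂(gibbs R β F) ≤ 1 := by
  have := h.isProbabilityMeasure
  exact (integral_mono ((h.bddMeas_symDens.comp measurable_prodMk_left).integrable _)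
    ((h.bddMeas_jumpDens.comp measurable_prodMk_left).integrable _)
    fun v => h.symDens_le_jumpDens (u, v)).trans (h.integral_jumpDens_le_one u)

/-- Two points from which the chain is unlikely to change sides are not close to each other. -/
lemma separation (h : SmallStep R β η σ r L₁ L₂ F g) {A : Set E} (hA : MeasurableSet A) {u v : E}
    (hu : u ∈ domain d R) (hv : v ∈ domain d R)
    (hqu : ∫ x, Aᶜ.indicator 1 x * symDens R β η σ r L₁ L₂ F g (u, x) ∂(gibbs R β F) < 64 / 10000)
    (hqv : ∫ x, A.indicator 1 x * symDens R β η σ r L₁ L₂ F g (v, x) ∂(gibbs R β F)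
      < 64 / 10000) : σ / 100 ≤ ‖u - v‖ := by
  by_contra! hlt
  have := h.isProbabilityMeasure
  -- Only the mass of `reachDens` matters here, so the direction and the offset of the slab are
  -- arbitrary.
  obtain ⟨e, he⟩ := exists_norm_eq_one h.one_le_dim
  have hm : (1 / 2 : ℝ) • (u + v) ∈ domain d R := by
    have := (convex_closedBall (0 : E) R) hu hv (show (0 : ℝ) ≤ 1 / 2 by norm_num)
      (show (0 : ℝ) ≤ 1 / 2 by norm_num) (by norm_num)
    rwa [← smul_add] at this
  have h0 := h.le_integral_reachDens hm he 0
  have hsq := h.sq_reachDens_le (e := e) 0 hu hv hlt.le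
  have bW := h.bddMeas_reachDens e 0 ((1 / 2 : ℝ) • (u + v))
  set W := reachDens R β σ r L₁ F g e 0 ((1 / 2 : ℝ) • (u + v))
  have bs := h.bddMeas_symDens
  have bu : BddMeas (fun x => symDens R β η σ r L₁ L₂ F g (u, x)) := bs.comp measurable_prodMk_left
  have bv : BddMeas (fun x => symDens R β η σ r L₁ L₂ F g (v, x)) := bs.comp measurable_prodMk_left
  have hu0 : ∀ x, 0 ≤ symDens R β η σ r L₁ L₂ F g (u, x) := fun x => h.symDens_nonneg _
  have hv0 : ∀ x, 0 ≤ symDens R β η σ r L₁ L₂ F g (v, x) := fun x => h.symDens_nonneg _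
  have ru := h.integral_symDens_le_one u
  have rv := h.integral_symDens_le_one v
  set su := fun x => symDens R β η σ r L₁ L₂ F g (u, x) with hsu
  set sv := fun x => symDens R β η σ r L₁ L₂ F g (v, x) with hsv
  have b1 : BddMeas (A.indicator (1 : E → ℝ)) := BddMeas.indicator_one hA
  have b2 : BddMeas (Aᶜ.indicator (1 : E → ℝ)) := BddMeas.indicator_one hA.compl
  have amgm : ∀ {w p q l : ℝ}, 0 ≤ p → 0 ≤ q → 0 < l → (9 / 10 * w) ^ 2 ≤ p * q →
      9 / 5 * w ≤ l * p + l⁻¹ * q := by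
    intro w p q l hp hq hl hw
    refine le_of_sq_le_sq ?_ (by positivity)
    have : (l * p) * (l⁻¹ * q) = p * q := by field_simp
    nlinarith [sq_nonneg (l * p - l⁻¹ * q)]
  -- AM-GM with unequal weights: on A the large weight 100/8 goes to the jumps from v, which rarely
  -- land in A, and off A to the jumps from u. As 64/10000 = (8/100)², each of the four integrals is
  -- at most 8/100, and 32/100 is less than 9/5 · 22/100.
  have key : ∀ x, 9 / 5 * W x ≤ (8 / 100 * su x + 100 / 8 * (A.indicator 1 x * sv x))
      + (100 / 8 * (Aᶜ.indicator 1 x * su x) + 8 / 100 * sv x) := by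
    intro x
    by_cases hx : x ∈ A
    · have hx' : x ∉ Aᶜ := fun h => h hx
      rw [indicator_of_mem hx, indicator_of_notMem hx']
      have := amgm (hu0 x) (hv0 x) (show (0 : ℝ) < 8 / 100 by norm_num) (hsq x)
      have h2 := hv0 x
      simp only [Pi.one_apply, hsu, hsv]
      norm_num at this ⊢
      linarith
    · have hx' : x ∈ Aᶜ := hx
      rw [indicator_of_notMem hx, indicator_of_mem hx']
      have := amgm (hu0 x) (hv0 x) (show (0 : ℝ) < 100 / 8 by norm_num) (hsq x)
      have h2 := hu0 x
      simp only [Pi.one_apply, hsu, hsv]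
      norm_num at this ⊢
      linarith
  have i1 := bu.const_mul (8 / 100)
  have i2 := (b1.mul bv).const_mul (100 / 8)
  have i3 := (b2.mul bu).const_mul (100 / 8)
  have i4 := bv.const_mul (8 / 100)
  have fin := integral_mono (μ := gibbs R β F) ((bW.const_mul (9 / 5)).integrable _)
    (((i1.add i2).add (i3.add i4)).integrable _) key
  rw [(i1.add i2).integral_add (i3.add i4), i1.integral_add i2, i3.integral_add i4,
    integral_const_mul, integral_const_mul, integral_const_mul, integral_const_mul,
    integral_const_mul] at fin
  linarith

/-- The Gibbs measure is spread out at the scale of the noise, which limits its Cheeger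
constant. -/
lemma cheeger_mul_noise_le (h : SmallStep R β η σ r L₁ L₂ F g) {ρ : ℝ} (hρ : 0 < ρ)
    (hch : HasCheegerConstant R ρ (gibbs R β F)) : ρ * (σ / 100) ≤ 20 := by
  have := h.isProbabilityMeasure
  have hσ := h.σ_pos
  set π := gibbs R β F with hπ
  obtain ⟨e, he⟩ := exists_norm_eq_one h.one_le_dim
  have hem : Measurable fun x : E => inner ℝ e x := by fun_prop
  have blin : BddMeas ((domain d R).indicator fun x : E => inner ℝ e x) := by
    refine BddMeas.of_indicator (C := R) (measurableSet_domain R) hem fun x hx => ?_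
    have h1 := abs_real_inner_le_norm e x
    have h2 : ‖x‖ ≤ R := by simpa [domain] using hx
    rw [he, one_mul] at h1
    exact h1.trans h2
  -- The slab of width σ/100 starts at the 1/20-quantile of a linear coordinate. The part of the
  -- ball below it has mass at least 1/20; the point is to show the same for the part above.
  obtain ⟨m₀, hm1, hm2⟩ := exists_quantile π blin (q := 1 / 20) (by norm_num) (by norm_num)
  set S : Set E := {x | inner ℝ e x ∈ Ico m₀ (m₀ + σ / 100)} with hS
  have hSm : MeasurableSet S := measurableSet_slab e _ _
  set A₁ : Set E := domain d R ∩ {x | inner ℝ e x ≤ m₀} with hA₁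
  set A₂ : Set E := {x | m₀ + σ / 100 ≤ inner ℝ e x} with hA₂
  have hA₂m : MeasurableSet A₂ := measurableSet_le measurable_const hem
  have hsymm : ∀ u v, symDens R β η σ r L₁ L₂ F g (u, v) = symDens R β η σ r L₁ L₂ F g (v, u) :=
    symDens_symm
  have f1 : 19 / 100 * π.real S ≤ flow π (symDens R β η σ r L₁ L₂ F g) S := by
    refine mul_measureReal_le_flow h.bddMeas_symDens h.symDens_nonneg hSm hSm subset_rfl ?_
    filter_upwards [ae_mem_domain (R := R) (β := β) (F := F)] with u hu _
    exact h.slab_escape hu he m₀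
  -- By reversibility the flow out of S equals the flow into S, hence is at most the mass of the
  -- complement. With `f1`, this gives the complement mass at least 19/119, which exceeds 1/10.
  have f2 : flow π (symDens R β η σ r L₁ L₂ F g) S ≤ π.real Sᶜ := by
    rw [← flow_compl hsymm, flow_eq_integral h.bddMeas_symDens hSm.compl,
      ← integral_indicator_one hSm.compl]
    have b1 : BddMeas (S.indicator (1 : E → ℝ)) := BddMeas.indicator_one hSm
    have b2 : BddMeas (Sᶜ.indicator (1 : E → ℝ)) := BddMeas.indicator_one hSm.compl
    rw [compl_compl]
    refine integral_mono
      ((b2.mul ((b1.snd.mul h.bddMeas_symDens).integral_right π)).integrable π)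
      (b2.integrable π) fun u => ?_
    refine mul_le_of_le_one_right (indicator_nonneg (fun _ _ => zero_le_one) _) ?_
    refine le_trans ?_ (h.integral_symDens_le_one u)
    refine integral_mono ((b1.mul (h.bddMeas_symDens.comp measurable_prodMk_left)).integrable π)
      ((h.bddMeas_symDens.comp measurable_prodMk_left).integrable π) fun v => ?_
    refine mul_le_of_le_one_left (h.symDens_nonneg _) ?_
    exact indicator_le_self' (fun _ _ => zero_le_one) v
  have f3 : π.real Sᶜ = 1 - π.real S := probReal_compl_eq_one_sub hSm
  have f4 : π.real Sᶜ ≤ 1 / 20 + π.real A₂ := by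
    have hsub : Sᶜ ⊆ ({x | (domain d R).indicator (fun x : E => inner ℝ e x) x < m₀} ∪ A₂)
        ∪ (domain d R)ᶜ := by
      intro x hx
      by_cases hxD : x ∈ domain d R
      · left
        by_cases hx1 : inner ℝ e x < m₀
        · left
          simpa [indicator_of_mem hxD] using hx1
        · right
          by_contra hx2
          exact hx ⟨not_lt.1 hx1, not_le.1 hx2⟩
      · exact Or.inr hxD
    have h0 : π.real (domain d R)ᶜ = 0 := by
      rw [measureReal_def, hπ, gibbs_compl_domain, ENNReal.toReal_zero]
    have := (measureReal_mono (μ := π) hsub).trans ((measureReal_union_le _ _).trans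
      (add_le_add (measureReal_union_le _ _) le_rfl))
    linarith
  have f5 : 1 / 20 ≤ π.real A₁ := by
    refine hm2.trans ?_
    have hsub : {x | (domain d R).indicator (fun x : E => inner ℝ e x) x ≤ m₀}
        ⊆ A₁ ∪ (domain d R)ᶜ := by
      intro x hx
      by_cases hxD : x ∈ domain d R
      · simp only [mem_ofPred_eq, indicator_of_mem hxD] at hx
        exact Or.inl ⟨hxD, hx⟩
      · exact Or.inr hxD
    have h0 : π.real (domain d R)ᶜ = 0 := by
      rw [measureReal_def, hπ, gibbs_compl_domain, ENNReal.toReal_zero]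
    have := (measureReal_mono (μ := π) hsub).trans (measureReal_union_le _ _)
    linarith
  have f6 := isoperimetry_of_separated hch hρ hA₂m (A₁ := A₁) inter_subset_left
    (h := σ / 100) (by positivity) (by
      intro u hu v hv
      have h1 : inner ℝ e u ≤ m₀ := hu.2
      have h2 : m₀ + σ / 100 ≤ inner ℝ e v := hv
      have h3 := abs_real_inner_le_norm e (v - u)
      rw [he, one_mul, inner_sub_right, norm_sub_rev] at h3
      linarith [le_abs_self (inner ℝ e v - inner ℝ e u)])
  have f7 : 1 / 20 ≤ min (π.real A₁) (π.real A₂) := le_min f5 (by linarith)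
  have f8 := mul_le_mul_of_nonneg_left f7 (show 0 ≤ ρ * (σ / 100) by positivity)
  have f9 : 0 ≤ π.real A₁ := measureReal_nonneg
  have f10 : 0 ≤ π.real A₂ := measureReal_nonneg
  linarith

/-- Conductance of the reversible approximation. -/
lemma conductance (h : SmallStep R β η σ r L₁ L₂ F g) {ρ : ℝ} (hρ : 0 < ρ)
    (hch : HasCheegerConstant R ρ (gibbs R β F)) {A : Set E} (hA : MeasurableSet A) :
    ρ * σ / 10 ^ 6 * min ((gibbs R β F).real A) ((gibbs R β F).real Aᶜ)
      ≤ flow (gibbs R β F) (symDens R β η σ r L₁ L₂ F g) A := by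
  have := h.isProbabilityMeasure
  have hσ := h.σ_pos
  have hρσ := h.cheeger_mul_noise_le hρ hch
  set π := gibbs R β F with hπ
  set s := symDens R β η σ r L₁ L₂ F g with hs
  have bs : BddMeas s := h.bddMeas_symDens
  have hsymm : ∀ u v, s (u, v) = s (v, u) := symDens_symm
  have b1 : BddMeas (A.indicator (1 : E → ℝ)) := BddMeas.indicator_one hA
  have b2 : BddMeas (Aᶜ.indicator (1 : E → ℝ)) := BddMeas.indicator_one hA.compl
  have bq : BddMeas fun u => ∫ x, Aᶜ.indicator 1 x * s (u, x) ∂π :=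
    (b2.snd.mul bs).integral_right π
  have bq' : BddMeas fun u => ∫ x, A.indicator 1 x * s (u, x) ∂π :=
    (b1.snd.mul bs).integral_right π
  -- `A₁` and `A₂` are the points of A and of its complement that cross over with small probability.
  -- All other points feed the flow directly.
  set A₁ : Set E := (A ∩ domain d R) ∩ {u | ∫ x, Aᶜ.indicator 1 x * s (u, x) ∂π < 64 / 10000}
    with hA₁
  set A₂ : Set E := (Aᶜ ∩ domain d R) ∩ {u | ∫ x, A.indicator 1 x * s (u, x) ∂π < 64 / 10000}
    with hA₂
  have hA₁m : MeasurableSet A₁ :=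
    (hA.inter (measurableSet_domain R)).inter (measurableSet_lt bq.1 measurable_const)
  have hA₂m : MeasurableSet A₂ :=
    (hA.compl.inter (measurableSet_domain R)).inter (measurableSet_lt bq'.1 measurable_const)
  have s1 : A₁ ⊆ A := inter_subset_left.trans inter_subset_left
  have s2 : A₂ ⊆ Aᶜ := inter_subset_left.trans inter_subset_left
  have f1 : 64 / 10000 * π.real (A \ A₁) ≤ flow π s A := by
    refine mul_measureReal_le_flow bs h.symDens_nonneg hA (hA.diff hA₁m) sdiff_subset ?_
    filter_upwards [ae_mem_domain (R := R) (β := β) (F := F)] with u hu hu2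
    by_contra hcon
    exact hu2.2 ⟨⟨hu2.1, hu⟩, not_le.1 hcon⟩
  have f2 : 64 / 10000 * π.real (Aᶜ \ A₂) ≤ flow π s A := by
    rw [← flow_compl hsymm]
    refine mul_measureReal_le_flow bs h.symDens_nonneg hA.compl (hA.compl.diff hA₂m)
      sdiff_subset ?_
    filter_upwards [ae_mem_domain (R := R) (β := β) (F := F)] with u hu hu2
    rw [compl_compl]
    by_contra hcon
    exact hu2.2 ⟨⟨hu2.1, hu⟩, not_le.1 hcon⟩
  rw [measureReal_sdiff s1 hA₁m] at f1
  rw [measureReal_sdiff s2 hA₂m] at f2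
  have f3 := isoperimetry_of_separated hch hρ hA₂m (A₁ := A₁)
    (inter_subset_left.trans inter_subset_right) (h := σ / 100) (by positivity)
    fun u hu v hv => h.separation hA hu.1.2 hv.1.2 hu.2 hv.2
  have f4 : π.real Aᶜ = 1 - π.real A := probReal_compl_eq_one_sub hA
  set fl := flow π s A
  set p := π.real A
  set p' := π.real Aᶜ
  have hp : 0 ≤ p := measureReal_nonneg
  have hp' : 0 ≤ p' := measureReal_nonneg
  have hmin0 : 0 ≤ min p p' := le_min hp hp'
  have hX0 : 0 ≤ ρ * (σ / 100) := by positivity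
  have hgoal : ρ * σ / 10 ^ 6 = ρ * (σ / 100) / 10 ^ 4 := by ring
  rw [hgoal]
  set X := ρ * (σ / 100)
  -- If half of one side crosses easily, the flow has a constant conductance; this dominates X/10⁴
  -- because X ≤ 20 by `cheeger_mul_noise_le`.
  have hsmall : fl ≥ 64 / 20000 * min p p' → X / 10 ^ 4 * min p p' ≤ fl := by
    intro hh
    refine le_trans (mul_le_mul_of_nonneg_right ?_ hmin0) hh
    linarith
  rcases le_total (π.real A₁) (p / 2) with c1 | c1
  · refine hsmall ?_
    linarith [min_le_left p p']
  rcases le_total (π.real A₂) (p' / 2) with c2 | c2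
  · refine hsmall ?_
    linarith [min_le_right p p']
  -- Otherwise both sets keep half of their sides, and isoperimetry leaves mass at least (X/2)
  -- min(p, p') outside them, where crossing has probability at least 64/10000.
  have f5 : min p p' / 2 ≤ min (π.real A₁) (π.real A₂) :=
    le_min (by linarith [min_le_left p p']) (by linarith [min_le_right p p'])
  have f6 := mul_le_mul_of_nonneg_left f5 hX0
  have f7 := mul_nonneg hX0 hmin0
  linarith

end SmallStep

end Conductance

end CSSGLD

/-! ### Evolution of the law and total variation decay. -/

namespace CSSGLD

section Density

variable {X : Type*} [MeasurableSpace X] (π : Measure X) [IsProbabilityMeasure π] {f : X → ℝ}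

omit [IsProbabilityMeasure π] in
lemma withDensity_real_eq (hf : BddMeas f) (hf0 : ∀ x, 0 ≤ f x) {A : Set X}
    (hA : MeasurableSet A) :
    (π.withDensity fun x => ENNReal.ofReal (f x)).real A = ∫ x, A.indicator 1 x * f x ∂π := by
  have e : ∀ x, A.indicator 1 x * f x = A.indicator f x := by
    intro x
    by_cases hx : x ∈ A <;> simp [hx]
  simp only [e]
  rw [integral_indicator hA, measureReal_def, withDensity_apply _ hA,
    integral_eq_lintegral_of_nonneg_ae (ae_of_all _ hf0) hf.1.aestronglyMeasurable]

/-- Cauchy–Schwarz for the indicator of A against f - 1. -/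
lemma tvDist_le_sqrt_variance (hf : BddMeas f) (hf0 : ∀ x, 0 ≤ f x) :
    tvDist (π.withDensity fun x => ENNReal.ofReal (f x)) π
      ≤ √(∫ x, (f x - 1) ^ 2 ∂π) := by
  unfold tvDist
  have : Nonempty {A : Set X // MeasurableSet A} := ⟨⟨∅, MeasurableSet.empty⟩⟩
  refine ciSup_le fun ⟨A, hA⟩ => ?_
  have b1 : BddMeas (A.indicator (1 : X → ℝ)) := BddMeas.indicator_one hA
  have e : (π.withDensity fun x => ENNReal.ofReal (f x)).real A - π.real A
      = ∫ x, 1 * A.indicator 1 x * (f x - 1) ∂π := by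
    rw [withDensity_real_eq π hf hf0 hA, ← integral_indicator_one hA, ← (b1.mul hf).integral_sub b1]
    refine integral_congr_ae (ae_of_all _ fun x => ?_)
    simp only
    ring
  rw [e, ← Real.sqrt_sq_eq_abs]
  refine Real.sqrt_le_sqrt ?_
  refine (sq_integral_mul_le π (BddMeas.const 1) b1 (hf.sub (BddMeas.const 1))
    fun _ => zero_le_one).trans ?_
  simp only [one_mul]
  refine mul_le_of_le_one_left (integral_nonneg fun _ => sq_nonneg _) ?_
  have : ∫ x, A.indicator (1 : X → ℝ) x ^ 2 ∂π ≤ ∫ x, (1 : ℝ) ∂π := by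
    refine integral_mono ((b1.pow 2).integrable π) (integrable_const _) fun x => ?_
    by_cases hx : x ∈ A <;> simp [hx]
  simpa using this

/-- A measure dominated by `C • π` has a density bounded by `C`. -/
lemma exists_density {μ : Measure X} [IsFiniteMeasure μ] {C : ℝ} (hC : 0 ≤ C)
    (h : ∀ A, MeasurableSet A → μ A ≤ ENNReal.ofReal C * π A) :
    ∃ f : X → ℝ, Measurable f ∧ (∀ x, 0 ≤ f x) ∧ (∀ x, f x ≤ C) ∧
      μ = π.withDensity fun x => ENNReal.ofReal (f x) := by
  have hac : μ ≪ π := by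
    refine Measure.AbsolutelyContinuous.mk fun A hA h0 => ?_
    have := h A hA
    rw [h0, mul_zero] at this
    exact nonpos_iff_eq_zero.1 this
  have hle : μ.rnDeriv π ≤ᵐ[π] fun _ => ENNReal.ofReal C := by
    refine ae_le_of_forall_setLIntegral_le_of_sigmaFinite (Measure.measurable_rnDeriv μ π)
      fun A hA _ => ?_
    rw [setLIntegral_const, Measure.setLIntegral_rnDeriv hac]
    exact h A hA
  -- Cutting the density at C changes it only on a null set and makes the bound hold everywhere.
  refine ⟨fun x => min (μ.rnDeriv π x).toReal C, by fun_prop,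
    fun x => le_min ENNReal.toReal_nonneg hC, fun x => min_le_right _ _, ?_⟩
  conv_lhs => rw [← Measure.withDensity_rnDeriv_eq μ π hac]
  refine withDensity_congr_ae ?_
  filter_upwards [hle] with x hx
  have hne : μ.rnDeriv π x ≠ ∞ := (hx.trans_lt ENNReal.ofReal_lt_top).ne
  rw [min_eq_left (ENNReal.toReal_le_of_le_ofReal hC hx), ENNReal.ofReal_toReal hne]

lemma integral_sub_one_sq (hf : BddMeas f) (h1 : ∫ x, f x ∂π = 1) :
    ∫ x, (f x - 1) ^ 2 ∂π = ∫ x, f x ^ 2 ∂π - 1 := by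
  have e : ∀ x, (f x - 1) ^ 2 = f x ^ 2 - (2 * f x - 1) := fun x => by ring
  simp only [e]
  rw [(hf.pow 2).integral_sub ((hf.const_mul 2).sub (BddMeas.const 1)),
    (hf.const_mul 2).integral_sub (BddMeas.const 1), integral_const_mul, h1]
  simp
  norm_num

end Density

section Law

variable {d : ℕ}

local notation "E" => EuclideanSpace ℝ (Fin d)

namespace SmallStep

variable {R β η σ r L₁ L₂ : ℝ} {F : EuclideanSpace ℝ (Fin d) → ℝ}
  {g : EuclideanSpace ℝ (Fin d) → EuclideanSpace ℝ (Fin d)}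

lemma transfer_nonneg (h : SmallStep R β η σ r L₁ L₂ F g) {f : E → ℝ} (hf0 : ∀ x, 0 ≤ f x) (v : E) :
    0 ≤ transfer (gibbs R β F) (jumpDens R β η σ r F g) f v := by
  refine add_nonneg (integral_nonneg fun u => mul_nonneg
    ((h.symDens_nonneg _).trans (h.symDens_le_jumpDens _)) (hf0 u)) (mul_nonneg ?_ (hf0 v))
  linarith [h.integral_jumpDens_le_one v]

open Classical in
/-- Transition probabilities of CS-SGLD. -/
lemma step_prob (h : SmallStep R β η σ r L₁ L₂ F g) {F₀ : E → ℝ}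
    (hg : ∀ u ∈ domain d R, gradientWithin F₀ (domain d R) u = g u) (hσ : √(2 * η / β) = σ)
    {u : E} (hu : u ∈ domain d R) {A : Set E} (hA : MeasurableSet A) :
    (stdGaussian E).real {ξ | step R β η r F₀ u ξ ∈ A}
      = A.indicator 1 u + ∫ v, jumpDens R β η σ r F g (u, v) *
          (A.indicator 1 v - A.indicator 1 u) ∂(gibbs R β F) := by
  have := h.isProbabilityMeasure
  set B := Metric.closedBall u r ∩ domain d R with hB
  have hBm : MeasurableSet B :=
    Metric.isClosed_closedBall.measurableSet.inter (measurableSet_domain R)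
  have hm : Measurable fun ξ : E => u - η • g u + σ • ξ := by fun_prop
  have b1 : BddMeas (A.indicator (1 : E → ℝ)) := BddMeas.indicator_one hA
  have bt : BddMeas fun v => jumpDens R β η σ r F g (u, v) :=
    h.bddMeas_jumpDens.comp measurable_prodMk_left
  have q1 := h.integral_jumpDens hu hA
  have q2 := h.integral_jumpDens hu MeasurableSet.univ
  simp only [indicator_univ, Pi.one_apply, one_mul, univ_inter] at q2
  have e0 : ∫ v, jumpDens R β η σ r F g (u, v) * (A.indicator 1 v - A.indicator 1 u) ∂(gibbs R β F)
      = (stdGaussian E).real {ξ | u - η • g u + σ • ξ ∈ A ∩ B}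
        - (stdGaussian E).real {ξ | u - η • g u + σ • ξ ∈ B} * A.indicator 1 u := by
    rw [← q1, ← q2, ← integral_mul_const, ← (b1.mul bt).integral_sub (bt.mul (BddMeas.const _))]
    refine integral_congr_ae (ae_of_all _ fun v => ?_)
    simp only
    ring
  have hstep : ∀ ξ, step R β η r F₀ u ξ
      = if u - η • g u + σ • ξ ∈ B then u - η • g u + σ • ξ else u := by
    intro ξ
    simp only [step, hg u hu, hσ, hB]
  rw [e0]
  have hm1 : MeasurableSet {ξ : E | u - η • g u + σ • ξ ∈ B} := hm hBm
  by_cases huA : u ∈ A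
  · rw [indicator_of_mem huA]
    have e1 : {ξ | step R β η r F₀ u ξ ∈ A}
        = {ξ | u - η • g u + σ • ξ ∈ A ∩ B} ∪ {ξ | u - η • g u + σ • ξ ∈ B}ᶜ := by
      ext ξ
      simp only [mem_ofPred_eq, hstep, mem_union, mem_compl_iff, mem_inter_iff]
      by_cases hx : u - η • g u + σ • ξ ∈ B <;> simp [hx, huA]
    have hdis : Disjoint {ξ : E | u - η • g u + σ • ξ ∈ A ∩ B}
        {ξ | u - η • g u + σ • ξ ∈ B}ᶜ := Set.disjoint_left.2 fun ξ h1 h2 => h2 h1.2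
    rw [e1, measureReal_union hdis hm1.compl,
      probReal_compl_eq_one_sub hm1]
    simp
    ring
  · rw [indicator_of_notMem huA]
    have e1 : {ξ | step R β η r F₀ u ξ ∈ A} = {ξ | u - η • g u + σ • ξ ∈ A ∩ B} := by
      ext ξ
      simp only [mem_ofPred_eq, hstep, mem_inter_iff]
      by_cases hx : u - η • g u + σ • ξ ∈ B <;> simp [hx, huA]
    rw [e1]
    simp

open Classical in
-- The mass of A after a step is the integral of f times the transition probability, which is the
-- weak form of `transfer` tested on the indicator of A.
lemma map_step_eq (h : SmallStep R β η σ r L₁ L₂ F g) {F₀ : E → ℝ}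
    (hg : ∀ u ∈ domain d R, gradientWithin F₀ (domain d R) u = g u) (hσ : √(2 * η / β) = σ)
    {f : E → ℝ} (hf : BddMeas f) (hf0 : ∀ x, 0 ≤ f x) :
    (((gibbs R β F).withDensity fun x => ENNReal.ofReal (f x)).prod (stdGaussian E)).map
        (fun p => step R β η r F₀ p.1 p.2)
      = (gibbs R β F).withDensity fun x =>
          ENNReal.ofReal (transfer (gibbs R β F) (jumpDens R β η σ r F g) f x) := by
  have := h.isProbabilityMeasure
  set π := gibbs R β F with hπ
  set t := jumpDens R β η σ r F g with ht
  have bt : BddMeas t := h.bddMeas_jumpDens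
  have hgm := h.measurable_g
  have hfm := hf.1
  have hfin : IsFiniteMeasure (π.withDensity fun x => ENNReal.ofReal (f x)) :=
    isFiniteMeasure_withDensity_ofReal (hf.integrable π).2
  -- A version of the step built from the globally measurable `g`; it agrees with `step` for
  -- starting points in the ball, hence almost surely.
  set step' : E × E → E := fun p =>
    if p.1 - η • g p.1 + σ • p.2 ∈ Metric.closedBall p.1 r ∩ domain d R
      then p.1 - η • g p.1 + σ • p.2 else p.1 with hstep'
  have hs'm : Measurable step' := by
    refine Measurable.ite ?_ (by fun_prop) measurable_fst
    have e : {p : E × E | p.1 - η • g p.1 + σ • p.2 ∈ Metric.closedBall p.1 r ∩ domain d R}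
        = {p : E × E | dist (p.1 - η • g p.1 + σ • p.2) p.1 ≤ r} ∩
          (fun p : E × E => p.1 - η • g p.1 + σ • p.2) ⁻¹' domain d R := rfl
    rw [e]
    have m1 : Measurable fun p : E × E => p.1 - η • g p.1 + σ • p.2 := by fun_prop
    exact (measurableSet_le (m1.dist measurable_fst) measurable_const).inter
      (m1 (measurableSet_domain R))
  have hstep : ∀ u ∈ domain d R, ∀ ξ, step R β η r F₀ u ξ = step' (u, ξ) := by
    intro u hu ξ
    simp only [step, hg u hu, hσ, hstep']
  have hae : ∀ᵐ u ∂(π.withDensity fun x => ENNReal.ofReal (f x)), u ∈ domain d R :=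
    (withDensity_absolutelyContinuous _ _) gibbs_compl_domain
  have hcongr : (fun p : E × E => step R β η r F₀ p.1 p.2)
      =ᵐ[(π.withDensity fun x => ENNReal.ofReal (f x)).prod (stdGaussian E)] step' := by
    have := Measure.quasiMeasurePreserving_fst (μ := π.withDensity fun x => ENNReal.ofReal (f x))
      (ν := stdGaussian E) |>.ae hae
    filter_upwards [this] with p hp
    exact hstep p.1 hp p.2
  rw [Measure.map_congr hcongr]
  have bT : BddMeas (transfer π t f) := hf.transfer π bt
  ext A hA
  have b1 : BddMeas (A.indicator (1 : E → ℝ)) := BddMeas.indicator_one hA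
  set p : E → ℝ := fun u => A.indicator 1 u + ∫ v, t (u, v) *
    (A.indicator 1 v - A.indicator 1 u) ∂π with hp
  have b2 : BddMeas fun z : E × E => t z * (A.indicator 1 z.2 - A.indicator 1 z.1) :=
    bt.mul (b1.snd.sub b1.fst)
  have bp : BddMeas p := b1.add (b2.integral_right π)
  rw [Measure.map_apply hs'm hA, Measure.prod_apply (hs'm hA),
    lintegral_withDensity_eq_lintegral_mul _ hfm.ennreal_ofReal
      (measurable_measure_prodMk_left (hs'm hA))]
  have e1 : ∫⁻ u, ((fun x => ENNReal.ofReal (f x)) *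
      fun x => (stdGaussian E) (Prod.mk x ⁻¹' (step' ⁻¹' A))) u ∂π
      = ∫⁻ u, ENNReal.ofReal (f u * p u) ∂π := by
    refine lintegral_congr_ae ?_
    filter_upwards [ae_mem_domain (R := R) (β := β) (F := F)] with u hu
    have := h.step_prob hg hσ hu hA
    simp only [hstep u hu] at this
    simp only [Pi.mul_apply]
    rw [ENNReal.ofReal_mul (hf0 u), ← ofReal_measureReal]
    congr 2
  have hpint : 0 ≤ᵐ[π] fun u => f u * p u := by
    filter_upwards [ae_mem_domain (R := R) (β := β) (F := F)] with u hu
    have := h.step_prob hg hσ hu hA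
    refine mul_nonneg (hf0 u) ?_
    simp only [hp]
    rw [← this]
    exact measureReal_nonneg
  rw [e1, ← ofReal_integral_eq_lintegral_ofReal ((hf.mul bp).integrable π) hpint]
  have hTfin : IsFiniteMeasure (π.withDensity fun x => ENNReal.ofReal (transfer π t f x)) :=
    isFiniteMeasure_withDensity_ofReal (bT.integrable π).2
  rw [← ofReal_measureReal, withDensity_real_eq π bT (h.transfer_nonneg hf0) hA,
    integral_mul_transfer π bt hf b1, integral_prod _ (((bt.mul hf.fst).mul
      (b1.snd.sub b1.fst)).integrable _), ← integral_add ((b1.mul hf).integrable π)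
      ((((bt.mul hf.fst).mul (b1.snd.sub b1.fst)).integral_right π).integrable π)]
  congr 1
  refine integral_congr_ae (ae_of_all _ fun u => ?_)
  simp only [hp]
  rw [mul_add, ← integral_const_mul, mul_comm (f u)]
  congr 2
  ext v
  ring

/-- The law of the iterates has a density with respect to the Gibbs measure, obtained by iterating
`transfer`. -/
lemma law_eq_withDensity (h : SmallStep R β η σ r L₁ L₂ F g) {F₀ : E → ℝ}
    (hg : ∀ u ∈ domain d R, gradientWithin F₀ (domain d R) u = g u) (hσ : √(2 * η / β) = σ)
    {f : E → ℝ} (hf : BddMeas f) (hf0 : ∀ x, 0 ≤ f x) (k : ℕ) :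
    (BddMeas ((transfer (gibbs R β F) (jumpDens R β η σ r F g))^[k] f) ∧
      ∀ x, 0 ≤ (transfer (gibbs R β F) (jumpDens R β η σ r F g))^[k] f x) ∧
    law R β η r F₀ ((gibbs R β F).withDensity fun x => ENNReal.ofReal (f x)) k
      = (gibbs R β F).withDensity fun x =>
          ENNReal.ofReal ((transfer (gibbs R β F) (jumpDens R β η σ r F g))^[k] f x) := by
  have := h.isProbabilityMeasure
  induction k with
  | zero => exact ⟨⟨hf, hf0⟩, rfl⟩
  | succ k ih =>
    obtain ⟨⟨ih1, ih2⟩, ih3⟩ := ih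
    rw [Function.iterate_succ_apply']
    refine ⟨⟨ih1.transfer _ h.bddMeas_jumpDens, h.transfer_nonneg ih2⟩, ?_⟩
    rw [law, ih3]
    exact h.map_step_eq hg hσ ih1 ih2

/-- Variance decay along one step. -/
lemma variance_step (h : SmallStep R β η σ r L₁ L₂ F g) {ρ : ℝ} (hρ : 0 < ρ)
    (hch : HasCheegerConstant R ρ (gibbs R β F)) {f : E → ℝ} (hf : BddMeas f)
    (h1 : ∫ x, f x ∂(gibbs R β F) = 1) {x : ℝ} (hx : x = ρ ^ 2 * η / (2 * 10 ^ 13 * β))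
    (hΔ : 432 * curvErr η L₁ L₂ d ^ 2 ≤ x) :
    ∫ v, (transfer (gibbs R β F) (jumpDens R β η σ r F g) f v - 1) ^ 2 ∂(gibbs R β F)
      ≤ (1 - x) * ∫ v, (f v - 1) ^ 2 ∂(gibbs R β F) + 432 * curvErr η L₁ L₂ d ^ 2 := by
  have := h.isProbabilityMeasure
  have hβ := h.β_pos
  set π := gibbs R β F with hπ
  have hσ := h.σ_pos
  have hD0 := h.curvErr_nonneg
  have a1 := variance_transfer_le π h.bddMeas_symDens h.bddMeas_jumpDens symDens_symm
    h.symDens_nonneg h.symDens_le_jumpDens h.jumpDens_le h.integral_jumpDens_le_one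
    (fun f hf => h.symDens_quadForm_ge hf) hf (δ := 4 * curvErr η L₁ L₂ d) (by positivity)
  have bh : BddMeas fun v => f v - 1 := hf.sub (BddMeas.const 1)
  have hmean : ∫ v, (f v - 1) ∂π = 0 := by
    rw [hf.integral_sub (BddMeas.const 1), h1]; simp
  have a2 := cheeger_poincare π h.bddMeas_symDens symDens_symm h.symDens_nonneg
    h.integral_symDens_le_one (Φ := ρ * σ / 10 ^ 6) (by positivity)
    (fun A hA => h.conductance hρ hch hA) bh hmean
  have a3 := integral_sub_one_sq π hf h1
  -- The contraction is (2/5) · 5x = 2x. The perturbation is 27 · 16Δ² = 432Δ² times ∫ f² = V + 1;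
  -- its V part uses up one x, and the rest is the additive error.
  have e : (ρ * σ / 10 ^ 6) ^ 2 / 8 = 5 * x := by
    rw [hx, div_pow, mul_pow, h.σ_sq]
    field_simp
    ring
  rw [e] at a2
  have hV0 : 0 ≤ ∫ v, (f v - 1) ^ 2 ∂π := integral_nonneg fun v => sq_nonneg _
  have a4 := mul_le_mul_of_nonneg_right hΔ hV0
  have a5 : ∫ v, f v ^ 2 ∂π = ∫ v, (f v - 1) ^ 2 ∂π + 1 := by linarith
  rw [a5] at a1
  nlinarith

end SmallStep

lemma le_geometric_add {V : ℕ → ℝ} {x B : ℝ} (hx0 : 0 < x) (hx1 : x ≤ 1) (hB : 0 ≤ B)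
    (hV : ∀ k, V (k + 1) ≤ (1 - x) * V k + B) (k : ℕ) : V k ≤ (1 - x) ^ k * V 0 + B / x := by
  induction k with
  | zero => simpa using div_nonneg hB hx0.le
  | succ k ih =>
    refine (hV k).trans ?_
    have h1 := mul_le_mul_of_nonneg_left ih (sub_nonneg.2 hx1)
    have h2 : (1 - x) * (B / x) + B = B / x := by field_simp; ring
    rw [pow_succ]
    linarith

namespace SmallStep

variable {R β η σ r L₁ L₂ : ℝ} {F : EuclideanSpace ℝ (Fin d) → ℝ}
  {g : EuclideanSpace ℝ (Fin d) → EuclideanSpace ℝ (Fin d)}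

/-- The rate of convergence is at most one. -/
lemma rate_le_one (h : SmallStep R β η σ r L₁ L₂ F g) {ρ : ℝ} (hρ : 0 < ρ)
    (hch : HasCheegerConstant R ρ (gibbs R β F)) {x : ℝ}
    (hx : x = ρ ^ 2 * η / (2 * 10 ^ 13 * β)) : x ≤ 1 := by
  have h1 := h.cheeger_mul_noise_le hρ hch
  have hσ := h.σ_pos
  have hβ := h.β_pos
  have h2 : (ρ * σ) ^ 2 ≤ 2000 ^ 2 := pow_le_pow_left₀ (by positivity) (by linarith) 2
  have e : x = (ρ * σ) ^ 2 / (4 * 10 ^ 13) := by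
    rw [hx, mul_pow, h.σ_sq]; field_simp; norm_num
  rw [e, div_le_one (by positivity)]
  norm_num at h2 ⊢
  linarith

/-- Convergence in total variation from a warm start. -/
lemma tvDist_law_le (h : SmallStep R β η σ r L₁ L₂ F g) {F₀ : E → ℝ}
    (hg : ∀ u ∈ domain d R, gradientWithin F₀ (domain d R) u = g u) (hσ : √(2 * η / β) = σ)
    {ρ : ℝ} (hρ : 0 < ρ) (hch : HasCheegerConstant R ρ (gibbs R β F)) {x : ℝ}
    (hx : x = ρ ^ 2 * η / (2 * 10 ^ 13 * β)) (hΔ : 432 * curvErr η L₁ L₂ d ^ 2 ≤ x)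
    {μ₀ : Measure E} [IsProbabilityMeasure μ₀] {lam : ℝ}
    (hw : IsWarmStart R lam μ₀ (gibbs R β F)) (k : ℕ) :
    1 ≤ lam ∧ tvDist (law R β η r F₀ μ₀ k) (gibbs R β F)
      ≤ lam * (1 - x / 2) ^ k + √(432 * curvErr η L₁ L₂ d ^ 2 / x) := by
  have := h.isProbabilityMeasure
  have hβ := h.β_pos; have hη := h.η_pos
  have hx0 : 0 < x := by rw [hx]; positivity
  have hx1 := h.rate_le_one hρ hch hx
  set π := gibbs R β F with hπ
  obtain ⟨hw1, hw2⟩ := hw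
  have hdom : ∀ A, MeasurableSet A → μ₀ A ≤ ENNReal.ofReal lam * π A := by
    intro A hA
    calc μ₀ A ≤ μ₀ (A ∩ domain d R) + μ₀ (domain d R)ᶜ := by
          refine (measure_mono fun y hy => ?_).trans (measure_union_le _ _)
          by_cases hyD : y ∈ domain d R
          · exact Or.inl ⟨hy, hyD⟩
          · exact Or.inr hyD
      _ = μ₀ (A ∩ domain d R) := by rw [hw1, add_zero]
      _ ≤ ENNReal.ofReal lam * π (A ∩ domain d R) :=
          hw2 _ inter_subset_right (hA.inter (measurableSet_domain R))
      _ ≤ _ := mul_le_mul_right (measure_mono inter_subset_left) _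
  have hlam : 1 ≤ lam := by
    have := hdom univ MeasurableSet.univ
    rwa [measure_univ, measure_univ, mul_one, ENNReal.one_le_ofReal] at this
  refine ⟨hlam, ?_⟩
  obtain ⟨f, hfm, hf0, hfC, rfl⟩ := exists_density π (zero_le_one.trans hlam) hdom
  have bf : BddMeas f := ⟨hfm, lam, fun y => by rw [abs_of_nonneg (hf0 y)]; exact hfC y⟩
  have hf1 : ∫ y, f y ∂π = 1 := by
    have e := withDensity_real_eq π bf hf0 MeasurableSet.univ
    simpa using e.symm
  set T := transfer π (jumpDens R β η σ r F g) with hT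
  have hall := h.law_eq_withDensity hg hσ bf hf0
  have hmean : ∀ k, ∫ y, T^[k] f y ∂π = 1 := by
    intro k
    induction k with
    | zero => exact hf1
    | succ k ih =>
      rw [Function.iterate_succ_apply', hT, integral_transfer π h.bddMeas_jumpDens (hall k).1.1]
      exact ih
  set V : ℕ → ℝ := fun k => ∫ y, (T^[k] f y - 1) ^ 2 ∂π with hVdef
  have hVstep : ∀ k, V (k + 1) ≤ (1 - x) * V k + 432 * curvErr η L₁ L₂ d ^ 2 := by
    intro k
    simp only [hVdef, Function.iterate_succ_apply']
    exact h.variance_step hρ hch (hall k).1.1 (hmean k) hx hΔ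
  have hV := le_geometric_add hx0 hx1 (by positivity) hVstep k
  -- The pointwise bound 0 ≤ f ≤ λ gives ∫ f² ≤ λ.
  have hV0 : V 0 ≤ lam ^ 2 := by
    have e := integral_sub_one_sq π bf hf1
    have : ∫ y, f y ^ 2 ∂π ≤ ∫ y, lam * f y ∂π := by
      refine integral_mono ((bf.pow 2).integrable π) ((bf.const_mul lam).integrable π) fun y => ?_
      simp only
      nlinarith [hf0 y, hfC y]
    rw [integral_const_mul, hf1] at this
    simp only [hVdef, Function.iterate_zero, id]
    nlinarith
  rw [(hall k).2]
  refine (tvDist_le_sqrt_variance π (hall k).1.1 (hall k).1.2).trans ?_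
  change √(V k) ≤ _
  have hx2 : 0 ≤ 1 - x / 2 := by linarith
  -- Taking the square root of the variance halves the rate: 1 - x ≤ (1 - x/2)².
  have hpow : (1 - x) ^ k * V 0 ≤ (lam * (1 - x / 2) ^ k) ^ 2 := by
    have a1 : (1 - x) ^ k ≤ ((1 - x / 2) ^ 2) ^ k :=
      pow_le_pow_left₀ (by linarith) (by nlinarith) k
    calc (1 - x) ^ k * V 0 ≤ ((1 - x / 2) ^ 2) ^ k * lam ^ 2 :=
          mul_le_mul a1 hV0 (integral_nonneg fun _ => sq_nonneg _) (by positivity)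
      _ = _ := by rw [mul_pow, ← pow_mul, ← pow_mul, mul_comm 2 k]; ring
  have hB : 0 ≤ 432 * curvErr η L₁ L₂ d ^ 2 / x := by positivity
  refine (Real.sqrt_le_sqrt (hV.trans (add_le_add hpow le_rfl))).trans ?_
  have hA : 0 ≤ lam * (1 - x / 2) ^ k := by positivity
  refine Real.sqrt_le_iff.2 ⟨by positivity, ?_⟩
  nlinarith [Real.sq_sqrt hB, mul_nonneg hA (Real.sqrt_nonneg (432 * curvErr η L₁ L₂ d ^ 2 / x))]

end SmallStep

end Law

end CSSGLD

/-! ### Smoothness of the reconstruction loss. -/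

namespace CSSGLD

lemma measurable_indicator_of_continuousOn {X Y : Type*} [TopologicalSpace X] [MeasurableSpace X]
    [OpensMeasurableSpace X] [TopologicalSpace Y] [MeasurableSpace Y] [BorelSpace Y] [Zero Y]
    {f : X → Y} {s : Set X} (hs : MeasurableSet s) (hf : ContinuousOn f s) :
    Measurable (s.indicator f) := by
  classical
  rw [← piecewise_eq_indicator]
  exact hf.measurable_piecewise continuousOn_const hs

section Loss

variable {d n m : ℕ} {R B κ M S : ℝ} {A : Matrix (Fin m) (Fin n) ℝ}
  {G : EuclideanSpace ℝ (Fin d) → EuclideanSpace ℝ (Fin n)} {y : EuclideanSpace ℝ (Fin m)}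

lemma convex_domain : Convex ℝ (domain d R) := convex_closedBall _ _

lemma uniqueDiffOn_domain (hR : 0 < R) : UniqueDiffOn ℝ (domain d R) :=
  uniqueDiffOn_convex convex_domain
    ⟨0, Metric.ball_subset_interior_closedBall (Metric.mem_ball_self hR)⟩

lemma HasLipschitzJacobian.continuousOn (hG : HasLipschitzJacobian R M G) :
    ContinuousOn (jacobian R G) (domain d R) :=
  (LipschitzOnWith.of_dist_le' (K := M) fun u hu v hv => by
    simpa [dist_eq_norm] using hG.2 u hu v hv).continuousOn

/-- In the interior the Lipschitz constant bounds the derivative. The bound passes to the boundary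
sphere because the Jacobian is continuous up to it. -/
lemma HasLipschitzJacobian.norm_jacobian_le (hR : 0 < R) (hκ : 0 ≤ κ)
    (hG : HasLipschitzJacobian R M G)
    (hlip : ∀ z ∈ domain d R, ∀ z' ∈ domain d R, ‖G z - G z'‖ ≤ κ * ‖z - z'‖)
    {u : EuclideanSpace ℝ (Fin d)} (hu : u ∈ domain d R) : ‖jacobian R G u‖ ≤ κ := by
  have hcl : closure (Metric.ball (0 : EuclideanSpace ℝ (Fin d)) R) = domain d R :=
    closure_ball _ hR.ne'
  have hl : LipschitzOnWith ⟨κ, hκ⟩ G (domain d R) := LipschitzOnWith.of_dist_le_mul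
    fun u hu v hv => by rw [dist_eq_norm, dist_eq_norm]; exact hlip u hu v hv
  refine le_on_closure (s := Metric.ball (0 : EuclideanSpace ℝ (Fin d)) R)
    (f := fun u => ‖jacobian R G u‖) (g := fun _ => κ) (fun v hv => ?_) ?_ continuousOn_const
    (by rwa [hcl])
  · have hn : domain d R ∈ 𝓝 v :=
      mem_of_superset (Metric.isOpen_ball.mem_nhds hv) Metric.ball_subset_closedBall
    simp only [jacobian, fderivWithin_of_mem_nhds hn]
    exact norm_fderiv_le_of_lipschitzOn ℝ hn hl
  · rw [hcl]
    exact hG.continuousOn.norm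

/-- The matrix `A` as a continuous linear map. -/
noncomputable abbrev matCLM (A : Matrix (Fin m) (Fin n) ℝ) :
    EuclideanSpace ℝ (Fin n) →L[ℝ] EuclideanSpace ℝ (Fin m) :=
  LinearMap.toContinuousLinearMap (Matrix.toEuclideanLin A)

/-- Derivative of the reconstruction loss within the domain. -/
noncomputable def lossDeriv (R : ℝ) (A : Matrix (Fin m) (Fin n) ℝ) (y : EuclideanSpace ℝ (Fin m))
    (G : EuclideanSpace ℝ (Fin d) → EuclideanSpace ℝ (Fin n)) (u : EuclideanSpace ℝ (Fin d)) :
    EuclideanSpace ℝ (Fin d) →L[ℝ] ℝ :=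
  -((2 : ℝ) • (innerSL ℝ (y - matCLM A (G u))).comp ((matCLM A).comp (jacobian R G u)))

lemma HasLipschitzJacobian.hasFDerivWithinAt_loss (hG : HasLipschitzJacobian R M G)
    {u : EuclideanSpace ℝ (Fin d)} (hu : u ∈ domain d R) :
    HasFDerivWithinAt (loss A y G) (lossDeriv R A y G u) (domain d R) u := by
  have h1 : HasFDerivWithinAt G (jacobian R G u) (domain d R) u :=
    (hG.1 u hu).hasFDerivWithinAt
  have h2 := (((matCLM A).hasFDerivAt.comp_hasFDerivWithinAt u h1).const_sub y).norm_sq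
  refine h2.congr_fderiv ?_
  ext w
  simp [lossDeriv, two_smul]

lemma HasLipschitzJacobian.gradientWithin_loss (hR : 0 < R) (hG : HasLipschitzJacobian R M G)
    {u : EuclideanSpace ℝ (Fin d)} (hu : u ∈ domain d R) :
    gradientWithin (loss A y G) (domain d R) u
      = (InnerProductSpace.toDual ℝ (EuclideanSpace ℝ (Fin d))).symm (lossDeriv R A y G u) := by
  rw [gradientWithin, (hG.hasFDerivWithinAt_loss hu).fderivWithin (uniqueDiffOn_domain hR u hu)]

/-- Since y = A G(z*), the residual is A applied to a difference of two values of G. -/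
lemma norm_residual_le (hA : specNorm A ≤ S) (hS : 0 ≤ S) (hB : IsBoundedGen R B G)
    {zstar : EuclideanSpace ℝ (Fin d)} (hz : zstar ∈ domain d R)
    (hy : y = Matrix.toEuclideanLin A (G zstar))
    {u : EuclideanSpace ℝ (Fin d)} (hu : u ∈ domain d R) : ‖y - matCLM A (G u)‖ ≤ 2 * S * B := by
  have e : y - matCLM A (G u) = matCLM A (G zstar - G u) := by rw [map_sub, hy]; rfl
  rw [e]
  refine ((matCLM A).le_opNorm _).trans ?_
  calc _ ≤ S * (B + B) := mul_le_mul hA ((norm_sub_le _ _).trans (add_le_add (hB _ hz) (hB _ hu)))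
        (norm_nonneg _) hS
    _ = _ := by ring

lemma norm_residual_sub_le (hA : specNorm A ≤ S) (hS : 0 ≤ S)
    (hlip : ∀ z ∈ domain d R, ∀ z' ∈ domain d R, ‖G z - G z'‖ ≤ κ * ‖z - z'‖)
    {u v : EuclideanSpace ℝ (Fin d)} (hu : u ∈ domain d R) (hv : v ∈ domain d R) :
    ‖(y - matCLM A (G v)) - (y - matCLM A (G u))‖ ≤ S * κ * ‖v - u‖ := by
  have e : (y - matCLM A (G v)) - (y - matCLM A (G u)) = matCLM A (G u - G v) := by
    rw [map_sub]; abel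
  rw [e]
  refine ((matCLM A).le_opNorm _).trans ?_
  rw [mul_assoc, norm_sub_rev v u]
  exact mul_le_mul hA (hlip _ hu _ hv) (norm_nonneg _) hS

lemma norm_comp_jacobian_le (hA : specNorm A ≤ S) (hS : 0 ≤ S) {u : EuclideanSpace ℝ (Fin d)}
    (hJ : ‖jacobian R G u‖ ≤ κ) : ‖(matCLM A).comp (jacobian R G u)‖ ≤ S * κ :=
  ((matCLM A).opNorm_comp_le _).trans (mul_le_mul hA hJ (norm_nonneg _) hS)

lemma norm_innerSL_comp_le (a : EuclideanSpace ℝ (Fin m))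
    (T : EuclideanSpace ℝ (Fin d) →L[ℝ] EuclideanSpace ℝ (Fin m)) :
    ‖(innerSL ℝ a).comp T‖ ≤ ‖a‖ * ‖T‖ := by
  simpa using (innerSL ℝ a).opNorm_comp_le T

lemma norm_lossDeriv_le (hA : specNorm A ≤ S) (hS : 0 ≤ S) (hB0 : 0 ≤ B)
    (hB : IsBoundedGen R B G)
    {zstar : EuclideanSpace ℝ (Fin d)} (hz : zstar ∈ domain d R)
    (hy : y = Matrix.toEuclideanLin A (G zstar))
    {u : EuclideanSpace ℝ (Fin d)} (hu : u ∈ domain d R) (hJ : ‖jacobian R G u‖ ≤ κ) :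
    ‖lossDeriv R A y G u‖ ≤ 4 * S ^ 2 * κ * B := by
  rw [lossDeriv, norm_neg, norm_smul, Real.norm_two]
  have h1 := (norm_innerSL_comp_le (y - matCLM A (G u)) ((matCLM A).comp (jacobian R G u))).trans
    (mul_le_mul (norm_residual_le hA hS hB hz hy hu) (norm_comp_jacobian_le hA hS hJ)
      (norm_nonneg _) (by positivity))
  linarith

lemma norm_lossDeriv_sub_le (hA : specNorm A ≤ S) (hS : 0 ≤ S) (hB0 : 0 ≤ B) (hκ : 0 ≤ κ)
    (hB : IsBoundedGen R B G) (hG : HasLipschitzJacobian R M G)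
    (hlip : ∀ z ∈ domain d R, ∀ z' ∈ domain d R, ‖G z - G z'‖ ≤ κ * ‖z - z'‖)
    {zstar : EuclideanSpace ℝ (Fin d)} (hz : zstar ∈ domain d R)
    (hy : y = Matrix.toEuclideanLin A (G zstar))
    {u v : EuclideanSpace ℝ (Fin d)} (hu : u ∈ domain d R) (hv : v ∈ domain d R)
    (hJ : ‖jacobian R G v‖ ≤ κ) :
    ‖lossDeriv R A y G v - lossDeriv R A y G u‖
      ≤ (4 * S ^ 2 * B * M + 2 * S ^ 2 * κ ^ 2) * ‖v - u‖ := by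
  set a := y - matCLM A (G u) with ha
  set b := y - matCLM A (G v) with hb
  -- Product rule for differences: the residual varies at rate Sκ and the Jacobian at rate M.
  have e : lossDeriv R A y G v - lossDeriv R A y G u
      = -((2 : ℝ) • ((innerSL ℝ (b - a)).comp ((matCLM A).comp (jacobian R G v))
        + (innerSL ℝ a).comp ((matCLM A).comp (jacobian R G v - jacobian R G u)))) := by
    ext w
    simp only [lossDeriv, ← ha, ← hb, map_sub, sub_apply,
      neg_apply, smul_apply,
      add_apply, ContinuousLinearMap.comp_apply, smul_eq_mul]
    ring
  have h1 := (norm_innerSL_comp_le (b - a) ((matCLM A).comp (jacobian R G v))).trans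
    (mul_le_mul (norm_residual_sub_le (y := y) hA hS hlip hu hv) (norm_comp_jacobian_le hA hS hJ)
      (norm_nonneg _) (by positivity))
  have h2 := (norm_innerSL_comp_le a ((matCLM A).comp (jacobian R G v - jacobian R G u))).trans
    (mul_le_mul (norm_residual_le hA hS hB hz hy hu)
      (((matCLM A).opNorm_comp_le _).trans (mul_le_mul hA (hG.2 v hv u hu) (norm_nonneg _) hS))
      (norm_nonneg _) (by positivity))
  rw [e, norm_neg, norm_smul, Real.norm_two]
  refine (mul_le_mul_of_nonneg_left ((norm_add_le _ _).trans (add_le_add h1 h2))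
    zero_le_two).trans (le_of_eq ?_)
  ring

/-- Mean value inequality on the part of s within ‖v - u‖ of u, where the derivative stays within
L‖v - u‖ of its value at u. The sharper constant L/2 is not needed. -/
lemma taylor_of_deriv_lipschitz {F : EuclideanSpace ℝ (Fin d) → ℝ}
    {F' : EuclideanSpace ℝ (Fin d) → EuclideanSpace ℝ (Fin d) →L[ℝ] ℝ} {L : ℝ} (hL : 0 ≤ L)
    {s : Set (EuclideanSpace ℝ (Fin d))} (hs : Convex ℝ s)
    (hF : ∀ u ∈ s, HasFDerivWithinAt F (F' u) s u)
    (hlip : ∀ u ∈ s, ∀ v ∈ s, ‖F' v - F' u‖ ≤ L * ‖v - u‖)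
    {u v : EuclideanSpace ℝ (Fin d)} (hu : u ∈ s) (hv : v ∈ s) :
    |F v - F u - F' u (v - u)| ≤ L * ‖v - u‖ ^ 2 := by
  have h := (hs.inter (convex_closedBall u ‖v - u‖)).norm_image_sub_le_of_norm_hasFDerivWithin_le'
    (f := F) (f' := F') (φ := F' u) (C := L * ‖v - u‖)
    (fun x hx => (hF x hx.1).mono inter_subset_left)
    (fun x hx => (hlip u hu x hx.1).trans (mul_le_mul_of_nonneg_left
      (by simpa [dist_eq_norm] using hx.2) hL))
    ⟨hu, by simp⟩ ⟨hv, by simp [dist_eq_norm]⟩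
  rw [Real.norm_eq_abs] at h
  refine h.trans (le_of_eq ?_)
  ring

/-- Under the step-size restrictions the truncated loss and gradient form a small step. -/
lemma smallStep_loss {β η σ r : ℝ} (hd : 1 ≤ d) (hR : 0 < R) (hB0 : 0 ≤ B) (hκ : 0 ≤ κ)
    (hM : 0 ≤ M) (hS : 0 ≤ S) (hA : specNorm A ≤ S) (hB : IsBoundedGen R B G)
    (hG : HasLipschitzJacobian R M G)
    (hlip : ∀ z ∈ domain d R, ∀ z' ∈ domain d R, ‖G z - G z'‖ ≤ κ * ‖z - z'‖)
    {zstar : EuclideanSpace ℝ (Fin d)} (hz : zstar ∈ domain d R)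
    (hy : y = Matrix.toEuclideanLin A (G zstar)) {L₁ L₂ : ℝ} (hL₁ : L₁ = 4 * S ^ 2 * κ * B)
    (hL₂ : L₂ = 4 * S ^ 2 * B * M + 2 * S ^ 2 * κ ^ 2)
    (hβ : 0 < β) (hη : 0 < η) (hσ : 0 < σ) (hr : 0 < r) (hσ2 : σ ^ 2 = 2 * η / β)
    (hr2 : r ^ 2 = 5 * d * σ ^ 2)
    (h1 : (5 * L₂ + L₁ * L₂) * η * d ≤ 1 / 100) (h2 : β * η ≤ 1) (h3 : β * σ * L₁ ≤ 1 / 200)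
    (h4 : 405 * σ * d ≤ R) :
    SmallStep R β η σ r L₁ L₂ ((domain d R).indicator (loss A y G))
      ((domain d R).indicator (gradientWithin (loss A y G) (domain d R))) := by
  have hmD : MeasurableSet (domain d R) := Metric.isClosed_closedBall.measurableSet
  have hJ : ∀ u ∈ domain d R, ‖jacobian R G u‖ ≤ κ := fun u hu =>
    hG.norm_jacobian_le hR hκ hlip hu
  have hL₁0 : 0 ≤ L₁ := by rw [hL₁]; positivity
  have hL₂0 : 0 ≤ L₂ := by rw [hL₂]; positivity
  have hD : ∀ u ∈ domain d R, HasFDerivWithinAt (loss A y G) (lossDeriv R A y G u) (domain d R) u :=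
    fun u hu => hG.hasFDerivWithinAt_loss hu
  have hN : ∀ u ∈ domain d R, ‖lossDeriv R A y G u‖ ≤ L₁ := fun u hu =>
    hL₁ ▸ norm_lossDeriv_le hA hS hB0 hB hz hy hu (hJ u hu)
  have hLip : ∀ u ∈ domain d R, ∀ v ∈ domain d R,
      ‖lossDeriv R A y G v - lossDeriv R A y G u‖ ≤ L₂ * ‖v - u‖ := fun u hu v hv =>
    hL₂ ▸ norm_lossDeriv_sub_le hA hS hB0 hκ hB hG hlip hz hy hu hv (hJ v hv)
  have hg : ∀ u ∈ domain d R,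
      (domain d R).indicator (gradientWithin (loss A y G) (domain d R)) u
        = (InnerProductSpace.toDual ℝ (EuclideanSpace ℝ (Fin d))).symm (lossDeriv R A y G u) :=
    fun u hu => by rw [indicator_of_mem hu, hG.gradientWithin_loss hR hu]
  have hgl : ∀ u ∈ domain d R, ∀ v ∈ domain d R,
      ‖(domain d R).indicator (gradientWithin (loss A y G) (domain d R)) v
        - (domain d R).indicator (gradientWithin (loss A y G) (domain d R)) u‖
        ≤ L₂ * ‖v - u‖ := fun u hu v hv => by
    rw [hg u hu, hg v hv, ← map_sub, LinearIsometryEquiv.norm_map]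
    exact hLip u hu v hv
  refine ⟨hd, hR, hβ, hη, hσ, hr, hσ2, hr2, hL₁0, hL₂0, ?_, ?_, ?_, hgl, ?_, ?_, h1, h2, h3, h4⟩
  · have hc : ContinuousOn (loss A y G) (domain d R) := fun u hu => (hD u hu).continuousWithinAt
    exact measurable_indicator_of_continuousOn hmD hc
  · have hc : ContinuousOn ((domain d R).indicator (gradientWithin (loss A y G) (domain d R)))
        (domain d R) := (LipschitzOnWith.of_dist_le' (K := L₂) fun u hu v hv => by
          simpa [dist_eq_norm] using hgl v hv u hu).continuousOn
    have := measurable_indicator_of_continuousOn hmD hc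
    rwa [indicator_indicator, inter_self] at this
  · intro u hu
    rw [hg u hu, LinearIsometryEquiv.norm_map]
    exact hN u hu
  · intro u hu v hv
    rw [indicator_of_mem hu, indicator_of_mem hv]
    exact convex_domain.norm_image_sub_le_of_norm_hasFDerivWithin_le hD hN hu hv
  · intro u hu v hv
    rw [indicator_of_mem hu, indicator_of_mem hv, hg u hu, InnerProductSpace.toDual_symm_apply]
    exact taylor_of_deriv_lipschitz hL₂0 convex_domain hD hLip hu hv

lemma gibbs_indicator (β : ℝ) (F : EuclideanSpace ℝ (Fin d) → ℝ) :
    gibbs R β ((domain d R).indicator F) = gibbs R β F := by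
  refine tilted_congr ?_
  filter_upwards [ae_restrict_mem (Metric.isClosed_closedBall.measurableSet :
    MeasurableSet (domain d R))] with u hu
  rw [indicator_of_mem hu]

end Loss

end CSSGLD

/-! ### Choice of the constants and conclusion. -/

namespace CSSGLD

lemma step_size_bounds {c η β ρ D : ℝ} (hc : 0 ≤ c) (hβ : 0 < β) (hD : 1 ≤ D)
    (h : η ≤ c * min (min (1 / D) (ρ ^ 2 / (β * D ^ 2))) (min (1 / β) (β / D ^ 2))) :
    η * D ≤ c ∧ η * (β * D ^ 2) ≤ c * ρ ^ 2 ∧ η * β ≤ c ∧ η * D ^ 2 ≤ c * β := by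
  have hD0 : 0 < D := by linarith
  have key : ∀ a b, 0 < b → min (min (1 / D) (ρ ^ 2 / (β * D ^ 2))) (min (1 / β) (β / D ^ 2))
      ≤ a / b → η * b ≤ c * a := fun a b hb hm => by
    have := h.trans (mul_le_mul_of_nonneg_left hm hc)
    rwa [← mul_div_assoc, le_div_iff₀ hb] at this
  refine ⟨?_, key _ _ (by positivity) ((min_le_left _ _).trans (min_le_right _ _)), ?_,
    key _ _ (by positivity) ((min_le_right _ _).trans (min_le_right _ _))⟩
  · simpa using key 1 D hD0 ((min_le_left _ _).trans (min_le_left _ _))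
  · simpa using key 1 β hβ ((min_le_right _ _).trans (min_le_left _ _))

lemma mul_one_sub_pow_le {lam a ε : ℝ} (hl : 0 < lam) (hε : 0 < ε) (ha : a ≤ 1) {k : ℕ}
    (hk : Real.log (2 * lam / ε) ≤ a * k) : lam * (1 - a) ^ k ≤ ε / 2 := by
  have h1 : (1 - a) ^ k ≤ Real.exp (-a) ^ k :=
    pow_le_pow_left₀ (by linarith) (Real.one_sub_le_exp_neg a) k
  have h2 : Real.exp (-a) ^ k ≤ ε / (2 * lam) := by
    rw [← Real.exp_nat_mul]
    calc Real.exp (k * -a) ≤ Real.exp (-Real.log (2 * lam / ε)) :=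
          Real.exp_le_exp.2 (by linarith)
      _ = ε / (2 * lam) := by
          rw [Real.exp_neg, Real.exp_log (by positivity), inv_div]
  calc lam * (1 - a) ^ k ≤ lam * (ε / (2 * lam)) :=
        mul_le_mul_of_nonneg_left (h1.trans h2) hl.le
    _ = ε / 2 := by field_simp

/-- Each step-size restriction has its use: ηD ≤ c bounds the curvature error, ηβ ≤ c the
temperature and drift terms, ηD² ≤ cβ keeps steps inside the ball, and ηβD² ≤ cρ² makes the
perturbation smaller than the spectral gap. -/
lemma smallStep_constants {R L₁ L c η β ρ D σ : ℝ} (hR : 0 < R) (hL₁0 : 0 ≤ L₁) (hL0 : 0 ≤ L)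
    (hc : 0 < c) (hc1 : c * (10 ^ 16 * (L + 1) ^ 2) ≤ 1)
    (hc2 : c * (80000 * (L₁ + 1) ^ 2) ≤ 1) (hc3 : c * 328050 ≤ R ^ 2) (hD : 1 ≤ D)
    (hβ : 0 < β) (hρ : 0 < ρ) (hη : 0 < η) (hσ : 0 < σ) (hσ2 : σ ^ 2 = 2 * η / β)
    (hηc : η ≤ c * min (min (1 / D) (ρ ^ 2 / (β * D ^ 2))) (min (1 / β) (β / D ^ 2))) :
    L * η * D ≤ 1 / 100 ∧ β * η ≤ 1 ∧ β * σ * L₁ ≤ 1 / 200 ∧ 405 * σ * D ≤ R ∧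
      432 * (L * η * D) ^ 2 ≤ ρ ^ 2 * η / (2 * 10 ^ 13 * β) := by
  obtain ⟨e1, e2, e3, e4⟩ := step_size_bounds hc.le hβ hD hηc
  clear hηc
  have hc4 : c * (L + 1) ^ 2 ≤ 1 / 10 ^ 16 := by linarith
  have hcL := mul_nonneg hc.le hL0
  have hcL2 := mul_nonneg hcL hL0
  have hexp : c * (L + 1) ^ 2 = L ^ 2 * c + 2 * (c * L) + c := by ring
  rw [hexp] at hc4
  have hLc2 : L ^ 2 * c ≤ 1 / 10 ^ 16 := by linarith
  refine ⟨?_, ?_, ?_, ?_, ?_⟩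
  · have := mul_le_mul_of_nonneg_left e1 hL0
    nlinarith
  · nlinarith
  · refine (sq_le_sq₀ (by positivity) (by norm_num)).1 ?_
    have e : (β * σ * L₁) ^ 2 = 2 * (η * β) * L₁ ^ 2 := by
      rw [mul_pow, mul_pow, hσ2]; field_simp
    have := mul_le_mul_of_nonneg_right e3 (sq_nonneg L₁)
    have a2 : c * L₁ ^ 2 ≤ c * (L₁ + 1) ^ 2 :=
      mul_le_mul_of_nonneg_left (pow_le_pow_left₀ hL₁0 (by linarith) 2) hc.le
    rw [e]
    linarith
  · refine (sq_le_sq₀ (by positivity) hR.le).1 ?_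
    have e : (405 * σ * D) ^ 2 = 328050 * (η * D ^ 2 / β) := by
      rw [mul_pow, mul_pow, hσ2]; ring
    have : η * D ^ 2 / β ≤ c := by rwa [div_le_iff₀ hβ]
    rw [e]
    linarith
  · rw [le_div_iff₀ (by positivity)]
    have a1 := mul_le_mul_of_nonneg_left e2 (by positivity : 0 ≤ L ^ 2 * η)
    have a2 := mul_le_mul_of_nonneg_left hLc2 (by positivity : 0 ≤ ρ ^ 2 * η)
    have a3 : 0 ≤ ρ ^ 2 * η := by positivity
    calc _ = 432 * 2 * 10 ^ 13 * (L ^ 2 * η * (η * (β * D ^ 2))) := by ring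
      _ ≤ 432 * 2 * 10 ^ 13 * (L ^ 2 * η * (c * ρ ^ 2)) := by linarith
      _ = 432 * 2 * 10 ^ 13 * (ρ ^ 2 * η * (L ^ 2 * c)) := by ring
      _ ≤ 432 * 2 * 10 ^ 13 * (ρ ^ 2 * η * (1 / 10 ^ 16)) := by linarith
      _ ≤ _ := by linarith

/-- The squared perturbation is quadratic in η and the contraction rate is linear, so the residual
variance is linear in η. -/
lemma sqrt_bias_le {L η β ρ D : ℝ} (hL0 : 0 ≤ L) (hD : 0 < D) (hβ : 0 < β) (hρ : 0 < ρ)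
    (hη : 0 < η) : √(432 * (L * η * D) ^ 2 / (ρ ^ 2 * η / (2 * 10 ^ 13 * β)))
      ≤ 10 ^ 8 * (L + 1) * D * √β / ρ * √η := by
  refine Real.sqrt_le_iff.2 ⟨by positivity, ?_⟩
  have e : (10 ^ 8 * (L + 1) * D * √β / ρ * √η) ^ 2
      = 10 ^ 16 * (L + 1) ^ 2 * (D ^ 2 * β * η / ρ ^ 2) := by
    rw [mul_pow, div_pow, mul_pow, mul_pow, Real.sq_sqrt hβ.le, Real.sq_sqrt hη.le]; ring
  have e' : 432 * (L * η * D) ^ 2 / (ρ ^ 2 * η / (2 * 10 ^ 13 * β))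
      = 864 * 10 ^ 13 * L ^ 2 * (D ^ 2 * β * η / ρ ^ 2) := by
    field_simp; ring
  rw [e, e']
  refine mul_le_mul_of_nonneg_right ?_ (by positivity)
  nlinarith

/-- The total variation bound for CS-SGLD in terms of the constants of the problem. -/
lemma tvDist_law_loss_le {d n m : ℕ} {R B κ M S : ℝ} (hR : 0 < R) (hB0 : 0 ≤ B) (hκ : 0 ≤ κ)
    (hM : 0 ≤ M) (hS : 0 ≤ S) {L₁ L₂ c : ℝ} (hL₁ : L₁ = 4 * S ^ 2 * κ * B)
    (hL₂ : L₂ = 4 * S ^ 2 * B * M + 2 * S ^ 2 * κ ^ 2) (hc : 0 < c)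
    (hc1 : c * (10 ^ 16 * (5 * L₂ + L₁ * L₂ + 1) ^ 2) ≤ 1)
    (hc2 : c * (80000 * (L₁ + 1) ^ 2) ≤ 1) (hc3 : c * 328050 ≤ R ^ 2)
    {A : Matrix (Fin m) (Fin n) ℝ}
    {G : EuclideanSpace ℝ (Fin d) → EuclideanSpace ℝ (Fin n)} {y : EuclideanSpace ℝ (Fin m)}
    {zstar : EuclideanSpace ℝ (Fin d)} {β ρ lam η : ℝ} {μ₀ : Measure (EuclideanSpace ℝ (Fin d))}
    (hd : 1 ≤ d) (hA : specNorm A ≤ S) (hB : IsBoundedGen R B G)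
    (hlip : ∀ z ∈ domain d R, ∀ z' ∈ domain d R, ‖G z - G z'‖ ≤ κ * ‖z - z'‖)
    (hG : HasLipschitzJacobian R M G)
    (hz : zstar ∈ domain d R) (hy : y = Matrix.toEuclideanLin A (G zstar))
    (hβ : 0 < β) (hρ : 0 < ρ) (hch : HasCheegerConstant R ρ (gibbs R β (loss A y G)))
    [IsProbabilityMeasure μ₀] (hw : IsWarmStart R lam μ₀ (gibbs R β (loss A y G)))
    (hη : 0 < η)
    (hηc : η ≤ c * min (min (1 / (d : ℝ)) (ρ ^ 2 / (β * (d : ℝ) ^ 2)))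
      (min (1 / β) (β / (d : ℝ) ^ 2))) :
    1 ≤ lam ∧ 1 / (4 * 10 ^ 13) * ρ ^ 2 / β * η ≤ 1 ∧ ∀ k : ℕ,
      tvDist (law R β η (√(10 * η * (d : ℝ) / β)) (loss A y G) μ₀ k) (gibbs R β (loss A y G))
        ≤ lam * (1 - 1 / (4 * 10 ^ 13) * ρ ^ 2 / β * η) ^ k
          + (10 ^ 8 * (5 * L₂ + L₁ * L₂ + 1) * (d : ℝ) * √β / ρ) * √η := by
  have hD : (1 : ℝ) ≤ d := by exact_mod_cast hd
  have hD0 : (0 : ℝ) < d := by linarith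
  have hL₁0 : 0 ≤ L₁ := by rw [hL₁]; positivity
  have hL₂0 : 0 ≤ L₂ := by rw [hL₂]; positivity
  obtain ⟨L, hL⟩ : ∃ L, L = 5 * L₂ + L₁ * L₂ := ⟨_, rfl⟩
  have hL0 : 0 ≤ L := by rw [hL]; positivity
  rw [← hL] at hc1 ⊢
  have hσ2 : √(2 * η / β) ^ 2 = 2 * η / β := Real.sq_sqrt (by positivity)
  have hσ : 0 < √(2 * η / β) := Real.sqrt_pos.2 (by positivity)
  obtain ⟨h1, h2, h3, h4, hΔ⟩ := smallStep_constants hR hL₁0 hL0 hc hc1 hc2 hc3 hD hβ hρ hη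
    hσ hσ2 hηc
  obtain ⟨σ, hσdef⟩ : ∃ σ, σ = √(2 * η / β) := ⟨_, rfl⟩
  rw [← hσdef] at hσ hσ2 h3 h4
  have hr2 : √(10 * η * (d : ℝ) / β) ^ 2 = 5 * d * σ ^ 2 := by
    rw [Real.sq_sqrt (by positivity), hσ2]; ring
  have hr : 0 < √(10 * η * (d : ℝ) / β) := Real.sqrt_pos.2 (by positivity)
  have hcurv : curvErr η L₁ L₂ d = L * η * d := by rw [hL, curvErr]
  rw [← hcurv] at hΔ
  have hs := smallStep_loss (r := √(10 * η * (d : ℝ) / β)) hd hR hB0 hκ hM hS hA hB hG hlip hz hy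
    hL₁ hL₂ hβ hη hσ hr hσ2 hr2 (hL ▸ h1) h2 h3 h4
  -- The loss extended by zero off the ball is globally measurable and defines the same Gibbs
  -- measure.
  rw [← gibbs_indicator] at hch hw ⊢
  have hx1 := hs.rate_le_one hρ hch rfl
  have hmain := hs.tvDist_law_le (F₀ := loss A y G) (fun u hu => (indicator_of_mem hu _).symm)
    hσdef.symm hρ hch rfl hΔ hw
  have hrate : 1 / (4 * 10 ^ 13) * ρ ^ 2 / β * η = ρ ^ 2 * η / (2 * 10 ^ 13 * β) / 2 := by
    field_simp; norm_num
  rw [hrate]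
  refine ⟨(hmain 0).1, by linarith, fun k => (hmain k).2.trans (add_le_add_right ?_ _)⟩
  rw [hcurv]
  exact sqrt_bias_le hL0 hD0 hβ hρ hη

end CSSGLD

theorem mainTheorem2 :
    ∃ c₀ : ℝ, 0 < c₀ ∧
    ∀ R B κ M S : ℝ, 0 < R → 0 < B → 0 < κ → 0 ≤ M → 0 ≤ S →
    ∃ c c₁ c₂ c₃ : ℝ, 0 < c ∧ 0 < c₁ ∧ 0 < c₂ ∧ 0 < c₃ ∧
    ∀ (d n m : ℕ) (A : Matrix (Fin m) (Fin n) ℝ)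
      (G : EuclideanSpace ℝ (Fin d) → EuclideanSpace ℝ (Fin n))
      (zstar : EuclideanSpace ℝ (Fin d)) (y : EuclideanSpace ℝ (Fin m))
      (ι α γ β ρ lam η : ℝ) (μ₀ : Measure (EuclideanSpace ℝ (Fin d))),
      1 ≤ d →
      CSSGLD.specNorm A ≤ S →
      CSSGLD.IsBoundedGen R B G →
      CSSGLD.IsNearIsometry R ι κ G →
      CSSGLD.HasLipschitzJacobian R M G →
      CSSGLD.IsStronglySmooth R α γ G →
      zstar ∈ CSSGLD.domain d R →
      y = Matrix.toEuclideanLin A (G zstar) →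
      0 < β →
      0 < ρ →
      CSSGLD.HasCheegerConstant R ρ (CSSGLD.gibbs R β (CSSGLD.loss A y G)) →
      IsProbabilityMeasure μ₀ →
      CSSGLD.IsWarmStart R lam μ₀ (CSSGLD.gibbs R β (CSSGLD.loss A y G)) →
      0 < η →
      η ≤ c * min (min (1 / (d : ℝ)) (ρ ^ 2 / (β * (d : ℝ) ^ 2)))
            (min (1 / β) (β / (d : ℝ) ^ 2)) →
      (∀ k : ℕ,
        CSSGLD.tvDist
            (CSSGLD.law R β η (√(10 * η * (d : ℝ) / β)) (CSSGLD.loss A y G) μ₀ k)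
            (CSSGLD.gibbs R β (CSSGLD.loss A y G))
          ≤ lam * (1 - (c₀ * ρ ^ 2 / β) * η) ^ k + (c₁ * (d : ℝ) * √β / ρ) * √η) ∧
      (∀ ε τ : ℝ, 0 < ε → 0 < τ →
        τ * (c₂ * ρ ^ 2 * ε ^ 2 / ((d : ℝ) ^ 2 * β)) ≤ η →
        η ≤ c₂ * ρ ^ 2 * ε ^ 2 / ((d : ℝ) ^ 2 * β) →
        ∀ k : ℕ,
          (c₃ / τ) * ((d : ℝ) ^ 2 * β ^ 2 / (ρ ^ 4 * ε ^ 2)) * Real.log (2 * lam / ε) ≤ (k : ℝ) →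
          CSSGLD.tvDist
              (CSSGLD.law R β η (√(10 * η * (d : ℝ) / β)) (CSSGLD.loss A y G) μ₀ k)
              (CSSGLD.gibbs R β (CSSGLD.loss A y G))
            ≤ ε) := by
  refine ⟨1 / (4 * 10 ^ 13), by norm_num, fun R B κ M S hR hB0 hκ hM hS => ?_⟩
  obtain ⟨L₁, hL₁⟩ : ∃ L₁, L₁ = 4 * S ^ 2 * κ * B := ⟨_, rfl⟩
  obtain ⟨L₂, hL₂⟩ : ∃ L₂, L₂ = 4 * S ^ 2 * B * M + 2 * S ^ 2 * κ ^ 2 := ⟨_, rfl⟩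
  have hL₁0 : 0 ≤ L₁ := by rw [hL₁]; positivity
  have hL₂0 : 0 ≤ L₂ := by rw [hL₂]; positivity
  obtain ⟨c₁, hc₁⟩ : ∃ c₁, c₁ = 10 ^ 8 * (5 * L₂ + L₁ * L₂ + 1) := ⟨_, rfl⟩
  have hc₁0 : 0 < c₁ := by rw [hc₁]; positivity
  obtain ⟨c, hc⟩ : ∃ c, c = min (1 / (10 ^ 16 * (5 * L₂ + L₁ * L₂ + 1) ^ 2))
      (min (1 / (80000 * (L₁ + 1) ^ 2)) (R ^ 2 / 328050)) := ⟨_, rfl⟩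
  have hc0 : 0 < c := by
    rw [hc]
    exact lt_min (by positivity) (lt_min (by positivity) (by positivity))
  -- With c₂ = 1/(4c₁²) the bias at the largest allowed step is exactly ε/2, and c₃ is fixed by
  -- c₀c₂c₃ = 1, which makes the exponent at the smallest allowed step and k reach log(2λ/ε).
  refine ⟨c, c₁, 1 / (4 * c₁ ^ 2), 16 * 10 ^ 13 * c₁ ^ 2, hc0, hc₁0, by positivity,
    by positivity, ?_⟩
  intro d n m A G zstar y ι α γ β ρ lam η μ₀ hd hA hB hiso hG _ hz hy hβ hρ hch hμ₀ hw hη hηc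
  have hD0 : (0 : ℝ) < d := by exact_mod_cast hd
  obtain ⟨hlam, ha, htv⟩ := CSSGLD.tvDist_law_loss_le hR hB0.le hκ.le hM hS hL₁ hL₂ hc0
    ((le_div_iff₀ (by positivity)).1 (hc ▸ min_le_left _ _))
    ((le_div_iff₀ (by positivity)).1 (hc ▸ (min_le_right _ _).trans (min_le_left _ _)))
    ((le_div_iff₀ (by positivity)).1 (hc ▸ (min_le_right _ _).trans (min_le_right _ _)))
    hd hA hB (fun z hz z' hz' => (hiso.2.2 z hz z' hz').2) hG hz hy hβ hρ hch hw hη hηc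
  rw [← hc₁] at htv
  refine ⟨htv, fun ε τ hε hτ hη1 hη2 k hk => (htv k).trans ?_⟩
  have hbias : c₁ * d * √β / ρ * √η ≤ ε / 2 := by
    refine (sq_le_sq₀ (by positivity) (by positivity)).1 ?_
    have e : (c₁ * d * √β / ρ * √η) ^ 2 = c₁ ^ 2 * d ^ 2 * β / ρ ^ 2 * η := by
      rw [mul_pow, div_pow, mul_pow, mul_pow, Real.sq_sqrt hβ.le, Real.sq_sqrt hη.le]
    rw [e]
    refine (mul_le_mul_of_nonneg_left hη2 (by positivity)).trans (le_of_eq ?_)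
    field_simp
    norm_num
  -- The lower bound on η through τ enters only here, to bound the accumulated contraction from
  -- below.
  have hlog : Real.log (2 * lam / ε) ≤ 1 / (4 * 10 ^ 13) * ρ ^ 2 / β * η * k := by
    have a1 := mul_le_mul_of_nonneg_right (mul_le_mul_of_nonneg_left hη1
      (by positivity : 0 ≤ 1 / (4 * 10 ^ 13) * ρ ^ 2 / β)) (k.cast_nonneg (α := ℝ))
    refine le_trans ?_ a1
    refine le_trans (le_of_eq ?_) (mul_le_mul_of_nonneg_left hk (by positivity))
    generalize Real.log (2 * lam / ε) = l
    field_simp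
    norm_num
  have hmix := CSSGLD.mul_one_sub_pow_le (by linarith : 0 < lam) hε ha hlog
  linarith
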